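/- Let $d\ge 1$, $\mathcal S=\{x\in[0,1]^d:\|x\|_1\le 1\}$, $\mathrm{Int}(\mathcal S)=\{x\in(0,1)^d:\|x\|_1<1\}$, where $\|x\|_1=\sum_{i=1}^d|x_i|$. Let $X_1,X_2,\dots$ be i.i.d. random vectors with a density $f$ supported on $\mathcal S$ which is twice continuously differentiable on $\mathcal S$. For $m,n\in\mathbb N$ let $$\hat f_{n,m}(x)=\sum_{k\in\mathbb N_0^d,\ \|k\|_1\le m-1} c_m\Big\{\frac1n\sum_{i=1}^n \mathbf 1_{(\frac km,\frac{k+1}m]}(X_i)\Big\}\frac{(m-1)!}{(m-1-\|k\|_1)!\prod_{i=1}^d k_i!}(1-\|x\|_1)^{m-1-\|k\|_1}\prod_{i=1}^d x_i^{k_i},$$ where $(\frac km,\frac{k+1}m]=\prod_{i=1}^d(\frac{k_i}m,\frac{k_i+1}m]$ and the normalizing factor is either $c_m=m^d$ or $c_m=\frac{(m-1+d)!}{(m-1)!}$ (these coincide for $d=1$). Put $\mathrm{MSE}[\hat f_{n,m}(x)]=\mathbb E\big[|\hat f_{n,m}(x)-f(x)|^2\big]$, $\psi(x)=[(4\pi)^d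 x_1\cdots x_d(1-\|x\|_1)]^{-1/2}$ and $$b(x)=\kappa f(x)+\sum_{i=1}^d\big(\tfrac12-x_i\big)\frac{\partial f}{\partial x_i}(x)+\frac12\sum_{i,j=1}^d\big(x_i\mathbf 1_{\{i=j\}}-x_ix_j\big)\frac{\partial^2 f}{\partial x_i\partial x_j}(x),$$ where $\kappa=0$ if $c_m=m^d$, and $\kappa=\frac{d(d-1)}2$ if $c_m=\frac{(m-1+d)!}{(m-1)!}$. For either choice of $c_m$ the following holds. (a) For every sequence $m=m(n)\to\infty$ and all $x\in\mathrm{Int}(\mathcal S)$, as $n\to\infty$, $$\mathrm{MSE}[\hat f_{n,m}(x)]=n^{-1}m^{d/2}\psi(x)f(x)+m^{-2}b^2(x)+\mathrm o_x(n^{-1}m^{d/2})+\mathrm o(m^{-2}),$$ where the term $\mathrm o_x(n^{-1}m^{d/2})$ may depend on $x$, and the term $\mathrm o(m^{-2})$ is uniform over $\{x\in\mathrm{Int}(\mathcal S):\|x\|_1\le1-\delta\}$ for each $\delta>0$ (and uniform over all of $\mathrm{Int}(\mathcal S)$ if $d=1$). (b) Let $x\in\mathrm{Int}(\mathcal S)$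 with $f(x)\,b(x)\ne0$ and put $$m_{\mathrm{opt}}(x)=n^{2/(d+4)}\Big[\frac4d\cdot\frac{b^2(x)}{\psi(x)f(x)}\Big]^{2/(d+4)}.$$ This is the asymptotically optimal choice of $m$ with respect to the MSE at $x$: for a sequence of integers $m=m(n)$, we have $m(n)/m_{\mathrm{opt}}(x)\to1$ if and only if $m(n)\to\infty$ and, for every integer sequence $m'(n)\to\infty$ and every $\varepsilon>0$, $\mathrm{MSE}[\hat f_{n,m(n)}(x)]\le(1+\varepsilon)\,\mathrm{MSE}[\hat f_{n,m'(n)}(x)]$ for all large $n$. For every integer sequence with $m(n)/m_{\mathrm{opt}}(x)\to1$ (for instance $m_{\mathrm{opt}}(x)$ rounded to an integer), $$\mathrm{MSE}[\hat f_{n,m}(x)]=n^{-4/(d+4)}\left[\frac{\frac4d+1}{(\frac4d)^{\frac4{d+4}}}\right]\frac{(\psi(x)f(x))^{4/(d+4)}}{(b^2(x))^{-d/(d+4)}}+\mathrm o_x(n^{-4/(d+4)}).$$ (c) More generally, for $x\in\mathrm{Int}(\mathcal S)$, if $n^{2/(d+4)}m^{-1}\to\lambda$ for some $\lambda>0$,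 then $$\mathrm{MSE}[\hat f_{n,m}(x)]=n^{-4/(d+4)}\big[\lambda^{-d/2}\psi(x)f(x)+\lambda^2b^2(x)\big]+\mathrm o_x(n^{-4/(d+4)}).$$ -/

import Mathlib

open MeasureTheory ProbabilityTheory Filter Topology Asymptotics

noncomputable section

namespace BernsteinSimplex

/-- The norm `‖x‖₁ = ∑ᵢ |xᵢ|`. -/
def l1 {d : ℕ} (x : Fin d → ℝ) : ℝ := ∑ i, |x i|

/-- The `d`-dimensional unit simplex `{x ∈ [0,1]^d : ‖x‖₁ ≤ 1}`. -/
def simplex (d : ℕ) : Set (Fin d → ℝ) :=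
  {x | (∀ i, x i ∈ Set.Icc (0 : ℝ) 1) ∧ l1 x ≤ 1}

/-- The interior `{x ∈ (0,1)^d : ‖x‖₁ < 1}` of the simplex. -/
def simplexInt (d : ℕ) : Set (Fin d → ℝ) :=
  {x | (∀ i, x i ∈ Set.Ioo (0 : ℝ) 1) ∧ l1 x < 1}

/-- The lattice points `ℕ₀^d ∩ r 𝒮`, that is, the `k ∈ ℕ₀^d` with `k₁ + ⋯ + k_d ≤ r`. -/
def lattice (d r : ℕ) : Finset (Fin d → ℕ) :=
  (Fintype.piFinset fun _ => Finset.range (r + 1)).filter fun k => ∑ i, k i ≤ r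

/-- The `Multinomial(r, x)` probability of the lattice point `k` (with `k₁ + ⋯ + k_d ≤ r`). -/
def multinomialProb {d : ℕ} (k : Fin d → ℕ) (r : ℕ) (x : Fin d → ℝ) : ℝ :=
  ((r.factorial : ℝ) / (((r - ∑ i, k i).factorial : ℝ) * ∏ i, ((k i).factorial : ℝ)))
    * (1 - l1 x) ^ (r - ∑ i, k i) * ∏ i, x i ^ k i

/-- The hypercube `(k/m, (k+1)/m]`. -/
def cell {d : ℕ} (m : ℕ) (k : Fin d → ℕ) : Set (Fin d → ℝ) :=
  Set.pi Set.univ fun i => Set.Ioc ((k i : ℝ) / m) (((k i : ℝ) + 1) / m)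

/-- The two normalizations in use for the Bernstein density estimator. -/
inductive Normalization : Type
  /-- The factor `(m-1+d)!/(m-1)!`, for which the estimator is a mixture of Dirichlet densities. -/
  | dirichlet
  /-- The factor `m^d`, the inverse of the volume of a hypercube. -/
  | volume

/-- The normalizing factor of the estimator (for `m ≥ 1`). -/
def Normalization.factor (N : Normalization) (d m : ℕ) : ℝ :=
  match N with
  | .dirichlet => ((m - 1 + d).factorial : ℝ) / ((m - 1).factorial : ℝ)
  | .volume => (m : ℝ) ^ d

/-- The Bernstein density estimator `f̂_{n,m}(x)` built on the first `n` observations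
`X 0, …, X (n-1)`, evaluated at the outcome `ω` (meaningful for `m, n ≥ 1`). -/
def densityEstimator {d : ℕ} {Ω : Type*} (N : Normalization) (X : ℕ → Ω → Fin d → ℝ)
    (n m : ℕ) (x : Fin d → ℝ) (ω : Ω) : ℝ :=
  ∑ k ∈ lattice d (m - 1),
    N.factor d m
      * ((1 / (n : ℝ)) * ∑ i ∈ Finset.range n, (cell m k).indicator (fun _ => (1 : ℝ)) (X i ω))
      * multinomialProb k (m - 1) x

/-- The mean squared error `𝔼[|f̂_{n,m}(x) - f(x)|²]`. -/
def mse {d : ℕ} {Ω : Type*} [MeasurableSpace Ω] (P : Measure Ω) (N : Normalization)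
    (X : ℕ → Ω → Fin d → ℝ) (f : (Fin d → ℝ) → ℝ) (n m : ℕ) (x : Fin d → ℝ) : ℝ :=
  ∫ ω, |densityEstimator N X n m x ω - f x| ^ 2 ∂P

/-- The partial derivative `∂f/∂xᵢ`. -/
def pderiv {d : ℕ} (i : Fin d) (f : (Fin d → ℝ) → ℝ) (x : Fin d → ℝ) : ℝ :=
  fderiv ℝ f x (Pi.single i 1)

/-- `∑ᵢ (1/2 - xᵢ) ∂ᵢf(x) + 1/2 ∑ᵢⱼ (xᵢ 1_{i=j} - xᵢ xⱼ) ∂ᵢ∂ⱼf(x)`. -/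
def biasDiff {d : ℕ} (f : (Fin d → ℝ) → ℝ) (x : Fin d → ℝ) : ℝ :=
  (∑ i, (1 / 2 - x i) * pderiv i f x)
    + (1 / 2) * ∑ i, ∑ j, ((if i = j then x i else 0) - x i * x j) * pderiv i (pderiv j f) x

/-- The bias function `b`. The factor `(m-1+d)!/(m-1)!` exceeds `m^d` by the relative amount
`d(d-1)/(2m) + O(m⁻²)`, which adds `(d(d-1)/2) f(x)` to `b(x)`. -/
def Normalization.bias {d : ℕ} (N : Normalization) (f : (Fin d → ℝ) → ℝ) (x : Fin d → ℝ) : ℝ :=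
  match N with
  | .dirichlet => ((d : ℝ) * ((d : ℝ) - 1) / 2) * f x + biasDiff f x
  | .volume => biasDiff f x

/-- `ψ(x) = [(4π)^d x₁ ⋯ x_d (1 - ‖x‖₁)]^{-1/2}`. -/
def psi {d : ℕ} (x : Fin d → ℝ) : ℝ :=
  ((4 * Real.pi) ^ d * (∏ i, x i) * (1 - l1 x)) ^ (-(1 / 2) : ℝ)

/-- `m_opt(x) = n^{2/(d+4)} [(4/d) b²(x) / (ψ(x) f(x))]^{2/(d+4)}`, a real number. -/
def mOpt {d : ℕ} (N : Normalization) (f : (Fin d → ℝ) → ℝ) (x : Fin d → ℝ) (n : ℕ) : ℝ :=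
  (n : ℝ) ^ (2 / ((d : ℝ) + 4))
    * ((4 / (d : ℝ)) * (N.bias f x ^ 2 / (psi x * f x))) ^ (2 / ((d : ℝ) + 4))

/-- A sequence of bandwidths `m = m(n) → ∞` is asymptotically optimal for the risk `R n m` if
every competitor `m' = m'(n) → ∞` satisfies `R n (m n) ≤ (1 + o(1)) R n (m' n)`. -/
def IsAsympOptimal (R : ℕ → ℕ → ℝ) (m : ℕ → ℕ) : Prop :=
  Tendsto m atTop atTop ∧
    ∀ m' : ℕ → ℕ, Tendsto m' atTop atTop →
      ∀ ε : ℝ, 0 < ε → ∀ᶠ n in atTop, R n (m n) ≤ (1 + ε) * R n (m' n)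

end BernsteinSimplex

end

open BernsteinSimplex

namespace BernsteinSimplex

/-! ### Sums against multinomial weights -/

/-! The estimator is an average of `n` independent copies of a bounded kernel, so its mean squared
error is exactly (variance of one copy) / n plus the squared bias (`mse_eq`). Both ingredients are
finite sums over lattice points `k`, weighted by the probabilities p_k of a Multinomial(m - 1, x)
vector K and involving the averages of `f` over the cells. No further probability is needed: what
remains is the asymptotics of these sums as m → ∞.

Bias. On a cell inside the simplex, the average of `f` is close to a second order Taylor polynomial
at `x`. The mean of (K + 1/2)/m - x is (1/2 - x)/m and the covariance of K/m is of order 1/m, which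
produces the two terms of `biasDiff`. The Taylor remainder is at most ε‖v‖² + C‖v‖⁴, so second and
fourth moments of K control it uniformly in `x`. Cells sticking out of the simplex have
exponentially small mass when ‖x‖₁ ≤ 1 - δ, and do not occur when d = 1. The normalizing factor adds
κ f(x).

Variance. The cells are disjoint, so the second moment of the kernel is governed by ∑ p_k² times
cell averages. By Parseval, (2π)^d ∑ p_k² is the integral over the torus of |φ|^{2r}, where φ is the
characteristic function of one trial and r = m - 1. Laplace's method
(`tendsto_integral_norm_trialCharFun_pow`) and an explicit Gaussian integral
(`integral_exp_neg_trialCov`) show that ∑ p_k² is asymptotic to r^{-d/2} ψ(x). The same method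
bounds max p_k by a multiple of r^{-d/2}, which allows the cell averages to be replaced by f(x).

Optimization. With z = m / m_opt, the leading part of the risk is proportional to (4/d) z^{d/2} +
z⁻². This exceeds its minimum 4/d + 1 by at least (1/z - 1)² (`le_four_div_mul_rpow_add`). The
quantitative gap shows that a sequence is asymptotically optimal exactly when z → 1. -/

theorem mem_lattice {d r : ℕ} {k : Fin d → ℕ} : k ∈ lattice d r ↔ ∑ i, k i ≤ r := by
  simp only [lattice, Finset.mem_filter, Fintype.mem_piFinset, Finset.mem_range,
    and_iff_right_iff_imp]
  intro h i
  have := Finset.single_le_sum (f := k) (fun _ _ => Nat.zero_le _) (Finset.mem_univ i)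
  omega

/-- The mean of `g(K)` for `K ∼ Multinomial(r, x)`. -/
noncomputable def multinomialMean {d : ℕ} {V : Type*} [AddCommGroup V] [Module ℝ V] (r : ℕ)
    (x : Fin d → ℝ) (g : (Fin d → ℕ) → V) : V :=
  ∑ k ∈ lattice d r, multinomialProb k r x • g k

theorem sum_add_single {d : ℕ} (k : Fin d → ℕ) (j : Fin d) :
    ∑ i, (k + Pi.single j 1 : Fin d → ℕ) i = ∑ i, k i + 1 := by
  simp [Finset.sum_add_distrib]

theorem prod_add_single {d : ℕ} (F : Fin d → ℕ → ℝ) (k : Fin d → ℕ) (j : Fin d) (c : ℝ)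
    (h : F j (k j + 1) = c * F j (k j)) :
    ∏ i, F i ((k + Pi.single j 1 : Fin d → ℕ) i) = c * ∏ i, F i (k i) := by
  rw [Fintype.prod_eq_mul_prod_compl j, Fintype.prod_eq_mul_prod_compl j (fun i => F i (k i))]
  have : ∏ i ∈ {j}ᶜ, F i ((k + Pi.single j 1 : Fin d → ℕ) i) = ∏ i ∈ {j}ᶜ, F i (k i) := by
    refine Finset.prod_congr rfl fun i hi => ?_
    have hij : i ≠ j := by simpa using hi
    simp [hij]
  rw [this]
  simp [h, mul_assoc]

/-- Absorption identity for the residual category; its companion below treats category `j`. The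
factors r + 1 - ∑ kᵢ and the kⱼ add up to r + 1, so together they give the recursion in the number
of trials. -/
theorem sub_mul_multinomialProb_succ {d r : ℕ} {k : Fin d → ℕ} (hk : ∑ i, k i ≤ r)
    (x : Fin d → ℝ) :
    ((r : ℝ) + 1 - ((∑ i, k i : ℕ) : ℝ)) * multinomialProb k (r + 1) x
      = (r + 1) * ((1 - l1 x) * multinomialProb k r x) := by
  obtain ⟨s, rfl⟩ := Nat.exists_eq_add_of_le hk
  have h1 : ∑ i, k i + s + 1 - ∑ i, k i = s + 1 := by omega
  have h2 : ∑ i, k i + s - ∑ i, k i = s := by omega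
  have h3 : (∏ i, ((k i).factorial : ℝ)) ≠ 0 :=
    Finset.prod_ne_zero_iff.2 fun i _ => by positivity
  have h4 : (s.factorial : ℝ) ≠ 0 := by positivity
  rw [multinomialProb, multinomialProb, h1, h2, Nat.factorial_succ, Nat.factorial_succ]
  push_cast
  have h5 : (s : ℝ) + 1 ≠ 0 := by positivity
  have h6 : (∑ i, (k i : ℝ)) + s + 1 - ∑ i, (k i : ℝ) = s + 1 := by ring
  rw [h6, pow_succ]
  field_simp

theorem mul_multinomialProb_add_single {d r : ℕ} {k : Fin d → ℕ} (j : Fin d) (x : Fin d → ℝ) :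
    ((k j : ℝ) + 1) * multinomialProb (k + Pi.single j 1) (r + 1) x
      = (r + 1) * (x j * multinomialProb k r x) := by
  have h3 : (∏ i, ((k i).factorial : ℝ)) ≠ 0 :=
    Finset.prod_ne_zero_iff.2 fun i _ => by positivity
  have h5 : (k j : ℝ) + 1 ≠ 0 := by positivity
  rw [multinomialProb, multinomialProb, sum_add_single, Nat.factorial_succ,
    Nat.add_sub_add_right,
    prod_add_single (fun _ n => (n.factorial : ℝ)) k j (k j + 1)
      (by rw [Nat.factorial_succ]; push_cast; ring),
    prod_add_single (fun i n => x i ^ n) k j (x j) (by rw [pow_succ, mul_comm])]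
  push_cast
  field_simp

/-- The factor `k j` removes the points with `k j = 0`; on the others, subtracting the `j`-th unit
vector is a bijection onto the smaller lattice. -/
theorem sum_lattice_succ_mul {d r : ℕ} {V : Type*} [AddCommGroup V] [Module ℝ V] (j : Fin d)
    (F : (Fin d → ℕ) → V) :
    ∑ k ∈ lattice d (r + 1), (k j : ℝ) • F k
      = ∑ k ∈ lattice d r, ((k j : ℝ) + 1) • F (k + Pi.single j 1) := by
  rw [← Finset.sum_filter_of_ne (p := fun k => k j ≠ 0)]
  · symm
    refine Finset.sum_bij' (fun k _ => k + Pi.single j 1) (fun k _ => k - Pi.single j 1)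
      ?_ ?_ ?_ ?_ ?_
    · intro k hk
      rw [mem_lattice] at hk
      simp only [Finset.mem_filter, mem_lattice, sum_add_single]
      exact ⟨by omega, by simp⟩
    · intro k hk
      simp only [Finset.mem_filter, mem_lattice] at hk
      have e : k - Pi.single j 1 + Pi.single j 1 = k := by
        ext i
        by_cases hi : i = j
        · subst hi; simp; omega
        · simp [hi]
      have := sum_add_single (k - Pi.single j 1) j
      rw [e] at this
      rw [mem_lattice]
      omega
    · intro k _
      ext i
      simp
    · intro k hk
      simp only [Finset.mem_filter, mem_lattice] at hk
      ext i
      by_cases hi : i = j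
      · subst hi; simp; omega
      · simp [hi]
    · intro k _
      simp
  · intro k _ hk h0
    simp [h0] at hk

/-- Conditioning on one trial. Every moment and the generating function follow from this recursion
by induction; values in a general module cover real moments and complex characters alike. -/
theorem multinomialMean_succ {d : ℕ} {V : Type*} [AddCommGroup V] [Module ℝ V] (r : ℕ)
    (x : Fin d → ℝ) (g : (Fin d → ℕ) → V) :
    multinomialMean (r + 1) x g = (1 - l1 x) • multinomialMean r x g
      + ∑ j, x j • multinomialMean r x (fun k => g (k + Pi.single j 1)) := by
  have hr : ((r : ℝ) + 1) ≠ 0 := by positivity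
  refine smul_right_injective V hr ?_
  have h1 : ((r : ℝ) + 1) • multinomialMean (r + 1) x g
      = ∑ k ∈ lattice d (r + 1),
          (((r : ℝ) + 1 - ((∑ i, k i : ℕ) : ℝ)) • multinomialProb k (r + 1) x • g k
            + ∑ j, (k j : ℝ) • multinomialProb k (r + 1) x • g k) := by
    rw [multinomialMean, Finset.smul_sum]
    refine Finset.sum_congr rfl fun k _ => ?_
    rw [← Finset.sum_smul, ← add_smul]
    congr 1
    push_cast
    ring
  have h2 : ∑ k ∈ lattice d (r + 1),
      ((r : ℝ) + 1 - ((∑ i, k i : ℕ) : ℝ)) • multinomialProb k (r + 1) x • g k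
      = ((r : ℝ) + 1) • ((1 - l1 x) • multinomialMean r x g) := by
    have hsub : lattice d r ⊆ lattice d (r + 1) := fun k hk => by
      rw [mem_lattice] at hk ⊢; omega
    rw [← Finset.sum_subset hsub, multinomialMean, Finset.smul_sum, Finset.smul_sum]
    · refine Finset.sum_congr rfl fun k hk => ?_
      rw [smul_smul, sub_mul_multinomialProb_succ (mem_lattice.1 hk), smul_smul, smul_smul]
      congr 1
      ring
    -- The points of the top layer ∑ kᵢ = r + 1 carry the coefficient zero.
    · intro k hk hk'
      rw [mem_lattice] at hk hk'
      have : ∑ i, k i = r + 1 := by omega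
      rw [this]
      simp
  have h3 : ∀ j, ∑ k ∈ lattice d (r + 1), (k j : ℝ) • multinomialProb k (r + 1) x • g k
      = ((r : ℝ) + 1) • (x j • multinomialMean r x (fun k => g (k + Pi.single j 1))) := by
    intro j
    rw [sum_lattice_succ_mul j, multinomialMean, Finset.smul_sum, Finset.smul_sum]
    refine Finset.sum_congr rfl fun k _ => ?_
    rw [smul_smul, mul_multinomialProb_add_single, smul_smul, smul_smul]
    congr 1
    ring
  change ((r : ℝ) + 1) • multinomialMean (r + 1) x g = ((r : ℝ) + 1) • _
  rw [h1, Finset.sum_add_distrib, h2, Finset.sum_comm, Finset.sum_congr rfl fun j _ => h3 j,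
    smul_add, Finset.smul_sum]

theorem multinomialMean_zero {d : ℕ} {V : Type*} [AddCommGroup V] [Module ℝ V]
    (x : Fin d → ℝ) (g : (Fin d → ℕ) → V) : multinomialMean 0 x g = g 0 := by
  have : lattice d 0 = {0} := by
    ext k
    rw [mem_lattice]
    simp [funext_iff]
  simp [multinomialMean, this, multinomialProb]

theorem multinomialMean_prod_pow {d : ℕ} (r : ℕ) (x : Fin d → ℝ) (z : Fin d → ℂ) :
    multinomialMean r x (fun k => ∏ j, z j ^ k j)
      = (((1 - l1 x : ℝ) : ℂ) + ∑ j, (x j : ℂ) * z j) ^ r := by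
  induction r with
  | zero => simp [multinomialMean_zero]
  | succ r ih =>
    have h : ∀ j, multinomialMean r x (fun k => ∏ i, z i ^ (k + Pi.single j 1 : Fin d → ℕ) i)
        = z j * multinomialMean r x (fun k => ∏ i, z i ^ k i) := by
      intro j
      simp only [multinomialMean, Finset.mul_sum]
      refine Finset.sum_congr rfl fun k _ => ?_
      rw [mul_smul_comm]
      congr 1
      simp only [Pi.add_apply, pow_add, Finset.prod_mul_distrib]
      rw [mul_comm]
      congr 1
      rw [Fintype.prod_eq_single j]
      · simp
      · intro i hi; simp [hi]
    rw [multinomialMean_succ]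
    simp only [h, ih, Complex.real_smul, pow_succ]
    rw [mul_add, Finset.mul_sum, mul_comm]
    congr 1
    refine Finset.sum_congr rfl fun j _ => by ring

section Linear

variable {d : ℕ} {r : ℕ} {x : Fin d → ℝ}

theorem multinomialMean_add (g h : (Fin d → ℕ) → ℝ) :
    multinomialMean r x (fun k => g k + h k) = multinomialMean r x g + multinomialMean r x h := by
  simp [multinomialMean, mul_add, Finset.sum_add_distrib]

theorem multinomialMean_sub (g h : (Fin d → ℕ) → ℝ) :
    multinomialMean r x (fun k => g k - h k) = multinomialMean r x g - multinomialMean r x h := by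
  simp [multinomialMean, mul_sub, Finset.sum_sub_distrib]

theorem multinomialMean_const_mul (c : ℝ) (g : (Fin d → ℕ) → ℝ) :
    multinomialMean r x (fun k => c * g k) = c * multinomialMean r x g := by
  simp only [multinomialMean, Finset.mul_sum, smul_eq_mul]
  exact Finset.sum_congr rfl fun k _ => by ring

theorem multinomialMean_sum {ι : Type*} (s : Finset ι) (g : ι → (Fin d → ℕ) → ℝ) :
    multinomialMean r x (fun k => ∑ a ∈ s, g a k) = ∑ a ∈ s, multinomialMean r x (g a) := by
  simp only [multinomialMean, Finset.smul_sum]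
  exact Finset.sum_comm

theorem l1_eq_sum (hx : ∀ i, 0 ≤ x i) : l1 x = ∑ i, x i :=
  Finset.sum_congr rfl fun i _ => abs_of_nonneg (hx i)

theorem multinomialMean_one (hx : ∀ i, 0 ≤ x i) :
    multinomialMean r x (fun _ => (1 : ℝ)) = 1 := by
  induction r with
  | zero => exact multinomialMean_zero x _
  | succ r ih =>
    rw [multinomialMean_succ, ih, l1_eq_sum hx]
    simp

theorem multinomialMean_const (hx : ∀ i, 0 ≤ x i) (c : ℝ) :
    multinomialMean r x (fun _ => c) = c := by
  have := multinomialMean_const_mul (r := r) (x := x) c (fun _ => 1)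
  simpa [multinomialMean_one hx] using this

theorem multinomialProb_nonneg (hx : x ∈ simplex d) (k : Fin d → ℕ) :
    0 ≤ multinomialProb k r x := by
  have h1 : 0 ≤ 1 - l1 x := sub_nonneg.2 hx.2
  have h2 : ∀ i, 0 ≤ x i := fun i => (hx.1 i).1
  have h3 : 0 ≤ ∏ i, x i ^ k i := Finset.prod_nonneg fun i _ => pow_nonneg (h2 i) _
  unfold multinomialProb
  positivity

theorem multinomialMean_mono (hx : x ∈ simplex d) {g h : (Fin d → ℕ) → ℝ}
    (hgh : ∀ k ∈ lattice d r, g k ≤ h k) : multinomialMean r x g ≤ multinomialMean r x h :=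
  Finset.sum_le_sum fun k hk =>
    mul_le_mul_of_nonneg_left (hgh k hk) (multinomialProb_nonneg hx k)

theorem abs_multinomialMean_le (hx : x ∈ simplex d) (g : (Fin d → ℕ) → ℝ) :
    |multinomialMean r x g| ≤ multinomialMean r x fun k => |g k| := by
  refine (Finset.abs_sum_le_sum_abs _ _).trans (Finset.sum_le_sum fun k _ => ?_)
  rw [smul_eq_mul, smul_eq_mul, abs_mul, abs_of_nonneg (multinomialProb_nonneg hx k)]

/-! ### Moments -/

/-- Since the trial probabilities add up to one, only the increments of `g` matter, and these have
lower degree when `g` is a polynomial. -/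
theorem multinomialMean_succ_sub (hx : ∀ i, 0 ≤ x i) (g : (Fin d → ℕ) → ℝ) :
    multinomialMean (r + 1) x g = multinomialMean r x g
      + ∑ j, x j * multinomialMean r x (fun k => g (k + Pi.single j 1) - g k) := by
  rw [multinomialMean_succ, l1_eq_sum hx]
  simp only [multinomialMean_sub, smul_eq_mul, mul_sub, Finset.sum_sub_distrib, sub_mul,
    ← Finset.sum_mul]
  ring

theorem multinomialMean_coord_succ (hx : ∀ i, 0 ≤ x i) (i : Fin d) (g : ℕ → ℝ) :
    multinomialMean (r + 1) x (fun k => g (k i))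
      = multinomialMean r x (fun k => (1 - x i) * g (k i) + x i * g (k i + 1)) := by
  rw [multinomialMean_succ_sub hx, Fintype.sum_eq_single i]
  · rw [← multinomialMean_const_mul, ← multinomialMean_add]
    congr 1
    ext k
    simp
    ring
  · intro j hj
    have : ∀ k : Fin d → ℕ, (k + Pi.single j 1 : Fin d → ℕ) i = k i := fun k => by
      simp [hj.symm]
    simp [this, multinomialMean]

theorem multinomialMean_centered (hx : ∀ i, 0 ≤ x i) (i : Fin d) :
    multinomialMean r x (fun k => (k i : ℝ) - r * x i) = 0 := by
  induction r with
  | zero => simp [multinomialMean_zero]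
  | succ r ih =>
    rw [multinomialMean_coord_succ hx i (fun n => (n : ℝ) - (r + 1 : ℕ) * x i), ← ih]
    congr 1
    ext k
    push_cast
    ring

theorem multinomialMean_centered_mul (hx : ∀ i, 0 ≤ x i) (i j : Fin d) :
    multinomialMean r x (fun k => ((k i : ℝ) - r * x i) * ((k j : ℝ) - r * x j))
      = r * ((if i = j then x i else 0) - x i * x j) := by
  induction r with
  | zero => simp [multinomialMean_zero]
  | succ r ih =>
    have key : ∀ l (k : Fin d → ℕ), ((((k + Pi.single l 1 : Fin d → ℕ) i : ℕ) : ℝ)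
          - (r + 1 : ℕ) * x i)
          * ((((k + Pi.single l 1 : Fin d → ℕ) j : ℕ) : ℝ) - (r + 1 : ℕ) * x j)
        - ((k i : ℝ) - (r + 1 : ℕ) * x i) * ((k j : ℝ) - (r + 1 : ℕ) * x j)
        = (Pi.single l (1 : ℝ) : Fin d → ℝ) i * ((k j : ℝ) - r * x j)
          + ((Pi.single l (1 : ℝ) : Fin d → ℝ) j * ((k i : ℝ) - r * x i)
          + ((Pi.single l (1 : ℝ) : Fin d → ℝ) i * (Pi.single l (1 : ℝ) : Fin d → ℝ) j
            - (Pi.single l (1 : ℝ) : Fin d → ℝ) i * x j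
            - (Pi.single l (1 : ℝ) : Fin d → ℝ) j * x i)) := by
      intro l k
      have e : ∀ a, (((k + Pi.single l 1 : Fin d → ℕ) a : ℕ) : ℝ)
          = k a + (Pi.single l (1 : ℝ) : Fin d → ℝ) a := by
        intro a
        by_cases h : a = l
        · subst h; simp
        · simp [h]
      rw [e, e]
      push_cast
      ring
    rw [multinomialMean_succ_sub hx]
    simp only [key, multinomialMean_add, multinomialMean_const_mul, multinomialMean_centered hx,
      multinomialMean_const hx, mul_zero, zero_add]
    have h0 : multinomialMean r x (fun k => ((k i : ℝ) - (r + 1 : ℕ) * x i)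
        * ((k j : ℝ) - (r + 1 : ℕ) * x j))
        = r * ((if i = j then x i else 0) - x i * x j) + x i * x j := by
      rw [← ih]
      have : (fun k : Fin d → ℕ => ((k i : ℝ) - (r + 1 : ℕ) * x i)
          * ((k j : ℝ) - (r + 1 : ℕ) * x j))
          = fun k => ((k i : ℝ) - r * x i) * ((k j : ℝ) - r * x j)
            + (-(x i) * ((k j : ℝ) - r * x j) + (-(x j) * ((k i : ℝ) - r * x i)
            + x i * x j)) := by
        ext k
        push_cast
        ring
      rw [this]
      simp only [multinomialMean_add, multinomialMean_const_mul, multinomialMean_centered hx,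
        multinomialMean_const hx]
      ring
    rw [h0]
    have h1 : ∑ l, x l * ((Pi.single l (1 : ℝ) : Fin d → ℝ) i
          * (Pi.single l (1 : ℝ) : Fin d → ℝ) j
        - (Pi.single l (1 : ℝ) : Fin d → ℝ) i * x j - (Pi.single l (1 : ℝ) : Fin d → ℝ) j * x i)
        = (if i = j then x i else 0) - 2 * (x i * x j) := by
      simp only [mul_sub, Finset.sum_sub_distrib, Pi.single_apply]
      by_cases h : i = j
      · subst h; simp; ring
      · simp [h]; ring
    rw [h1]
    push_cast
    ring

theorem multinomialMean_centered_sq_le (hx : x ∈ simplex d) (i : Fin d) :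
    multinomialMean r x (fun k => ((k i : ℝ) - r * x i) ^ 2) ≤ r := by
  have h0 : ∀ i, 0 ≤ x i := fun i => (hx.1 i).1
  have := multinomialMean_centered_mul (r := r) h0 i i
  simp only [← sq, if_true] at this
  rw [this]
  have h1 := hx.1 i
  have : x i - x i ^ 2 ≤ 1 := by nlinarith [h1.1, h1.2]
  nlinarith [(Nat.cast_nonneg r : (0 : ℝ) ≤ r)]

/-- With s = xᵢ(1 - xᵢ) ≤ 1/4, one more trial adds 6s²r + s(1 - 3s), which is below 3(r + 1)² - 3r²
= 6r + 3. -/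
theorem multinomialMean_centered_pow_four_le (hx : x ∈ simplex d) (i : Fin d) :
    multinomialMean r x (fun k => ((k i : ℝ) - r * x i) ^ 4) ≤ 3 * (r : ℝ) ^ 2 := by
  have h0 : ∀ i, 0 ≤ x i := fun i => (hx.1 i).1
  obtain ⟨hi0, hi1⟩ := hx.1 i
  induction r with
  | zero => simp [multinomialMean_zero]
  | succ r ih =>
    rw [multinomialMean_coord_succ h0 i (fun n => ((n : ℝ) - (r + 1 : ℕ) * x i) ^ 4)]
    have : (fun k : Fin d → ℕ => (1 - x i) * ((k i : ℝ) - (r + 1 : ℕ) * x i) ^ 4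
        + x i * (((k i + 1 : ℕ) : ℝ) - (r + 1 : ℕ) * x i) ^ 4)
        = fun k => ((k i : ℝ) - r * x i) ^ 4
          + (6 * (x i * (1 - x i)) * (((k i : ℝ) - r * x i) * ((k i : ℝ) - r * x i))
          + (4 * ((1 - x i) * x i * (1 - 2 * x i)) * ((k i : ℝ) - r * x i)
          + ((1 - x i) * x i ^ 4 + x i * (1 - x i) ^ 4))) := by
      ext k
      push_cast
      ring
    rw [this]
    simp only [multinomialMean_add, multinomialMean_const_mul, multinomialMean_centered h0,
      multinomialMean_centered_mul h0, multinomialMean_const h0, if_true]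
    have hs0 : 0 ≤ x i * (1 - x i) := mul_nonneg hi0 (sub_nonneg.2 hi1)
    have hs1 : x i * (1 - x i) ≤ 1 / 4 := by nlinarith [sq_nonneg (x i - 1 / 2)]
    have e4 : (1 - x i) * x i ^ 4 + x i * (1 - x i) ^ 4
        = x i * (1 - x i) * (1 - 3 * (x i * (1 - x i))) := by ring
    have hr : (0 : ℝ) ≤ r := Nat.cast_nonneg r
    have e5 : x i - x i * x i = x i * (1 - x i) := by ring
    rw [e4, e5]
    generalize x i * (1 - x i) = s at *
    push_cast
    have e6 : 6 * s * (r * s) ≤ r := by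
      have : s * s ≤ 1 / 16 := by nlinarith
      nlinarith
    nlinarith

theorem multinomialMean_two_pow (hx : ∀ i, 0 ≤ x i) :
    multinomialMean r x (fun k => (2 : ℝ) ^ ∑ i, k i) = (1 + l1 x) ^ r := by
  induction r with
  | zero => simp [multinomialMean_zero]
  | succ r ih =>
    rw [multinomialMean_succ_sub hx, ih]
    have : ∀ (j : Fin d) (k : Fin d → ℕ), (2 : ℝ) ^ (∑ i, (k + Pi.single j 1 : Fin d → ℕ) i)
        - 2 ^ (∑ i, k i) = 2 ^ (∑ i, k i) := by
      intro j k
      rw [sum_add_single, pow_succ]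
      ring
    simp only [this, ih]
    rw [← Finset.sum_mul, ← l1_eq_sum hx]
    ring

/-- The multinomial mass of the lattice points whose cell sticks out of the simplex. -/
theorem multinomialMean_boundary_le (hx : x ∈ simplex d) :
    multinomialMean r x (fun k => if ∑ i, k i + d ≤ r + 1 then (0 : ℝ) else 1)
      ≤ 2 ^ d * ((1 + l1 x) / 2) ^ r := by
  have h0 : ∀ i, 0 ≤ x i := fun i => (hx.1 i).1
  have : ((1 + l1 x) / 2) ^ r = (2 ^ r)⁻¹ * multinomialMean r x (fun k => (2 : ℝ) ^ ∑ i, k i) := by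
    rw [multinomialMean_two_pow h0, div_pow]
    ring
  rw [this, ← mul_assoc, ← multinomialMean_const_mul]
  refine multinomialMean_mono hx fun k _ => ?_
  split_ifs with h
  · positivity
  -- Exponential Markov inequality: outside the event of the `if`, the exponent ∑ kᵢ + d is at least
  -- r, so 2^d 2^{-r} 2^{∑ kᵢ} is at least one.
  · rw [mul_right_comm, ← pow_add, ← div_eq_mul_inv, one_le_div (by positivity)]
    exact pow_le_pow_right₀ (by norm_num) (by omega)

end Linear

/-! ### Fourier inversion for multinomial probabilities -/

/-- The characteristic function `t ↦ 1 - ‖x‖₁ + ∑ⱼ xⱼ e^{itⱼ}` of a single multinomial trial. -/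
noncomputable def trialCharFun {d : ℕ} (x t : Fin d → ℝ) : ℂ :=
  ((1 - l1 x : ℝ) : ℂ) + ∑ j, (x j : ℂ) * Complex.exp (t j * Complex.I)

/-- The fundamental domain `(-π, π]^d`. -/
def torusBox (d : ℕ) : Set (Fin d → ℝ) := Set.pi Set.univ fun _ => Set.Ioc (-Real.pi) Real.pi

theorem continuous_trialCharFun {d : ℕ} (x : Fin d → ℝ) : Continuous (trialCharFun x) := by
  unfold trialCharFun
  fun_prop

theorem integrableOn_torusBox {d : ℕ} {E : Type*} [NormedAddCommGroup E] {g : (Fin d → ℝ) → E}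
    (hg : Continuous g) : IntegrableOn g (torusBox d) :=
  (hg.continuousOn.integrableOn_compact
    (isCompact_univ_pi fun _ : Fin d => isCompact_Icc (a := -Real.pi) (b := Real.pi))).mono_set
    (Set.pi_mono fun _ _ => Set.Ioc_subset_Icc_self)

theorem measurableSet_torusBox (d : ℕ) : MeasurableSet (torusBox d) :=
  MeasurableSet.univ_pi fun _ => measurableSet_Ioc

theorem integral_exp_int_mul_I (n : ℤ) :
    ∫ t in Set.Ioc (-Real.pi) Real.pi, Complex.exp (n * (t * Complex.I))
      = if n = 0 then (2 * Real.pi : ℂ) else 0 := by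
  rw [← intervalIntegral.integral_of_le (by linarith [Real.pi_pos])]
  split_ifs with h
  · simp [h]
    ring
  · have h0 : (n : ℂ) * Complex.I ≠ 0 := by simp [h]
    have e : ∀ t : ℝ, Complex.exp (n * (t * Complex.I)) = Complex.exp (n * Complex.I * t) :=
      fun t => by ring_nf
    simp only [e]
    rw [integral_exp_mul_complex h0, div_eq_zero_iff]
    left
    -- The exponents at π and -π differ by 2πi n.
    rw [sub_eq_zero, Complex.exp_eq_exp_iff_exists_int]
    exact ⟨n, by push_cast; ring⟩

theorem integral_torusBox_character {d : ℕ} (n : Fin d → ℤ) :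
    ∫ t in torusBox d, ∏ j, Complex.exp (n j * (t j * Complex.I))
      = if n = 0 then (2 * Real.pi : ℂ) ^ d else 0 := by
  rw [torusBox, volume_pi, Measure.restrict_pi_pi,
    integral_fintype_prod_eq_prod (fun j (s : ℝ) => Complex.exp (n j * (s * Complex.I)))]
  simp only [integral_exp_int_mul_I]
  split_ifs with h
  · simp [h]
  · obtain ⟨j, hj⟩ := Function.ne_iff.1 h
    exact Finset.prod_eq_zero (Finset.mem_univ j) (if_neg hj)

theorem trialCharFun_pow {d : ℕ} (r : ℕ) (x t : Fin d → ℝ) :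
    trialCharFun x t ^ r
      = ∑ k ∈ lattice d r, (multinomialProb k r x : ℂ)
          * ∏ j, Complex.exp (k j * (t j * Complex.I)) := by
  rw [trialCharFun, ← multinomialMean_prod_pow, multinomialMean]
  refine Finset.sum_congr rfl fun k _ => ?_
  rw [Complex.real_smul]
  congr 1
  refine Finset.prod_congr rfl fun j _ => ?_
  rw [← Complex.exp_nat_mul]

theorem integral_trialCharFun_pow {d : ℕ} {r : ℕ} (x : Fin d → ℝ) {k : Fin d → ℕ}
    (hk : k ∈ lattice d r) :
    ∫ t in torusBox d, trialCharFun x t ^ r * ∏ j, Complex.exp (-(k j * (t j * Complex.I)))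
      = (2 * Real.pi : ℂ) ^ d * multinomialProb k r x := by
  have e : ∀ t : Fin d → ℝ,
      trialCharFun x t ^ r * ∏ j, Complex.exp (-(k j * (t j * Complex.I)))
      = ∑ l ∈ lattice d r, (multinomialProb l r x : ℂ)
          * ∏ j, Complex.exp ((((l j : ℤ) - k j : ℤ) : ℂ) * (t j * Complex.I)) := by
    intro t
    rw [trialCharFun_pow, Finset.sum_mul]
    refine Finset.sum_congr rfl fun l _ => ?_
    rw [mul_assoc, ← Finset.prod_mul_distrib]
    congr 1
    refine Finset.prod_congr rfl fun j _ => ?_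
    rw [← Complex.exp_add]
    push_cast
    ring_nf
  simp only [e]
  rw [integral_finsetSum _ fun l _ => (integrableOn_torusBox (by fun_prop))]
  simp only [integral_const_mul]
  rw [Finset.sum_eq_single k]
  · rw [integral_torusBox_character (fun j => (k j : ℤ) - k j), if_pos (by ext; simp), mul_comm]
  · intro l _ hl
    rw [integral_torusBox_character (fun j => (l j : ℤ) - k j), if_neg, mul_zero]
    intro h
    apply hl
    ext j
    have := congrFun h j
    simp only [Pi.zero_apply] at this
    omega
  · exact fun h => absurd hk h

/-- Characters have modulus one, so Fourier inversion bounds all the probabilities at once by the L¹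
norm of the characteristic function. -/
theorem two_pi_pow_mul_multinomialProb_le {d : ℕ} {r : ℕ} (x : Fin d → ℝ) {k : Fin d → ℕ}
    (hk : k ∈ lattice d r) :
    (2 * Real.pi) ^ d * multinomialProb k r x ≤ ∫ t in torusBox d, ‖trialCharFun x t‖ ^ r := by
  have h := norm_integral_le_integral_norm (μ := volume.restrict (torusBox d))
    fun t => trialCharFun x t ^ r * ∏ j, Complex.exp (-(k j * (t j * Complex.I)))
  rw [integral_trialCharFun_pow x hk] at h
  have e : ∀ t : Fin d → ℝ,
      ‖trialCharFun x t ^ r * ∏ j, Complex.exp (-(k j * (t j * Complex.I)))‖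
        = ‖trialCharFun x t‖ ^ r := by
    intro t
    rw [norm_mul, norm_pow, norm_prod, Finset.prod_eq_one, mul_one]
    intro j _
    rw [Complex.norm_exp]
    simp
  simp only [e] at h
  refine le_trans ?_ h
  have : (2 * Real.pi : ℂ) ^ d * multinomialProb k r x
      = (((2 * Real.pi) ^ d * multinomialProb k r x : ℝ) : ℂ) := by push_cast; ring
  rw [this, Complex.norm_real]
  exact le_abs_self _

/-- Parseval's identity: write one factor of p_k² as an inversion integral and resum the other into
the conjugate of φ^r. -/
theorem two_pi_pow_mul_sum_multinomialProb_sq {d : ℕ} (r : ℕ) (x : Fin d → ℝ) :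
    (2 * Real.pi) ^ d * ∑ k ∈ lattice d r, multinomialProb k r x ^ 2
      = ∫ t in torusBox d, ‖trialCharFun x t‖ ^ (2 * r) := by
  have h : ∑ k ∈ lattice d r, (multinomialProb k r x : ℂ)
        * ∫ t in torusBox d, trialCharFun x t ^ r * ∏ j, Complex.exp (-(k j * (t j * Complex.I)))
      = ∫ t in torusBox d, ((‖trialCharFun x t‖ ^ (2 * r) : ℝ) : ℂ) := by
    simp only [← integral_const_mul]
    rw [← integral_finsetSum _ fun k _ => (integrableOn_torusBox (by
      have := continuous_trialCharFun x
      fun_prop))]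
    refine integral_congr_ae (Eventually.of_forall fun t => ?_)
    have hc : (starRingEnd ℂ) (trialCharFun x t ^ r)
        = ∑ k ∈ lattice d r, (multinomialProb k r x : ℂ)
          * ∏ j, Complex.exp (-(k j * (t j * Complex.I))) := by
      rw [trialCharFun_pow, map_sum]
      refine Finset.sum_congr rfl fun k _ => ?_
      rw [map_mul, Complex.conj_ofReal, map_prod]
      congr 1
      refine Finset.prod_congr rfl fun j _ => ?_
      rw [← Complex.exp_conj]
      simp
    have : ∑ k ∈ lattice d r, (multinomialProb k r x : ℂ)
        * (trialCharFun x t ^ r * ∏ j, Complex.exp (-(k j * (t j * Complex.I))))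
        = trialCharFun x t ^ r * (starRingEnd ℂ) (trialCharFun x t ^ r) := by
      rw [hc, Finset.mul_sum]
      refine Finset.sum_congr rfl fun k _ => by ring
    simp only [this]
    rw [Complex.mul_conj, Complex.normSq_eq_norm_sq, norm_pow, ← pow_mul, mul_comm r 2]
  rw [integral_complex_ofReal] at h
  rw [Finset.sum_congr rfl fun k hk => by rw [integral_trialCharFun_pow x hk]] at h
  have h2 : ((((2 * Real.pi) ^ d * ∑ k ∈ lattice d r, multinomialProb k r x ^ 2 : ℝ)) : ℂ)
      = ((∫ t in torusBox d, ‖trialCharFun x t‖ ^ (2 * r) : ℝ) : ℂ) := by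
    rw [← h]
    push_cast
    rw [Finset.mul_sum]
    exact Finset.sum_congr rfl fun k _ => by ring
  exact_mod_cast h2

/-! ### Laplace asymptotics of the norm of the characteristic function -/

theorem norm_trialCharFun_sq {d : ℕ} (x t : Fin d → ℝ) :
    ‖trialCharFun x t‖ ^ 2
      = (1 - l1 x + ∑ j, x j * Real.cos (t j)) ^ 2 + (∑ j, x j * Real.sin (t j)) ^ 2 := by
  have : trialCharFun x t = ((1 - l1 x + ∑ j, x j * Real.cos (t j) : ℝ) : ℂ)
      + ((∑ j, x j * Real.sin (t j) : ℝ) : ℂ) * Complex.I := by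
    rw [trialCharFun]
    push_cast
    rw [add_assoc, Finset.sum_mul, ← Finset.sum_add_distrib]
    congr 1
    refine Finset.sum_congr rfl fun j _ => ?_
    rw [Complex.exp_mul_I]
    ring
  rw [this, Complex.sq_norm, Complex.normSq_add_mul_I]

/-- Write φ = q + w with q = 1 - ‖x‖₁. Since |w| ≤ S = ‖x‖₁, the square |φ|² = q² + 2q Re w + |w|²
is at most (q + S)² - 2q(S - Re w). -/
theorem norm_trialCharFun_sq_le {d : ℕ} {x : Fin d → ℝ} (hx : x ∈ simplex d) (t : Fin d → ℝ) :
    ‖trialCharFun x t‖ ^ 2 ≤ 1 - 2 * ((1 - l1 x) * ∑ j, x j * (1 - Real.cos (t j))) := by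
  have h0 : ∀ i, 0 ≤ x i := fun i => (hx.1 i).1
  have h : (∑ j, x j * Real.cos (t j)) ^ 2 + (∑ j, x j * Real.sin (t j)) ^ 2 ≤ l1 x ^ 2 := by
    have e : ∑ j, (x j : ℂ) * Complex.exp (t j * Complex.I)
        = ((∑ j, x j * Real.cos (t j) : ℝ) : ℂ)
          + ((∑ j, x j * Real.sin (t j) : ℝ) : ℂ) * Complex.I := by
      push_cast
      rw [Finset.sum_mul, ← Finset.sum_add_distrib]
      refine Finset.sum_congr rfl fun j _ => ?_
      rw [Complex.exp_mul_I]
      ring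
    rw [← Complex.normSq_add_mul_I, ← e, ← Complex.sq_norm]
    refine pow_le_pow_left₀ (norm_nonneg _) ((norm_sum_le _ _).trans_eq ?_) 2
    refine Finset.sum_congr rfl fun j _ => ?_
    rw [norm_mul, Complex.norm_exp_ofReal_mul_I, Complex.norm_real, mul_one, Real.norm_eq_abs]
  rw [norm_trialCharFun_sq]
  have h2 : ∑ j, x j * (1 - Real.cos (t j)) = l1 x - ∑ j, x j * Real.cos (t j) := by
    rw [l1_eq_sum h0]
    simp only [mul_sub, mul_one, Finset.sum_sub_distrib]
  rw [h2]
  nlinarith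

/-- The bound 1 - cos t ≥ 2t²/π² on [-π, π] and 1 - y ≤ e^{-y} give a Gaussian majorant on the whole
torus. After the scaling t = u/√r it no longer depends on `r`, as dominated convergence requires. -/
theorem norm_trialCharFun_pow_le {d : ℕ} {x : Fin d → ℝ} (hx : x ∈ simplex d) {t : Fin d → ℝ}
    (ht : t ∈ torusBox d) (r : ℕ) :
    ‖trialCharFun x t‖ ^ r
      ≤ Real.exp (-(∑ j, 2 / Real.pi ^ 2 * ((1 - l1 x) * x j) * (r * t j ^ 2))) := by
  have hq : 0 ≤ 1 - l1 x := sub_nonneg.2 hx.2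
  have h1 : ‖trialCharFun x t‖ ^ 2
      ≤ Real.exp (-(∑ j, 2 / Real.pi ^ 2 * ((1 - l1 x) * x j) * t j ^ 2)) ^ 2 := by
    refine (norm_trialCharFun_sq_le hx t).trans ?_
    rw [← Real.exp_nat_mul]
    refine le_trans ?_ (Real.add_one_le_exp _)
    have : ∑ j, 2 / Real.pi ^ 2 * ((1 - l1 x) * x j) * t j ^ 2
        ≤ (1 - l1 x) * ∑ j, x j * (1 - Real.cos (t j)) := by
      rw [Finset.mul_sum]
      refine Finset.sum_le_sum fun j _ => ?_
      have hc := Real.cos_le_one_sub_mul_cos_sq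
        (abs_le.2 ⟨(ht j trivial).1.le, (ht j trivial).2⟩ : |t j| ≤ Real.pi)
      have : 2 / Real.pi ^ 2 * t j ^ 2 ≤ 1 - Real.cos (t j) := by linarith
      calc 2 / Real.pi ^ 2 * ((1 - l1 x) * x j) * t j ^ 2
          = (1 - l1 x) * (x j * (2 / Real.pi ^ 2 * t j ^ 2)) := by ring
        _ ≤ _ := mul_le_mul_of_nonneg_left
            (mul_le_mul_of_nonneg_left this (hx.1 j).1) hq
    push_cast
    linarith
  have h2 := pow_le_pow_left₀ (norm_nonneg _)
    ((pow_le_pow_iff_left₀ (norm_nonneg _) (Real.exp_nonneg _) two_ne_zero).1 h1) r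
  refine h2.trans_eq ?_
  rw [← Real.exp_nat_mul, mul_neg, Finset.mul_sum]
  congr 2
  exact Finset.sum_congr rfl fun j _ => by ring

theorem tendsto_sqrt_mul_sin (c : ℝ) :
    Tendsto (fun r : ℕ => √(r : ℝ) * Real.sin ((√(r : ℝ))⁻¹ * c)) atTop (𝓝 c) := by
  have h1 : Tendsto (fun r : ℕ => (√(r : ℝ))⁻¹ * c) atTop (𝓝 0) := by
    have : Tendsto (fun r : ℕ => (√(r : ℝ))⁻¹) atTop (𝓝 0) :=
      tendsto_inv_atTop_zero.comp (Real.tendsto_sqrt_atTop.comp tendsto_natCast_atTop_atTop)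
    simpa using this.mul_const c
  have h2 : Tendsto (fun r : ℕ => c * Real.sinc ((√(r : ℝ))⁻¹ * c)) atTop (𝓝 (c * 1)) := by
    rw [← Real.sinc_zero]
    exact ((Real.continuous_sinc.tendsto 0).comp h1).const_mul c
  rw [mul_one] at h2
  refine h2.congr' ?_
  filter_upwards [eventually_gt_atTop 0] with r hr
  have hs : √(r : ℝ) ≠ 0 := by positivity
  by_cases hc : c = 0
  · simp [hc]
  · rw [Real.sinc_of_ne_zero (by positivity)]
    field_simp

theorem tendsto_mul_one_sub_cos (c : ℝ) :
    Tendsto (fun r : ℕ => (r : ℝ) * (1 - Real.cos ((√(r : ℝ))⁻¹ * c))) atTop (𝓝 (c ^ 2 / 2)) := by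
  have h := ((tendsto_sqrt_mul_sin (c / 2)).pow 2).const_mul 2
  have e : 2 * (c / 2) ^ 2 = c ^ 2 / 2 := by ring
  rw [e] at h
  refine h.congr fun r => ?_
  have : Real.cos ((√(r : ℝ))⁻¹ * c) = 1 - 2 * Real.sin ((√(r : ℝ))⁻¹ * (c / 2)) ^ 2 := by
    have := Real.cos_two_mul ((√(r : ℝ))⁻¹ * (c / 2))
    rw [show 2 * ((√(r : ℝ))⁻¹ * (c / 2)) = (√(r : ℝ))⁻¹ * c by ring] at this
    rw [this, Real.cos_sq']
    ring
  rw [this, mul_pow, Real.sq_sqrt (Nat.cast_nonneg r)]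
  ring

/-- The covariance form of a single multinomial trial. -/
def trialCov {d : ℕ} (x u : Fin d → ℝ) : ℝ := ∑ j, x j * u j ^ 2 - (∑ j, x j * u j) ^ 2

theorem tendsto_norm_trialCharFun_pow {d : ℕ} {x : Fin d → ℝ} (hx : x ∈ simplex d)
    (u : Fin d → ℝ) :
    Tendsto (fun r : ℕ => ‖trialCharFun x ((√(r : ℝ))⁻¹ • u)‖ ^ r) atTop
      (𝓝 (Real.exp (-(trialCov x u) / 2))) := by
  have h0 : ∀ i, 0 ≤ x i := fun i => (hx.1 i).1
  set a : ℕ → ℝ := fun r => ∑ j, x j * (1 - Real.cos ((√(r : ℝ))⁻¹ * u j)) with ha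
  have hra : Tendsto (fun r : ℕ => (r : ℝ) * a r) atTop (𝓝 (∑ j, x j * (u j ^ 2 / 2))) := by
    simp only [ha, Finset.mul_sum]
    refine tendsto_finsetSum _ fun j _ => ?_
    refine ((tendsto_mul_one_sub_cos (u j)).const_mul (x j)).congr fun r => by ring
  have ha0 : Tendsto a atTop (𝓝 0) := by
    have h := hra.mul (tendsto_inv_atTop_zero.comp (tendsto_natCast_atTop_atTop (R := ℝ)))
    rw [mul_zero] at h
    refine h.congr' ?_
    filter_upwards [eventually_gt_atTop 0] with r hr
    have : (r : ℝ) ≠ 0 := by positivity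
    simp only [Function.comp_apply]
    field_simp
  have hs : Tendsto (fun r : ℕ => √(r : ℝ) * ∑ j, x j * Real.sin ((√(r : ℝ))⁻¹ * u j)) atTop
      (𝓝 (∑ j, x j * u j)) := by
    simp only [Finset.mul_sum]
    refine tendsto_finsetSum _ fun j _ => ?_
    refine ((tendsto_sqrt_mul_sin (u j)).const_mul (x j)).congr fun r => by ring
  -- Here |φ|² - 1 = -2a + a² + (∑ xⱼ sin tⱼ)². Multiplied by `r`, the term a² vanishes in the limit
  -- and the other two combine to minus the covariance form.
  have h1 : Tendsto (fun r : ℕ => (r : ℝ) * (‖trialCharFun x ((√(r : ℝ))⁻¹ • u)‖ ^ 2 - 1)) atTop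
      (𝓝 (-(trialCov x u))) := by
    have h := ((hs.pow 2).add (hra.mul ha0)).sub (hra.const_mul 2)
    have e : (∑ j, x j * u j) ^ 2 + (∑ j, x j * (u j ^ 2 / 2)) * 0
        - 2 * ∑ j, x j * (u j ^ 2 / 2) = -(trialCov x u) := by
      have : ∑ j, x j * u j ^ 2 = 2 * ∑ j, x j * (u j ^ 2 / 2) := by
        rw [Finset.mul_sum]
        exact Finset.sum_congr rfl fun j _ => by ring
      rw [trialCov, this]
      ring
    rw [e] at h
    refine h.congr fun r => ?_
    rw [norm_trialCharFun_sq]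
    have : 1 - l1 x + ∑ j, x j * Real.cos (((√(r : ℝ))⁻¹ • u) j) = 1 - a r := by
      simp only [ha, mul_sub, mul_one, Finset.sum_sub_distrib, l1_eq_sum h0, Pi.smul_apply,
        smul_eq_mul]
      ring
    rw [this, mul_pow, Real.sq_sqrt (Nat.cast_nonneg r)]
    simp only [Pi.smul_apply, smul_eq_mul]
    ring
  have h2 := Real.tendsto_one_add_pow_exp_of_tendsto h1
  have h3 := (Real.continuous_sqrt.tendsto _).comp h2
  rw [← Real.exp_half] at h3
  refine h3.congr fun r => ?_
  simp only [Function.comp_apply]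
  rw [add_sub_cancel, ← pow_mul, mul_comm 2 r, pow_mul, Real.sqrt_sq (by positivity)]

theorem mem_simplex_of_mem_simplexInt {d : ℕ} {x : Fin d → ℝ} (hx : x ∈ simplexInt d) :
    x ∈ simplex d :=
  ⟨fun i => Set.Ioo_subset_Icc_self (hx.1 i), hx.2.le⟩

theorem integrable_exp_neg_sum_sq {d : ℕ} {b : Fin d → ℝ} (hb : ∀ j, 0 < b j) :
    Integrable fun u : Fin d → ℝ => Real.exp (-(∑ j, b j * u j ^ 2)) := by
  have : (fun u : Fin d → ℝ => Real.exp (-(∑ j, b j * u j ^ 2)))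
      = fun u => ∏ j, Real.exp (-b j * u j ^ 2) := by
    ext u
    rw [← Real.exp_sum, ← Finset.sum_neg_distrib]
    simp only [neg_mul]
  rw [this]
  exact Integrable.fintype_prod (f := fun j (s : ℝ) => Real.exp (-b j * s ^ 2))
    fun j => integrable_exp_neg_mul_sq (hb j)

theorem torusBox_mem_nhds (d : ℕ) : torusBox d ∈ 𝓝 (0 : Fin d → ℝ) :=
  set_pi_mem_nhds Set.finite_univ fun _ _ =>
    Ioc_mem_nhds (by simpa using Real.pi_pos) (by simpa using Real.pi_pos)

/-- Laplace's method: substitute t = u/√r, extend the integrand by zero off the scaled torus, and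
pass to the limit under the Gaussian majorant. -/
theorem tendsto_integral_norm_trialCharFun_pow {d : ℕ} {x : Fin d → ℝ} (hx : x ∈ simplexInt d) :
    Tendsto (fun r : ℕ => √(r : ℝ) ^ d * ∫ t in torusBox d, ‖trialCharFun x t‖ ^ r) atTop
      (𝓝 (∫ u, Real.exp (-(trialCov x u) / 2))) := by
  have hx' := mem_simplex_of_mem_simplexInt hx
  set b : Fin d → ℝ := fun j => 2 / Real.pi ^ 2 * ((1 - l1 x) * x j) with hb
  have hb0 : ∀ j, 0 < b j := fun j => by
    have := sub_pos.2 hx.2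
    have := (hx.1 j).1
    have := Real.pi_pos
    positivity
  set F : ℕ → (Fin d → ℝ) → ℝ := fun r u =>
    (torusBox d).indicator (fun t => ‖trialCharFun x t‖ ^ r) ((√(r : ℝ))⁻¹ • u) with hF
  have hFI : ∀ᶠ r : ℕ in atTop,
      ∫ u, F r u = √(r : ℝ) ^ d * ∫ t in torusBox d, ‖trialCharFun x t‖ ^ r := by
    filter_upwards [eventually_gt_atTop 0] with r hr
    rw [hF]
    dsimp only
    rw [Measure.integral_comp_smul, integral_indicator (measurableSet_torusBox d)]
    have : 0 ≤ √(r : ℝ) := Real.sqrt_nonneg _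
    simp [abs_of_nonneg this]
  refine Tendsto.congr' hFI ?_
  refine tendsto_integral_filter_of_dominated_convergence
    (fun u => Real.exp (-(∑ j, b j * u j ^ 2))) ?_ ?_ (integrable_exp_neg_sum_sq hb0) ?_
  · refine Eventually.of_forall fun r => Measurable.aestronglyMeasurable ?_
    exact (((continuous_trialCharFun x).norm.pow r).measurable.indicator
      (measurableSet_torusBox d)).comp (measurable_const_smul _)
  · filter_upwards [eventually_gt_atTop 0] with r hr
    refine Eventually.of_forall fun u => ?_
    rw [hF]
    dsimp only
    by_cases h : (√(r : ℝ))⁻¹ • u ∈ torusBox d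
    · rw [Set.indicator_of_mem h, norm_pow, norm_norm]
      refine (norm_trialCharFun_pow_le hx' h r).trans_eq ?_
      congr 2
      refine Finset.sum_congr rfl fun j _ => ?_
      have : (r : ℝ) ≠ 0 := by positivity
      rw [Pi.smul_apply, smul_eq_mul, mul_pow, inv_pow, Real.sq_sqrt (Nat.cast_nonneg r)]
      simp only [hb]
      field_simp
    · rw [Set.indicator_of_notMem h, norm_zero]
      positivity
  · refine Eventually.of_forall fun u => ?_
    refine (tendsto_norm_trialCharFun_pow hx' u).congr' ?_
    have h1 : Tendsto (fun r : ℕ => (√(r : ℝ))⁻¹ • u) atTop (𝓝 0) := by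
      have : Tendsto (fun r : ℕ => (√(r : ℝ))⁻¹) atTop (𝓝 0) :=
        tendsto_inv_atTop_zero.comp (Real.tendsto_sqrt_atTop.comp tendsto_natCast_atTop_atTop)
      simpa using this.smul_const u
    filter_upwards [h1 (torusBox_mem_nhds d)] with r hr
    rw [hF]
    exact (Set.indicator_of_mem hr _).symm

/-! ### The Gaussian integral of the covariance form -/

theorem integral_comp_mulVec {d : ℕ} (M : Matrix (Fin d) (Fin d) ℝ) (hM : M.det ≠ 0)
    {g : (Fin d → ℝ) → ℝ} (hg : Continuous g) :
    ∫ u, g (M.mulVec u) = |M.det|⁻¹ * ∫ v, g v := by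
  have h := Real.map_matrix_volume_pi_eq_smul_volume_pi hM
  have hc : Continuous (Matrix.toLin' M) := (Matrix.toLin' M).continuous_of_finiteDimensional
  have h2 := integral_map (μ := (volume : Measure (Fin d → ℝ))) hc.measurable.aemeasurable
    (f := g) hg.aestronglyMeasurable
  rw [h, integral_smul_measure, ENNReal.toReal_ofReal (abs_nonneg _), abs_inv] at h2
  simpa using h2.symm

theorem integral_exp_neg_half_sum_sq (d : ℕ) :
    ∫ v : Fin d → ℝ, Real.exp (-(∑ j, v j ^ 2) / 2) = √(2 * Real.pi) ^ d := by
  have : (fun v : Fin d → ℝ => Real.exp (-(∑ j, v j ^ 2) / 2))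
      = fun v => ∏ j, Real.exp (-(1 / 2) * v j ^ 2) := by
    ext v
    rw [← Real.exp_sum, ← Finset.mul_sum]
    congr 1
    ring
  rw [this, integral_fintype_prod_volume_eq_pow (fun s : ℝ => Real.exp (-(1 / 2) * s ^ 2)),
    integral_gaussian, Fintype.card_fin]
  congr 2
  ring

/-- With w = √x (entrywise), the covariance matrix is diag(w)(I - w wᵀ)diag(w). The explicit square
root I - c w wᵀ of the middle factor turns the form into |Mu|², and the determinant of a rank one
perturbation gives det M. -/
theorem integral_exp_neg_trialCov {d : ℕ} (hd : 1 ≤ d) {x : Fin d → ℝ} (hx : x ∈ simplexInt d) :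
    ∫ u, Real.exp (-(trialCov x u) / 2)
      = (√((∏ j, x j) * (1 - l1 x)))⁻¹ * √(2 * Real.pi) ^ d := by
  have hx0 : ∀ i, 0 < x i := fun i => (hx.1 i).1
  have hq : 0 < 1 - l1 x := sub_pos.2 hx.2
  set S := l1 x with hS
  have hSum : ∑ j, x j = S := (l1_eq_sum fun i => (hx0 i).le).symm
  have : Nonempty (Fin d) := ⟨⟨0, hd⟩⟩
  have hS0 : 0 < S := hSum ▸ Finset.sum_pos (fun i _ => hx0 i) Finset.univ_nonempty
  -- A root of S c² - 2c + 1 = 0, so that (I - c w wᵀ)² = I - w wᵀ because |w|² = S.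
  set c : ℝ := (1 - √(1 - S)) / S with hc
  have hcS : 1 - c * S = √(1 - S) := by rw [hc]; field_simp; ring
  set w : Fin d → ℝ := fun j => √(x j) with hw
  have hw2 : ∀ j, w j * w j = x j := fun j => Real.mul_self_sqrt (hx0 j).le
  set M : Matrix (Fin d) (Fin d) ℝ :=
    (1 + Matrix.replicateCol Unit (-c • w) * Matrix.replicateRow Unit w) * Matrix.diagonal w
    with hMdef
  have hdet : M.det = √((∏ j, x j) * (1 - S)) := by
    rw [hMdef, Matrix.det_mul, Matrix.det_one_add_replicateCol_mul_replicateRow,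
      Matrix.det_diagonal, Real.sqrt_mul (Finset.prod_nonneg fun i _ => (hx0 i).le),
      Real.sqrt_prod _ (fun i _ => (hx0 i).le), mul_comm]
    congr 1
    rw [← hcS, ← hSum, dotProduct_smul, dotProduct]
    simp only [hw2]
    simp [sub_eq_add_neg]
  have hdet0 : 0 < M.det := by
    rw [hdet]
    exact Real.sqrt_pos.2 (mul_pos (Finset.prod_pos fun i _ => hx0 i) hq)
  have hMu : ∀ u j, M.mulVec u j = w j * u j - c * w j * ∑ i, x i * u i := by
    intro u j
    rw [hMdef, ← Matrix.mulVec_mulVec, Matrix.add_mulVec, Matrix.one_mulVec,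
      ← Matrix.mulVec_mulVec]
    have e1 : (Matrix.diagonal w).mulVec u = fun i => w i * u i := by
      ext i; exact Matrix.mulVec_diagonal w u i
    rw [e1]
    have e2 : (Matrix.replicateRow Unit w).mulVec (fun i => w i * u i)
        = fun _ => ∑ i, x i * u i := by
      ext a
      simp only [Matrix.mulVec, dotProduct, Matrix.replicateRow_apply]
      exact Finset.sum_congr rfl fun i _ => by rw [← hw2 i]; ring
    rw [e2]
    simp [Matrix.mulVec, dotProduct]
    ring
  have hform : ∀ u, ∑ j, M.mulVec u j ^ 2 = trialCov x u := by
    intro u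
    simp only [hMu]
    set T := ∑ i, x i * u i with hT
    have : ∀ j, (w j * u j - c * w j * T) ^ 2
        = x j * u j ^ 2 - 2 * c * T * (x j * u j) + c ^ 2 * T ^ 2 * x j := by
      intro j
      rw [← hw2 j]
      ring
    simp only [this, Finset.sum_add_distrib, Finset.sum_sub_distrib, ← Finset.mul_sum]
    rw [hSum, ← hT, trialCov, ← hT]
    have h1 : (1 - c * S) ^ 2 = 1 - S := by rw [hcS, Real.sq_sqrt hq.le]
    have h2 : -2 * c + c ^ 2 * S = -1 := by
      have : S * (-2 * c + c ^ 2 * S + 1) = 0 := by linear_combination h1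
      rcases mul_eq_zero.1 this with h | h
      · exact absurd h hS0.ne'
      · linarith
    linear_combination T ^ 2 * h2
  simp only [← hform]
  rw [integral_comp_mulVec M hdet0.ne' (g := fun v => Real.exp (-(∑ j, v j ^ 2) / 2))
    (by fun_prop), integral_exp_neg_half_sum_sq, abs_of_pos hdet0, hdet]

/-! ### Asymptotics of the maximum and of the sum of squares of multinomial probabilities -/

theorem exists_sqrt_pow_mul_multinomialProb_le {d : ℕ} {x : Fin d → ℝ} (hx : x ∈ simplexInt d) :
    ∃ C, 0 ≤ C ∧ ∀ r : ℕ, ∀ k ∈ lattice d r, √(r : ℝ) ^ d * multinomialProb k r x ≤ C := by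
  obtain ⟨C, hC⟩ := (tendsto_integral_norm_trialCharFun_pow hx).bddAbove_range
  have hC' : ∀ r : ℕ, √(r : ℝ) ^ d * ∫ t in torusBox d, ‖trialCharFun x t‖ ^ r ≤ C :=
    fun r => hC ⟨r, rfl⟩
  have hpi : 0 < (2 * Real.pi) ^ d := by positivity
  refine ⟨((2 * Real.pi) ^ d)⁻¹ * C, ?_, fun r k hk => ?_⟩
  · refine mul_nonneg (inv_nonneg.2 hpi.le) (le_trans ?_ (hC' 0))
    exact mul_nonneg (by positivity) (integral_nonneg fun t => by positivity)
  · rw [← div_eq_inv_mul, le_div_iff₀ hpi]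
    refine le_trans ?_ (hC' r)
    rw [mul_assoc, mul_comm _ ((2 * Real.pi) ^ d)]
    exact mul_le_mul_of_nonneg_left (two_pi_pow_mul_multinomialProb_le x hk) (by positivity)

theorem psi_eq {d : ℕ} {x : Fin d → ℝ} (hx : x ∈ simplexInt d) :
    psi x = (√((∏ j, x j) * (1 - l1 x)) * √(4 * Real.pi) ^ d)⁻¹ := by
  have hp : 0 ≤ ∏ j, x j := Finset.prod_nonneg fun i _ => (hx.1 i).1.le
  have hq : 0 ≤ 1 - l1 x := sub_nonneg.2 hx.2.le
  have h4 : (0 : ℝ) ≤ 4 * Real.pi := by positivity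
  rw [psi, Real.rpow_neg (by positivity), ← Real.sqrt_eq_rpow, mul_assoc,
    Real.sqrt_mul (by positivity), mul_comm]
  congr 2
  rw [← Real.sqrt_sq (pow_nonneg (Real.sqrt_nonneg (4 * Real.pi)) d), ← pow_mul, mul_comm d 2,
    pow_mul, Real.sq_sqrt h4]

theorem psi_pos {d : ℕ} {x : Fin d → ℝ} (hx : x ∈ simplexInt d) : 0 < psi x := by
  rw [psi_eq hx]
  have hp : 0 < ∏ j, x j := Finset.prod_pos fun i _ => (hx.1 i).1
  have hq : 0 < 1 - l1 x := sub_pos.2 hx.2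
  positivity

theorem tendsto_sum_multinomialProb_sq {d : ℕ} (hd : 1 ≤ d) {x : Fin d → ℝ}
    (hx : x ∈ simplexInt d) :
    Tendsto (fun r : ℕ => √(r : ℝ) ^ d * ∑ k ∈ lattice d r, multinomialProb k r x ^ 2) atTop
      (𝓝 (psi x)) := by
  have h := (tendsto_integral_norm_trialCharFun_pow hx).comp
    (tendsto_id.const_mul_atTop' (two_pos : (0 : ℕ) < 2))
  rw [integral_exp_neg_trialCov hd hx] at h
  -- The integral limit is taken along the exponents 2r: the factor 2^{-d/2} turns √(2r)^d into
  -- √r^d, and (2π)^{-d} comes from Parseval. The constants combine to (4π)^{-d/2}.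
  have h2 := h.const_mul (((2 * Real.pi) ^ d)⁻¹ * (√2 ^ d)⁻¹)
  have hpi : 0 < (2 * Real.pi) ^ d := by positivity
  have hs2 : 0 < √(2 : ℝ) := by positivity
  have hsp : 0 < √(2 * Real.pi) := by positivity
  convert! h2 using 2 with r
  · simp only [Function.comp_apply, id]
    rw [← two_pi_pow_mul_sum_multinomialProb_sq]
    push_cast
    rw [Real.sqrt_mul zero_le_two, mul_pow]
    field_simp
    ring
  · rw [psi_eq hx]
    have e1 : √(4 * Real.pi) = √2 * √(2 * Real.pi) := by
      rw [← Real.sqrt_mul zero_le_two]; ring_nf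
    have e2 : (2 * Real.pi) ^ d = √(2 * Real.pi) ^ d * √(2 * Real.pi) ^ d := by
      rw [← mul_pow, Real.mul_self_sqrt (by positivity)]
    rw [e1, e2, mul_pow, mul_inv, mul_inv, mul_inv]
    field_simp

/-! ### Geometry of the simplex -/

theorem continuous_l1 {d : ℕ} : Continuous (l1 : (Fin d → ℝ) → ℝ) := by
  unfold l1
  fun_prop

theorem isOpen_simplexInt (d : ℕ) : IsOpen (simplexInt d) := by
  have : simplexInt d = (Set.pi Set.univ fun _ => Set.Ioo (0 : ℝ) 1) ∩ {x | l1 x < 1} := by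
    ext x; simp [simplexInt]
  rw [this]
  exact (isOpen_set_pi Set.finite_univ fun _ _ => isOpen_Ioo).inter
    (isOpen_lt continuous_l1 continuous_const)

theorem simplex_mem_nhds {d : ℕ} {x : Fin d → ℝ} (hx : x ∈ simplexInt d) : simplex d ∈ 𝓝 x :=
  mem_of_superset ((isOpen_simplexInt d).mem_nhds hx) fun _ => mem_simplex_of_mem_simplexInt

theorem isCompact_simplex (d : ℕ) : IsCompact (simplex d) := by
  have : simplex d = (Set.pi Set.univ fun _ => Set.Icc (0 : ℝ) 1) ∩ {x | l1 x ≤ 1} := by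
    ext x; simp only [simplex, Set.mem_ofPred_eq, Set.mem_inter_iff, Set.mem_univ_pi]
  rw [this]
  exact (isCompact_univ_pi fun _ => isCompact_Icc).inter_right
    (isClosed_le continuous_l1 continuous_const)

theorem convex_simplex (d : ℕ) : Convex ℝ (simplex d) := by
  intro x hx y hy a b ha hb hab
  refine ⟨fun i => convex_Icc (0 : ℝ) 1 (hx.1 i) (hy.1 i) ha hb hab, ?_⟩
  have : l1 (a • x + b • y) ≤ a * l1 x + b * l1 y := by
    simp only [l1, Finset.mul_sum, ← Finset.sum_add_distrib]
    refine Finset.sum_le_sum fun i _ => (abs_add_le _ _).trans_eq ?_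
    simp [abs_mul, abs_of_nonneg ha, abs_of_nonneg hb]
  nlinarith [hx.2, hy.2]

theorem simplexInt_nonempty (d : ℕ) : (simplexInt d).Nonempty := by
  refine ⟨fun _ => 1 / ((d : ℝ) + 1), fun i => ⟨by positivity, ?_⟩, ?_⟩
  · have : 0 < d := i.pos
    rw [div_lt_one (by positivity)]
    have : (0 : ℝ) < d := by positivity
    linarith
  · have : (0 : ℝ) < (d : ℝ) + 1 := by positivity
    simp only [l1, abs_of_pos (div_pos one_pos this), Finset.sum_const, Finset.card_univ,
      Fintype.card_fin, nsmul_eq_mul]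
    rw [mul_one_div, div_lt_one this]
    linarith

theorem uniqueDiffOn_simplex (d : ℕ) : UniqueDiffOn ℝ (simplex d) := by
  refine uniqueDiffOn_convex (convex_simplex d) ?_
  obtain ⟨x, hx⟩ := simplexInt_nonempty d
  exact ⟨x, mem_interior_iff_mem_nhds.2 (simplex_mem_nhds hx)⟩

/-! ### Second order Taylor expansion on the simplex -/

section Taylor

variable {d : ℕ} {f : (Fin d → ℝ) → ℝ}

/-- Derivatives within the simplex agree with the ordinary ones in the interior and are continuous
up to the boundary, so compactness makes all estimates uniform. -/
theorem pderiv_eq {x : Fin d → ℝ} (hx : x ∈ simplexInt d) (i : Fin d) :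
    pderiv i f x = fderivWithin ℝ f (simplex d) x (Pi.single i 1) := by
  rw [pderiv, fderivWithin_of_mem_nhds (simplex_mem_nhds hx)]

theorem contDiffOn_fderivWithin (hf : ContDiffOn ℝ 2 f (simplex d)) :
    ContDiffOn ℝ 1 (fderivWithin ℝ f (simplex d)) (simplex d) :=
  hf.fderivWithin (uniqueDiffOn_simplex d) (by norm_num)

theorem pderiv_pderiv_eq (hf : ContDiffOn ℝ 2 f (simplex d)) {x : Fin d → ℝ}
    (hx : x ∈ simplexInt d) (i j : Fin d) :
    pderiv i (pderiv j f) x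
      = fderivWithin ℝ (fderivWithin ℝ f (simplex d)) (simplex d) x (Pi.single i 1)
          (Pi.single j 1) := by
  have h : pderiv j f =ᶠ[𝓝 x] fun y => fderivWithin ℝ f (simplex d) y (Pi.single j 1) := by
    filter_upwards [(isOpen_simplexInt d).mem_nhds hx] with y hy using pderiv_eq hy j
  have hd : DifferentiableAt ℝ (fderivWithin ℝ f (simplex d)) x :=
    ((contDiffOn_fderivWithin hf).differentiableOn one_ne_zero x
      (mem_simplex_of_mem_simplexInt hx)).differentiableAt (simplex_mem_nhds hx)
  rw [pderiv, h.fderiv_eq, fderiv_clm_apply hd (differentiableAt_const _),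
    fderivWithin_of_mem_nhds (simplex_mem_nhds hx) (f := fderivWithin ℝ f (simplex d))]
  simp

theorem continuousOn_fderivWithin_fderivWithin (hf : ContDiffOn ℝ 2 f (simplex d)) :
    ContinuousOn (fderivWithin ℝ (fderivWithin ℝ f (simplex d)) (simplex d)) (simplex d) :=
  (contDiffOn_fderivWithin hf).continuousOn_fderivWithin (uniqueDiffOn_simplex d) le_rfl

/-- Two applications of the mean value inequality along the segment from `x` to `x + v`, first to
the derivative and then to `f`. The constant is not sharp. -/
theorem abs_taylor_remainder_le (hf : ContDiffOn ℝ 2 f (simplex d)) {x v : Fin d → ℝ} {M : ℝ}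
    (hx : x ∈ simplex d) (hxv : x + v ∈ simplex d)
    (hM : ∀ t ∈ Set.Icc (0 : ℝ) 1,
      ‖fderivWithin ℝ (fderivWithin ℝ f (simplex d)) (simplex d) (x + t • v)
        - fderivWithin ℝ (fderivWithin ℝ f (simplex d)) (simplex d) x‖ ≤ M) :
    |f (x + v) - f x - fderivWithin ℝ f (simplex d) x v
        - 1 / 2 * fderivWithin ℝ (fderivWithin ℝ f (simplex d)) (simplex d) x v v|
      ≤ M * ‖v‖ ^ 2 := by
  set S := simplex d
  set f1 := fderivWithin ℝ f S with hf1
  set f2 := fderivWithin ℝ f1 S with hf2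
  have hM0 : 0 ≤ M := le_trans (norm_nonneg (_ : (Fin d → ℝ) →L[ℝ] (Fin d → ℝ) →L[ℝ] ℝ)) (hM 0 (by simp))
  have hseg : ∀ t ∈ Set.Icc (0 : ℝ) 1, x + t • v ∈ S := fun t ht => by
    have := (convex_simplex d) hx hxv (sub_nonneg.2 ht.2) ht.1 (by ring)
    convert! this using 1
    module
  have hline : ∀ t : ℝ, HasDerivWithinAt (fun t : ℝ => x + t • v) v (Set.Icc 0 1) t := fun t => by
    have := ((hasDerivAt_id t).smul_const v).const_add x
    simpa using this.hasDerivWithinAt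
  have hd0 : ∀ t ∈ Set.Icc (0 : ℝ) 1,
      HasDerivWithinAt (fun t : ℝ => f (x + t • v)) (f1 (x + t • v) v) (Set.Icc 0 1) t := by
    intro t ht
    have h := (hf.differentiableOn two_ne_zero _ (hseg t ht)).hasFDerivWithinAt
    exact h.comp_hasDerivWithinAt t (hline t) hseg
  have hd1 : ∀ t ∈ Set.Icc (0 : ℝ) 1,
      HasDerivWithinAt (fun t : ℝ => f1 (x + t • v) v) (f2 (x + t • v) v v) (Set.Icc 0 1) t := by
    intro t ht
    have h := ((contDiffOn_fderivWithin hf).differentiableOn one_ne_zero _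
      (hseg t ht)).hasFDerivWithinAt
    have h' := h.comp_hasDerivWithinAt t (hline t) hseg
    simpa using h'.clm_apply (hasDerivWithinAt_const t _ v)
  have hb1 : ∀ t ∈ Set.Icc (0 : ℝ) 1, ‖f1 (x + t • v) v - f1 x v - t * f2 x v v‖ ≤ M * ‖v‖ ^ 2 := by
    intro t ht
    have key := norm_image_sub_le_of_norm_deriv_le_segment'
      (f := fun s : ℝ => f1 (x + s • v) v - s * f2 x v v)
      (f' := fun s => f2 (x + s • v) v v - f2 x v v) (C := M * ‖v‖ ^ 2) (a := 0) (b := 1)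
      (fun s hs => by
        have := (hd1 s hs).sub ((hasDerivWithinAt_id s _).mul_const (f2 x v v))
        rw [one_mul] at this
        exact this)
      (fun s hs => by
        have e : f2 (x + s • v) v v - f2 x v v = (f2 (x + s • v) - f2 x) v v := by simp
        rw [e]
        refine (ContinuousLinearMap.le_opNorm₂ _ _ _).trans ?_
        rw [mul_assoc, ← sq]
        exact mul_le_mul_of_nonneg_right (hM s (Set.Ico_subset_Icc_self hs)) (sq_nonneg _))
      t ht
    have e : f1 (x + t • v) v - f1 x v - t * f2 x v v
        = f1 (x + t • v) v - t * f2 x v v - (f1 (x + (0 : ℝ) • v) v - 0 * f2 x v v) := by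
      simp; ring
    rw [e]
    refine key.trans ?_
    have := mul_le_mul_of_nonneg_left ht.2 (mul_nonneg hM0 (sq_nonneg ‖v‖))
    linarith
  have key := norm_image_sub_le_of_norm_deriv_le_segment_01'
    (f := fun s : ℝ => f (x + s • v) - s * f1 x v - s ^ 2 * (1 / 2 * f2 x v v))
    (f' := fun s => f1 (x + s • v) v - f1 x v - s * f2 x v v) (C := M * ‖v‖ ^ 2)
    (fun s hs => by
      have h2 := (((hasDerivWithinAt_id s (Set.Icc 0 1)).pow 2).mul_const (1 / 2 * f2 x v v))
      have := ((hd0 s hs).sub ((hasDerivWithinAt_id s _).mul_const (f1 x v))).sub h2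
      convert! this using 1
      simp
      ring)
    (fun s hs => hb1 s (Set.Ico_subset_Icc_self hs))
  rw [Real.norm_eq_abs] at key
  convert! key using 2
  simp
  ring

/-- Bounds on a `C²` function, its first two derivatives, and its second order Taylor remainder,
uniform over the simplex. -/
theorem exists_bound_fderivWithin (hf : ContDiffOn ℝ 2 f (simplex d)) :
    ∃ K, 0 ≤ K ∧ ∀ x ∈ simplex d, |f x| ≤ K ∧ ‖fderivWithin ℝ f (simplex d) x‖ ≤ K ∧
      ‖fderivWithin ℝ (fderivWithin ℝ f (simplex d)) (simplex d) x‖ ≤ K := by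
  obtain ⟨K0, h0⟩ := (isCompact_simplex d).exists_bound_of_continuousOn hf.continuousOn
  obtain ⟨K1, h1⟩ := (isCompact_simplex d).exists_bound_of_continuousOn
    (contDiffOn_fderivWithin hf).continuousOn
  obtain ⟨K2, h2⟩ := (isCompact_simplex d).exists_bound_of_continuousOn
    (E := (Fin d → ℝ) →L[ℝ] (Fin d → ℝ) →L[ℝ] ℝ)
    (continuousOn_fderivWithin_fderivWithin hf)
  refine ⟨max 0 (max K0 (max K1 K2)), le_max_left _ _, fun x hx => ⟨?_, ?_, ?_⟩⟩
  · exact (h0 x hx).trans (by simp)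
  · exact (h1 x hx).trans (by simp)
  · exact (h2 x hx).trans (by simp)

/-- For ‖v‖ < δ, uniform continuity of the second derivative gives ε. Otherwise its oscillation 2K
is at most (2K/δ²)‖v‖². The remainder o(‖v‖²) thus becomes a polynomial bound that can be averaged
with moments alone. -/
theorem exists_taylor_bound (hf : ContDiffOn ℝ 2 f (simplex d)) {ε : ℝ} (hε : 0 < ε) :
    ∃ C, 0 ≤ C ∧ ∀ x v : Fin d → ℝ, x ∈ simplex d → x + v ∈ simplex d →
      |f (x + v) - f x - fderivWithin ℝ f (simplex d) x v
        - 1 / 2 * fderivWithin ℝ (fderivWithin ℝ f (simplex d)) (simplex d) x v v|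
      ≤ ε * ‖v‖ ^ 2 + C * ‖v‖ ^ 4 := by
  obtain ⟨K, hK0, hK⟩ := exists_bound_fderivWithin hf
  have huc := (isCompact_simplex d).uniformContinuousOn_of_continuous
    (β := (Fin d → ℝ) →L[ℝ] (Fin d → ℝ) →L[ℝ] ℝ)
    (continuousOn_fderivWithin_fderivWithin hf)
  obtain ⟨δ, hδ, H⟩ := (Metric.uniformContinuousOn_iff
    (β := (Fin d → ℝ) →L[ℝ] (Fin d → ℝ) →L[ℝ] ℝ)).1 huc ε hε
  refine ⟨2 * K / δ ^ 2, by positivity, fun x v hx hxv => ?_⟩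
  have hseg : ∀ t ∈ Set.Icc (0 : ℝ) 1, x + t • v ∈ simplex d := fun t ht => by
    have := (convex_simplex d) hx hxv (sub_nonneg.2 ht.2) ht.1 (by ring)
    convert! this using 1
    module
  have : ε * ‖v‖ ^ 2 + 2 * K / δ ^ 2 * ‖v‖ ^ 4 = (ε + 2 * K / δ ^ 2 * ‖v‖ ^ 2) * ‖v‖ ^ 2 := by ring
  rw [this]
  refine abs_taylor_remainder_le hf hx hxv fun t ht => ?_
  by_cases hv : ‖v‖ < δ
  · have hd : dist (x + t • v) x < δ := by
      rw [dist_eq_norm, add_sub_cancel_left, norm_smul, Real.norm_of_nonneg ht.1]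
      exact (mul_le_of_le_one_left (norm_nonneg v) ht.2).trans_lt hv
    have h := (dist_eq_norm (E := (Fin d → ℝ) →L[ℝ] (Fin d → ℝ) →L[ℝ] ℝ) _ _).symm.trans_lt
      (H _ (hseg t ht) x hx hd)
    refine h.le.trans (le_add_of_nonneg_right (by positivity))
  · push Not at hv
    refine le_trans (norm_sub_le (E := (Fin d → ℝ) →L[ℝ] (Fin d → ℝ) →L[ℝ] ℝ) _ _) ?_
    have h1 := (hK _ (hseg t ht)).2.2
    have h2 := (hK x hx).2.2
    have h3 : 2 * K ≤ 2 * K / δ ^ 2 * ‖v‖ ^ 2 := by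
      rw [div_mul_eq_mul_div, le_div_iff₀ (by positivity)]
      exact mul_le_mul_of_nonneg_left (pow_le_pow_left₀ hδ.le hv 2) (by positivity)
    linarith

theorem abs_sub_le_of_simplex {K : ℝ} (hf : ContDiffOn ℝ 2 f (simplex d))
    (hK : ∀ x ∈ simplex d, ‖fderivWithin ℝ f (simplex d) x‖ ≤ K) {x y : Fin d → ℝ}
    (hx : x ∈ simplex d) (hy : y ∈ simplex d) : |f y - f x| ≤ K * ‖y - x‖ :=
  (convex_simplex d).norm_image_sub_le_of_norm_fderivWithin_le
    (hf.differentiableOn two_ne_zero) hK hx hy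

end Taylor

/-! ### Averages over cells -/

section Cells

variable {d : ℕ} {f : (Fin d → ℝ) → ℝ}

/-- The average over a cell of the extension of `f` by zero outside the simplex. -/
noncomputable def cellMean (f : (Fin d → ℝ) → ℝ) (m : ℕ) (k : Fin d → ℕ) : ℝ :=
  (m : ℝ) ^ d * ∫ y in cell m k ∩ simplex d, f y

theorem measurableSet_cell (m : ℕ) (k : Fin d → ℕ) : MeasurableSet (cell m k) :=
  MeasurableSet.univ_pi fun _ => measurableSet_Ioc

theorem pow_mul_setIntegral_cell_prod {m : ℕ} (k : Fin d → ℕ) (g : Fin d → ℝ → ℝ) :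
    (m : ℝ) ^ d * ∫ y in cell m k, ∏ j, g j (y j)
      = ∏ j, ((m : ℝ) * ∫ s in Set.Ioc ((k j : ℝ) / m) (((k j : ℝ) + 1) / m), g j s) := by
  rw [cell, volume_pi, Measure.restrict_pi_pi, integral_fintype_prod_eq_prod,
    Finset.prod_mul_distrib]
  simp

theorem mul_setIntegral_Ioc_one {m : ℕ} (hm : 0 < m) (a : ℕ) :
    (m : ℝ) * ∫ _ in Set.Ioc ((a : ℝ) / m) (((a : ℝ) + 1) / m), (1 : ℝ) = 1 := by
  have : (m : ℝ) ≠ 0 := by positivity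
  have h : (a : ℝ) / m ≤ ((a : ℝ) + 1) / m := by gcongr; linarith
  rw [← intervalIntegral.integral_of_le h, integral_one]
  field_simp
  ring

theorem mul_setIntegral_Ioc_id {m : ℕ} (hm : 0 < m) (a : ℕ) :
    (m : ℝ) * ∫ s in Set.Ioc ((a : ℝ) / m) (((a : ℝ) + 1) / m), s = ((a : ℝ) + 1 / 2) / m := by
  have : (m : ℝ) ≠ 0 := by positivity
  have h : (a : ℝ) / m ≤ ((a : ℝ) + 1) / m := by gcongr; linarith
  rw [← intervalIntegral.integral_of_le h, integral_id]
  field_simp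
  ring

theorem pow_mul_volume_cell {m : ℕ} (hm : 0 < m) (k : Fin d → ℕ) :
    (m : ℝ) ^ d * volume.real (cell m k) = 1 := by
  have h := pow_mul_setIntegral_cell_prod (m := m) k fun _ _ => 1
  rw [Finset.prod_eq_one fun j _ => mul_setIntegral_Ioc_one hm (k j)] at h
  simpa using h

theorem pow_mul_setIntegral_cell_coord {m : ℕ} (hm : 0 < m) (k : Fin d → ℕ) (i : Fin d) :
    (m : ℝ) ^ d * ∫ y in cell m k, y i = ((k i : ℝ) + 1 / 2) / m := by
  have h := pow_mul_setIntegral_cell_prod (m := m) k fun j s => if j = i then s else 1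
  have e : ∀ y : Fin d → ℝ, ∏ j, (if j = i then y j else 1) = y i := fun y => by simp
  simp only [e] at h
  rw [h, Fintype.prod_eq_single i]
  · simp [mul_setIntegral_Ioc_id hm]
  · intro j hj
    simp only [hj, if_false]
    exact mul_setIntegral_Ioc_one hm _

theorem cell_subset_simplex {m : ℕ} (hm : 0 < m) {k : Fin d → ℕ} (hk : ∑ i, k i + d ≤ m) :
    cell m k ⊆ simplex d := by
  have hm' : (0 : ℝ) < m := by positivity
  intro y hy
  have h0 : ∀ i, 0 ≤ y i := fun i => le_trans (by positivity) (hy i trivial).1.le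
  have hs : l1 y ≤ 1 := by
    rw [l1_eq_sum h0]
    have h1 : ∑ i, y i ≤ ∑ i, ((k i : ℝ) + 1) / m := Finset.sum_le_sum fun i _ => (hy i trivial).2
    refine h1.trans ?_
    rw [← Finset.sum_div, div_le_one hm', Finset.sum_add_distrib]
    simp only [Finset.sum_const, Finset.card_univ, Fintype.card_fin, nsmul_eq_mul, mul_one]
    exact_mod_cast hk
  refine ⟨fun i => ⟨h0 i, ?_⟩, hs⟩
  rw [l1_eq_sum h0] at hs
  exact (Finset.single_le_sum (fun j _ => h0 j) (Finset.mem_univ i)).trans hs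

theorem volume_cell_lt_top (m : ℕ) (k : Fin d → ℕ) : volume (cell m k) < ⊤ :=
  (measure_mono (Set.pi_mono fun _ _ => Set.Ioc_subset_Icc_self)).trans_lt
    (isCompact_univ_pi fun _ => isCompact_Icc).measure_lt_top

theorem integrableOn_cell {E : Type*} [NormedAddCommGroup E] {g : (Fin d → ℝ) → E}
    (hg : Continuous g) (m : ℕ) (k : Fin d → ℕ) : IntegrableOn g (cell m k) :=
  (hg.continuousOn.integrableOn_compact
    (isCompact_univ_pi fun _ : Fin d => isCompact_Icc)).mono_set
    (Set.pi_mono fun _ _ => Set.Ioc_subset_Icc_self)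

theorem abs_cellMean_le {m : ℕ} (hm : 0 < m) {K : ℝ} (hK : ∀ y ∈ simplex d, |f y| ≤ K)
    (k : Fin d → ℕ) : |cellMean f m k| ≤ K := by
  have hK0 : 0 ≤ K := by
    obtain ⟨x, hx⟩ := simplexInt_nonempty d
    exact (abs_nonneg _).trans (hK x (mem_simplex_of_mem_simplexInt hx))
  have hfin : volume (cell m k ∩ simplex d) < ⊤ :=
    (measure_mono Set.inter_subset_left).trans_lt (volume_cell_lt_top m k)
  have h := norm_setIntegral_le_of_norm_le_const (f := f) hfin fun y hy => hK y hy.2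
  rw [cellMean, abs_mul, abs_of_nonneg (by positivity)]
  have h2 : volume.real (cell m k ∩ simplex d) ≤ volume.real (cell m k) :=
    measureReal_mono Set.inter_subset_left (volume_cell_lt_top m k).ne
  calc (m : ℝ) ^ d * |∫ y in cell m k ∩ simplex d, f y|
      ≤ (m : ℝ) ^ d * (K * volume.real (cell m k)) := by
        refine mul_le_mul_of_nonneg_left (h.trans ?_) (by positivity)
        exact mul_le_mul_of_nonneg_left h2 hK0
    _ = K * ((m : ℝ) ^ d * volume.real (cell m k)) := by ring
    _ = K := by rw [pow_mul_volume_cell hm, mul_one]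

theorem clm_apply_eq_sum {F : Type*} [AddCommGroup F] [Module ℝ F] [TopologicalSpace F]
    (L : (Fin d → ℝ) →L[ℝ] F) (v : Fin d → ℝ) : L v = ∑ i, v i • L (Pi.single i 1) := by
  conv_lhs => rw [pi_eq_sum_univ v, map_sum]
  refine Finset.sum_congr rfl fun i _ => ?_
  rw [map_smul]
  congr 2
  ext j
  simp [Pi.single_apply, eq_comm]

theorem integrableOn_simplex (hf : ContDiffOn ℝ 2 f (simplex d)) :
    IntegrableOn f (simplex d) :=
  hf.continuousOn.integrableOn_compact (isCompact_simplex d)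

/-- An affine approximation of `f` on a cell integrates to its value at the midpoint. -/
theorem abs_cellMean_sub_le (hf : ContDiffOn ℝ 2 f (simplex d)) {m : ℕ} (hm : 0 < m)
    {k : Fin d → ℕ} (hk : ∑ i, k i + d ≤ m) (x : Fin d → ℝ) (c B : ℝ)
    (L : (Fin d → ℝ) →L[ℝ] ℝ) (hB : ∀ y ∈ cell m k, |f y - c - L (y - x)| ≤ B) :
    |cellMean f m k - (c + L (fun i => ((k i : ℝ) + 1 / 2) / m - x i))| ≤ B := by
  have hsub := cell_subset_simplex hm hk
  have hfi : IntegrableOn f (cell m k) := (integrableOn_simplex hf).mono_set hsub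
  have hci : ∀ c : ℝ, IntegrableOn (fun _ => c) (cell m k) := fun c =>
    integrableOn_cell continuous_const m k
  have hLi : IntegrableOn (fun y => L (y - x)) (cell m k) :=
    integrableOn_cell (by fun_prop) m k
  have hone : ∀ c : ℝ, (m : ℝ) ^ d * ∫ _ in cell m k, c = c := fun c => by
    rw [setIntegral_const, smul_eq_mul, ← mul_assoc, pow_mul_volume_cell hm, one_mul]
  have hL : (m : ℝ) ^ d * ∫ y in cell m k, L (y - x)
      = L (fun i => ((k i : ℝ) + 1 / 2) / m - x i) := by
    have e : ∀ y : Fin d → ℝ, L (y - x)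
        = ∑ i, (y i * L (Pi.single i 1) - x i * L (Pi.single i 1)) := fun y => by
      rw [clm_apply_eq_sum L (y - x)]
      exact Finset.sum_congr rfl fun i _ => by simp [sub_mul]
    simp only [e]
    rw [integral_finsetSum _ fun i _ => integrableOn_cell (by fun_prop) m k, Finset.mul_sum,
      clm_apply_eq_sum L]
    refine Finset.sum_congr rfl fun i _ => ?_
    rw [integral_sub (integrableOn_cell (by fun_prop) m k) (hci _), mul_sub, hone,
      integral_mul_const, ← mul_assoc, pow_mul_setIntegral_cell_coord hm, smul_eq_mul, sub_mul]
  have key : cellMean f m k - (c + L (fun i => ((k i : ℝ) + 1 / 2) / m - x i))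
      = (m : ℝ) ^ d * ∫ y in cell m k, (f y - c - L (y - x)) := by
    rw [integral_sub (f := fun y => f y - c) (hfi.sub (hci c)) hLi, integral_sub hfi (hci c), mul_sub, mul_sub, hone, hL,
      cellMean, Set.inter_eq_left.2 hsub]
    ring
  have h := norm_setIntegral_le_of_norm_le_const (f := fun y => f y - c - L (y - x))
    (volume_cell_lt_top m k) hB
  rw [key, abs_mul, abs_of_nonneg (by positivity)]
  calc (m : ℝ) ^ d * |∫ y in cell m k, (f y - c - L (y - x))|
      ≤ (m : ℝ) ^ d * (B * volume.real (cell m k)) :=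
        mul_le_mul_of_nonneg_left h (by positivity)
    _ = B * ((m : ℝ) ^ d * volume.real (cell m k)) := by ring
    _ = B := by rw [pow_mul_volume_cell hm, mul_one]

/-- The deviation `k - (m - 1) x` of a lattice point from the multinomial mean. -/
def deviation (m : ℕ) (x : Fin d → ℝ) (k : Fin d → ℕ) : Fin d → ℝ :=
  fun i => (k i : ℝ) - ((m - 1 : ℕ) : ℝ) * x i

/-- For `y` in the cell of `k`, the vector `m (y - x)` is within `1` of the deviation of `k`. -/
theorem norm_smul_sub_deviation_le {m : ℕ} (hm : 0 < m) {x : Fin d → ℝ} (hx : x ∈ simplex d)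
    {k : Fin d → ℕ} {y : Fin d → ℝ} (hy : y ∈ cell m k) :
    ‖(m : ℝ) • (y - x) - deviation m x k‖ ≤ 1 := by
  have hm' : (0 : ℝ) < m := by positivity
  rw [pi_norm_le_iff_of_nonneg zero_le_one]
  intro i
  have h1 := (div_lt_iff₀ hm').1 (hy i trivial).1
  have h2 := (le_div_iff₀ hm').1 (hy i trivial).2
  obtain ⟨h3, h4⟩ := hx.1 i
  have h5 : ((m - 1 : ℕ) : ℝ) = m - 1 := by rw [Nat.cast_sub hm]; simp
  -- The difference is (m yᵢ - kᵢ) - xᵢ, with the first term in (0, 1] and xᵢ in [0, 1].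
  simp only [Pi.sub_apply, Pi.smul_apply, smul_eq_mul, deviation, h5, Real.norm_eq_abs]
  rw [abs_le]
  constructor <;> nlinarith

/-- The second order approximation of the average of `f` over a cell. -/
noncomputable def cellTaylor (f : (Fin d → ℝ) → ℝ) (m : ℕ) (x : Fin d → ℝ) (k : Fin d → ℕ) : ℝ :=
  f x + 1 / 2 * ((m : ℝ) ^ 2)⁻¹ *
      fderivWithin ℝ (fderivWithin ℝ f (simplex d)) (simplex d) x (deviation m x k)
        (deviation m x k)
    + fderivWithin ℝ f (simplex d) x (fun i => ((k i : ℝ) + 1 / 2) / m - x i)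

/-- The linear term averages exactly to its value at the midpoint. In the quadratic term, y - x = (D
+ W)/m with D the deviation and ‖W‖ ≤ 1; the cross terms are O(‖D‖/m²) and are absorbed by ηa² +
K²/(4η) ≥ Ka. -/
theorem exists_abs_cellMean_sub_cellTaylor_le (hf : ContDiffOn ℝ 2 f (simplex d)) {ε : ℝ}
    (hε : 0 < ε) :
    ∃ C, 0 ≤ C ∧ ∀ m : ℕ, 0 < m → ∀ x ∈ simplex d, ∀ k : Fin d → ℕ, ∑ i, k i + d ≤ m →
      |cellMean f m k - cellTaylor f m x k|
        ≤ ((m : ℝ) ^ 2)⁻¹ * (ε * ‖deviation m x k‖ ^ 2 + C)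
          + ((m : ℝ) ^ 4)⁻¹ * (C * ‖deviation m x k‖ ^ 4) := by
  obtain ⟨K, hK0, hK⟩ := exists_bound_fderivWithin hf
  obtain ⟨C, hC0, hC⟩ := exists_taylor_bound hf (half_pos (half_pos hε))
  -- The Taylor remainder uses 2η of the coefficient of ‖D‖², and the cross terms use another η.
  set η := ε / 4 with hη
  have hη0 : 0 < η := by positivity
  refine ⟨2 * η + K ^ 2 / (4 * η) + K / 2 + 8 * C, by positivity, fun m hm x hx k hk => ?_⟩
  refine abs_cellMean_sub_le hf hm hk x _ _ _ fun y hy => ?_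
  set D := deviation m x k with hD
  set H := fderivWithin ℝ (fderivWithin ℝ f (simplex d)) (simplex d) x with hH
  set L := fderivWithin ℝ f (simplex d) x with hL
  have hm' : (0 : ℝ) < m := by positivity
  have hm1 : (1 : ℝ) ≤ m := by exact_mod_cast hm
  set W := (m : ℝ) • (y - x) - D with hW
  have hW1 : ‖W‖ ≤ 1 := norm_smul_sub_deviation_le hm hx hy
  set v := y - x with hv
  have hvDW : v = (m : ℝ)⁻¹ • (D + W) := by
    rw [hW, add_sub_cancel, smul_smul, inv_mul_cancel₀ hm'.ne', one_smul]
  have hy' : x + v = y := by rw [hv]; abel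
  have htay := hC x v hx (hy'.symm ▸ cell_subset_simplex hm hk hy)
  rw [hy'] at htay
  set a := ‖D‖ with ha
  have ha0 : 0 ≤ a := norm_nonneg D
  have hvn : ‖v‖ ≤ (m : ℝ)⁻¹ * (a + 1) := by
    rw [hvDW, norm_smul, norm_inv, Real.norm_of_nonneg hm'.le]
    refine mul_le_mul_of_nonneg_left ((norm_add_le _ _).trans ?_) (by positivity)
    linarith
  have hv2 : ‖v‖ ^ 2 ≤ ((m : ℝ) ^ 2)⁻¹ * (2 * a ^ 2 + 2) := by
    refine (pow_le_pow_left₀ (norm_nonneg v) hvn 2).trans ?_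
    rw [mul_pow, inv_pow]
    refine mul_le_mul_of_nonneg_left ?_ (by positivity)
    nlinarith [sq_nonneg (a - 1)]
  have hv4 : ‖v‖ ^ 4 ≤ ((m : ℝ) ^ 4)⁻¹ * (8 * a ^ 4 + 8) := by
    have h := pow_le_pow_left₀ (by positivity) hv2 2
    refine le_trans (le_of_eq (by ring)) (h.trans ?_)
    rw [mul_pow, inv_pow, ← pow_mul]
    refine mul_le_mul_of_nonneg_left ?_ (by positivity)
    nlinarith [sq_nonneg (a ^ 2 - 1)]
  have hm24 : ((m : ℝ) ^ 4)⁻¹ ≤ ((m : ℝ) ^ 2)⁻¹ := by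
    rw [inv_le_inv₀ (by positivity) (by positivity)]
    exact pow_le_pow_right₀ hm1 (by norm_num)
  have hHv : H v v = ((m : ℝ) ^ 2)⁻¹ * (H D D + (H D W + (H W D + H W W))) := by
    rw [hvDW]
    simp only [map_smul, map_add, _root_.smul_apply, _root_.add_apply,
      smul_eq_mul]
    field_simp
    ring
  have hHb : ∀ u w : Fin d → ℝ, |H u w| ≤ K * ‖u‖ * ‖w‖ := fun u w =>
    (ContinuousLinearMap.le_opNorm₂ H u w).trans (by gcongr; exact (hK x hx).2.2)
  have hcross : |H D W + (H W D + H W W)| ≤ 2 * K * a + K := by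
    have h1 : |H D W| ≤ K * a := (hHb D W).trans (mul_le_of_le_one_right (by positivity) hW1)
    have h2 : |H W D| ≤ K * a := by
      refine (hHb W D).trans ?_
      rw [mul_assoc]
      exact mul_le_mul_of_nonneg_left (mul_le_of_le_one_left ha0 hW1) hK0
    have h3 : |H W W| ≤ K := by
      refine (hHb W W).trans ?_
      rw [mul_assoc]
      exact mul_le_of_le_one_right hK0 (mul_le_one₀ hW1 (norm_nonneg W) hW1)
    have h4 := abs_add_le (H D W) (H W D + H W W)
    have h5 := abs_add_le (H W D) (H W W)
    linarith
  have hKa : K * a ≤ η * a ^ 2 + K ^ 2 / (4 * η) := by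
    have : η * a ^ 2 + K ^ 2 / (4 * η) - K * a = (2 * η * a - K) ^ 2 / (4 * η) := by
      field_simp; ring
    have h : 0 ≤ (2 * η * a - K) ^ 2 / (4 * η) := by positivity
    linarith
  have e : f y - (f x + 1 / 2 * ((m : ℝ) ^ 2)⁻¹ * H D D) - L v
      = (f y - f x - L v - 1 / 2 * H v v)
        + 1 / 2 * ((m : ℝ) ^ 2)⁻¹ * (H D W + (H W D + H W W)) := by
    rw [hHv]; ring
  rw [e]
  refine (abs_add_le _ _).trans ?_
  rw [abs_mul (1 / 2 * ((m : ℝ) ^ 2)⁻¹), abs_of_nonneg (by positivity : 0 ≤ 1 / 2 * ((m : ℝ) ^ 2)⁻¹)]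
  have hεη : ε / 2 / 2 = η := by rw [hη]; ring
  have hε4 : ε = 4 * η := by rw [hη]; ring
  rw [hεη] at htay
  set p := ((m : ℝ) ^ 2)⁻¹ with hp
  set q := ((m : ℝ) ^ 4)⁻¹ with hq
  have hp0 : 0 ≤ p := by positivity
  have hq0 : 0 ≤ q := by positivity
  have t1 : η * ‖v‖ ^ 2 ≤ η * (p * (2 * a ^ 2 + 2)) := mul_le_mul_of_nonneg_left hv2 hη0.le
  have t2 : C * ‖v‖ ^ 4 ≤ C * (q * (8 * a ^ 4 + 8)) := mul_le_mul_of_nonneg_left hv4 hC0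
  have t3 : 1 / 2 * p * |H D W + (H W D + H W W)|
      ≤ p * (η * a ^ 2 + K ^ 2 / (4 * η) + K / 2) := by
    have := mul_le_mul_of_nonneg_left hcross (by positivity : 0 ≤ 1 / 2 * p)
    have h2 := mul_le_mul_of_nonneg_left hKa hp0
    linarith
  have t4 : C * (q * 8) ≤ p * (8 * C) := by
    have := mul_le_mul_of_nonneg_left hm24 (by positivity : 0 ≤ 8 * C)
    linarith
  have t5 : 0 ≤ q * ((2 * η + K ^ 2 / (4 * η) + K / 2) * a ^ 4) := by positivity
  have t6 : 0 ≤ p * (η * a ^ 2) := by positivity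
  rw [hε4]
  linarith

end Cells

/-! ### The mean of the cell averages -/

section Bias

variable {d : ℕ} {f : (Fin d → ℝ) → ℝ}

theorem norm_pow_le_sum_pow (hd : 1 ≤ d) (v : Fin d → ℝ) {p : ℕ} (hp : Even p) :
    ‖v‖ ^ p ≤ ∑ i, v i ^ p := by
  have : Nonempty (Fin d) := ⟨⟨0, hd⟩⟩
  obtain ⟨i, hi⟩ := Finite.exists_max fun i => ‖v i‖
  have h1 : ‖v‖ ≤ ‖v i‖ := (pi_norm_le_iff_of_nonneg (norm_nonneg _)).2 hi
  refine (pow_le_pow_left₀ (norm_nonneg _) h1 p).trans ?_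
  rw [Real.norm_eq_abs, hp.pow_abs]
  exact Finset.single_le_sum (f := fun j => v j ^ p) (fun j _ => hp.pow_nonneg _)
    (Finset.mem_univ i)

theorem multinomialMean_norm_deviation_sq_le (hd : 1 ≤ d) {x : Fin d → ℝ} (hx : x ∈ simplex d)
    (m : ℕ) : multinomialMean (m - 1) x (fun k => ‖deviation m x k‖ ^ 2) ≤ d * m := by
  calc multinomialMean (m - 1) x (fun k => ‖deviation m x k‖ ^ 2)
      ≤ multinomialMean (m - 1) x (fun k => ∑ i, deviation m x k i ^ 2) :=
        multinomialMean_mono hx fun k _ => norm_pow_le_sum_pow hd _ even_two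
    _ = ∑ i, multinomialMean (m - 1) x (fun k => deviation m x k i ^ 2) :=
        multinomialMean_sum _ _
    _ ≤ ∑ _i : Fin d, ((m - 1 : ℕ) : ℝ) :=
        Finset.sum_le_sum fun i _ => multinomialMean_centered_sq_le hx i
    _ ≤ ∑ _i : Fin d, (m : ℝ) :=
        Finset.sum_le_sum fun i _ => Nat.cast_le.2 (Nat.sub_le m 1)
    _ = d * m := by simp

theorem multinomialMean_norm_deviation_pow_four_le (hd : 1 ≤ d) {x : Fin d → ℝ}
    (hx : x ∈ simplex d) (m : ℕ) :
    multinomialMean (m - 1) x (fun k => ‖deviation m x k‖ ^ 4) ≤ d * (3 * (m : ℝ) ^ 2) := by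
  calc multinomialMean (m - 1) x (fun k => ‖deviation m x k‖ ^ 4)
      ≤ multinomialMean (m - 1) x (fun k => ∑ i, deviation m x k i ^ 4) :=
        multinomialMean_mono hx fun k _ => norm_pow_le_sum_pow hd _ (by decide)
    _ = ∑ i, multinomialMean (m - 1) x (fun k => deviation m x k i ^ 4) :=
        multinomialMean_sum _ _
    _ ≤ ∑ _i : Fin d, 3 * ((m - 1 : ℕ) : ℝ) ^ 2 :=
        Finset.sum_le_sum fun i _ => multinomialMean_centered_pow_four_le hx i
    _ ≤ ∑ _i : Fin d, 3 * (m : ℝ) ^ 2 :=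
        Finset.sum_le_sum fun i _ => by
          have : ((m - 1 : ℕ) : ℝ) ≤ m := Nat.cast_le.2 (Nat.sub_le m 1)
          gcongr
    _ = d * (3 * (m : ℝ) ^ 2) := by simp

theorem norm_deviation_le {m : ℕ} {x : Fin d → ℝ} (hx : x ∈ simplex d)
    {k : Fin d → ℕ} (hk : k ∈ lattice d (m - 1)) : ‖deviation m x k‖ ≤ m := by
  rw [pi_norm_le_iff_of_nonneg (Nat.cast_nonneg m)]
  intro i
  have h1 : k i ≤ m - 1 := (Finset.single_le_sum (f := k) (fun _ _ => Nat.zero_le _)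
    (Finset.mem_univ i)).trans (mem_lattice.1 hk)
  have h1' : (k i : ℝ) ≤ ((m - 1 : ℕ) : ℝ) := Nat.cast_le.2 h1
  have h2 : ((m - 1 : ℕ) : ℝ) ≤ m := Nat.cast_le.2 (Nat.sub_le m 1)
  have h3 : (0 : ℝ) ≤ ((m - 1 : ℕ) : ℝ) := Nat.cast_nonneg _
  have h4 : (0 : ℝ) ≤ k i := Nat.cast_nonneg _
  obtain ⟨h5, h6⟩ := hx.1 i
  rw [Real.norm_eq_abs, deviation, abs_le]
  constructor <;> nlinarith

theorem norm_midpoint_sub_le {m : ℕ} (hm : 0 < m) {x : Fin d → ℝ} (hx : x ∈ simplex d)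
    {k : Fin d → ℕ} (hk : k ∈ lattice d (m - 1)) :
    ‖fun i => ((k i : ℝ) + 1 / 2) / m - x i‖ ≤ 1 := by
  have hm' : (0 : ℝ) < m := by positivity
  rw [pi_norm_le_iff_of_nonneg zero_le_one]
  intro i
  have h1 : k i ≤ m - 1 := (Finset.single_le_sum (f := k) (fun _ _ => Nat.zero_le _)
    (Finset.mem_univ i)).trans (mem_lattice.1 hk)
  have h1' : (k i : ℝ) + 1 ≤ m := by exact_mod_cast (by omega : k i + 1 ≤ m)
  have h4 : (0 : ℝ) ≤ k i := Nat.cast_nonneg _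
  obtain ⟨h5, h6⟩ := hx.1 i
  have h7 : 0 ≤ ((k i : ℝ) + 1 / 2) / m := by positivity
  have h8 : ((k i : ℝ) + 1 / 2) / m ≤ 1 := by rw [div_le_one hm']; linarith
  rw [Real.norm_eq_abs, abs_le]
  constructor <;> linarith

/-- A crude bound for the cells that leave the simplex, where the Taylor comparison is unavailable
and only the small total mass helps. -/
theorem abs_cellTaylor_le {K : ℝ} (hK : ∀ x ∈ simplex d, |f x| ≤ K ∧
      ‖fderivWithin ℝ f (simplex d) x‖ ≤ K ∧
      ‖fderivWithin ℝ (fderivWithin ℝ f (simplex d)) (simplex d) x‖ ≤ K) {m : ℕ} (hm : 0 < m)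
    {x : Fin d → ℝ} (hx : x ∈ simplex d) {k : Fin d → ℕ} (hk : k ∈ lattice d (m - 1)) :
    |cellTaylor f m x k| ≤ 3 * K := by
  obtain ⟨h0, h1, h2⟩ := hK x hx
  have hK0 : 0 ≤ K := (abs_nonneg _).trans h0
  have hm' : (0 : ℝ) < m := by positivity
  set L := fderivWithin ℝ f (simplex d) x
  set H := fderivWithin ℝ (fderivWithin ℝ f (simplex d)) (simplex d) x
  set D := deviation m x k with hD
  have hDm : ‖D‖ ≤ m := norm_deviation_le hx hk
  have hL : |L (fun i => ((k i : ℝ) + 1 / 2) / m - x i)| ≤ K := by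
    refine (L.le_opNorm _).trans ?_
    exact (mul_le_mul h1 (norm_midpoint_sub_le hm hx hk) (norm_nonneg _) hK0).trans_eq (mul_one K)
  have hH : |1 / 2 * ((m : ℝ) ^ 2)⁻¹ * H D D| ≤ K := by
    have h : |H D D| ≤ K * m * m :=
      (ContinuousLinearMap.le_opNorm₂ H D D).trans (by gcongr)
    rw [abs_mul, abs_of_nonneg (by positivity : 0 ≤ 1 / 2 * ((m : ℝ) ^ 2)⁻¹)]
    calc 1 / 2 * ((m : ℝ) ^ 2)⁻¹ * |H D D| ≤ 1 / 2 * ((m : ℝ) ^ 2)⁻¹ * (K * m * m) := by gcongr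
      _ = K / 2 := by field_simp
      _ ≤ K := by linarith
  rw [cellTaylor]
  have h3 := abs_add_le (f x + 1 / 2 * ((m : ℝ) ^ 2)⁻¹ * H D D)
    (L fun i => ((k i : ℝ) + 1 / 2) / m - x i)
  have h4 := abs_add_le (f x) (1 / 2 * ((m : ℝ) ^ 2)⁻¹ * H D D)
  linarith

/-- The trace term of the operator `biasDiff`. -/
theorem multinomialMean_bilin (H : (Fin d → ℝ) →L[ℝ] (Fin d → ℝ) →L[ℝ] ℝ) {x : Fin d → ℝ}
    (hx : x ∈ simplex d) (m : ℕ) :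
    multinomialMean (m - 1) x (fun k => H (deviation m x k) (deviation m x k))
      = ((m - 1 : ℕ) : ℝ) * ∑ i, ∑ j, ((if i = j then x i else 0) - x i * x j)
          * H (Pi.single i 1) (Pi.single j 1) := by
  have e : ∀ v : Fin d → ℝ,
      H v v = ∑ i, ∑ j, H (Pi.single i 1) (Pi.single j 1) * (v i * v j) := fun v => by
    rw [clm_apply_eq_sum H v, _root_.sum_apply]
    refine Finset.sum_congr rfl fun i _ => ?_
    rw [_root_.smul_apply, clm_apply_eq_sum (H (Pi.single i 1)) v, Finset.smul_sum]
    refine Finset.sum_congr rfl fun j _ => ?_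
    simp only [smul_eq_mul]
    ring
  simp only [e, multinomialMean_sum, multinomialMean_const_mul, Finset.mul_sum]
  refine Finset.sum_congr rfl fun i _ => Finset.sum_congr rfl fun j _ => ?_
  have := multinomialMean_centered_mul (r := m - 1) (fun i => (hx.1 i).1) i j
  simp only [deviation]
  rw [this]
  ring

/-- Here m times the argument of `L` is (k - (m - 1)x) + (1/2 - x): the centered part has mean zero,
1/2 comes from the midpoint, and -x from having m - 1 trials instead of m. -/
theorem multinomialMean_clm (L : (Fin d → ℝ) →L[ℝ] ℝ) {x : Fin d → ℝ}
    (hx : x ∈ simplex d) {m : ℕ} (hm : 0 < m) :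
    multinomialMean (m - 1) x (fun k => L (fun i => ((k i : ℝ) + 1 / 2) / m - x i))
      = (m : ℝ)⁻¹ * ∑ i, (1 / 2 - x i) * L (Pi.single i 1) := by
  have hx0 : ∀ i, 0 ≤ x i := fun i => (hx.1 i).1
  have hm' : (0 : ℝ) < m := by positivity
  have e : ∀ k : Fin d → ℕ, L (fun i => ((k i : ℝ) + 1 / 2) / m - x i)
      = ∑ i, (m : ℝ)⁻¹ * L (Pi.single i 1)
          * (((k i : ℝ) - ((m - 1 : ℕ) : ℝ) * x i) + (1 / 2 - x i)) := fun k => by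
    rw [clm_apply_eq_sum L]
    refine Finset.sum_congr rfl fun i _ => ?_
    have h5 : ((m - 1 : ℕ) : ℝ) = m - 1 := by rw [Nat.cast_sub hm]; simp
    rw [h5, smul_eq_mul]
    field_simp
    ring
  simp only [e, multinomialMean_sum, multinomialMean_const_mul, multinomialMean_add,
    multinomialMean_centered hx0, multinomialMean_const hx0, Finset.mul_sum]
  refine Finset.sum_congr rfl fun i _ => by ring

theorem abs_covariance_sum_le {K : ℝ} {x : Fin d → ℝ} (hx : x ∈ simplex d)
    {a : Fin d → Fin d → ℝ} (ha : ∀ i j, |a i j| ≤ K) :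
    |∑ i, ∑ j, ((if i = j then x i else 0) - x i * x j) * a i j| ≤ d * (d * K) := by
  have h : ∀ i j, |((if i = j then x i else 0) - x i * x j) * a i j| ≤ K := fun i j => by
    obtain ⟨h1, h2⟩ := hx.1 i
    obtain ⟨h3, h4⟩ := hx.1 j
    have : |(if i = j then x i else 0) - x i * x j| ≤ 1 := by
      rw [abs_le]
      split_ifs <;> constructor <;> nlinarith
    rw [abs_mul]
    exact (mul_le_mul this (ha i j) (abs_nonneg _) zero_le_one).trans_eq (one_mul K)
  calc |∑ i, ∑ j, ((if i = j then x i else 0) - x i * x j) * a i j|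
      ≤ ∑ i, ∑ j, |((if i = j then x i else 0) - x i * x j) * a i j| :=
        (Finset.abs_sum_le_sum_abs _ _).trans
          (Finset.sum_le_sum fun i _ => Finset.abs_sum_le_sum_abs _ _)
    _ ≤ ∑ _i : Fin d, ∑ _j : Fin d, K :=
        Finset.sum_le_sum fun i _ => Finset.sum_le_sum fun j _ => h i j
    _ = d * (d * K) := by simp

theorem norm_single_one_le (i : Fin d) : ‖(Pi.single i 1 : Fin d → ℝ)‖ ≤ 1 := by
  rw [Pi.norm_single, norm_one]

theorem abs_apply_single_single_le {H : (Fin d → ℝ) →L[ℝ] (Fin d → ℝ) →L[ℝ] ℝ} {K : ℝ}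
    (hH : ‖H‖ ≤ K) (i j : Fin d) : |H (Pi.single i 1) (Pi.single j 1)| ≤ K := by
  have h : ‖H (Pi.single i 1) (Pi.single j 1)‖ ≤ ‖H‖ * 1 * 1 :=
    (ContinuousLinearMap.le_opNorm₂ H _ _).trans (by gcongr <;> exact norm_single_one_le _)
  rw [mul_one, mul_one] at h
  exact h.trans hH

theorem biasDiff_eq (hf : ContDiffOn ℝ 2 f (simplex d)) {x : Fin d → ℝ} (hx : x ∈ simplexInt d) :
    biasDiff f x = (∑ i, (1 / 2 - x i) * fderivWithin ℝ f (simplex d) x (Pi.single i 1))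
      + (1 / 2) * ∑ i, ∑ j, ((if i = j then x i else 0) - x i * x j)
        * fderivWithin ℝ (fderivWithin ℝ f (simplex d)) (simplex d) x (Pi.single i 1)
          (Pi.single j 1) := by
  simp only [biasDiff, pderiv_pderiv_eq hf hx]
  simp only [pderiv_eq hx]

theorem exists_abs_biasDiff_le (hf : ContDiffOn ℝ 2 f (simplex d)) :
    ∃ B, 0 ≤ B ∧ ∀ x ∈ simplexInt d, |biasDiff f x| ≤ B := by
  obtain ⟨K, hK0, hK⟩ := exists_bound_fderivWithin hf
  refine ⟨d * K + 1 / 2 * (d * (d * K)), by positivity, fun x hx => ?_⟩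
  have hx' := mem_simplex_of_mem_simplexInt hx
  rw [biasDiff_eq hf hx]
  refine (abs_add_le _ _).trans (add_le_add ?_ ?_)
  · refine (Finset.abs_sum_le_sum_abs _ _).trans ?_
    refine (Finset.sum_le_sum (g := fun _ => K) fun i _ => ?_).trans_eq (by simp)
    rw [abs_mul]
    have h1 : |1 / 2 - x i| ≤ 1 := by
      obtain ⟨h1, h2⟩ := hx'.1 i
      rw [abs_le]
      constructor <;> linarith
    have h2 : |fderivWithin ℝ f (simplex d) x (Pi.single i 1)| ≤ K :=
      (ContinuousLinearMap.le_opNorm _ _).trans ((mul_le_mul (hK x hx').2.1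
        (norm_single_one_le i) (norm_nonneg _) hK0).trans_eq (mul_one K))
    exact (mul_le_mul h1 h2 (abs_nonneg _) zero_le_one).trans_eq (one_mul K)
  · rw [abs_mul, abs_of_nonneg (by norm_num : (0 : ℝ) ≤ 1 / 2)]
    refine mul_le_mul_of_nonneg_left (abs_covariance_sum_le hx' fun i j => ?_) (by norm_num)
    exact abs_apply_single_single_le (hK x hx').2.2 i j

/-- The moments are exact. The only error comes from the factor (m - 1)/m² in the trace term, which
differs from 1/m by 1/m². -/
theorem exists_abs_multinomialMean_cellTaylor_sub_le (hf : ContDiffOn ℝ 2 f (simplex d)) :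
    ∃ C, 0 ≤ C ∧ ∀ m : ℕ, 0 < m → ∀ x ∈ simplexInt d,
      |multinomialMean (m - 1) x (cellTaylor f m x) - f x - (m : ℝ)⁻¹ * biasDiff f x|
        ≤ ((m : ℝ) ^ 2)⁻¹ * C := by
  obtain ⟨K, hK0, hK⟩ := exists_bound_fderivWithin hf
  refine ⟨1 / 2 * (d * (d * K)), by positivity, fun m hm x hx => ?_⟩
  have hx' := mem_simplex_of_mem_simplexInt hx
  have hx0 : ∀ i, 0 ≤ x i := fun i => (hx'.1 i).1
  have hm' : (0 : ℝ) < m := by positivity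
  rw [biasDiff_eq hf hx]
  set L := fderivWithin ℝ f (simplex d) x with hL
  set H := fderivWithin ℝ (fderivWithin ℝ f (simplex d)) (simplex d) x with hH
  have e : multinomialMean (m - 1) x (cellTaylor f m x)
      = f x + 1 / 2 * ((m : ℝ) ^ 2)⁻¹ * (((m - 1 : ℕ) : ℝ)
          * ∑ i, ∑ j, ((if i = j then x i else 0) - x i * x j)
            * H (Pi.single i 1) (Pi.single j 1))
        + (m : ℝ)⁻¹ * ∑ i, (1 / 2 - x i) * L (Pi.single i 1) := by
    rw [← multinomialMean_bilin H hx', ← multinomialMean_clm L hx' hm]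
    rw [← multinomialMean_const_mul, ← multinomialMean_const (r := m - 1) hx0 (f x),
      ← multinomialMean_add, ← multinomialMean_add]
    rfl
  have hsum : |∑ i, ∑ j, ((if i = j then x i else 0) - x i * x j)
      * H (Pi.single i 1) (Pi.single j 1)| ≤ d * (d * K) := by
    refine abs_covariance_sum_le hx' fun i j => ?_
    exact abs_apply_single_single_le (hK x hx').2.2 i j
  rw [e]
  set T := ∑ i, ∑ j, ((if i = j then x i else 0) - x i * x j)
      * H (Pi.single i 1) (Pi.single j 1) with hT
  have h5 : ((m - 1 : ℕ) : ℝ) = m - 1 := by rw [Nat.cast_sub hm]; simp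
  have e2 : f x + 1 / 2 * ((m : ℝ) ^ 2)⁻¹ * (((m - 1 : ℕ) : ℝ) * T)
        + (m : ℝ)⁻¹ * ∑ i, (1 / 2 - x i) * L (Pi.single i 1) - f x
        - (m : ℝ)⁻¹ * (∑ i, (1 / 2 - x i) * L (Pi.single i 1) + 1 / 2 * T)
      = -(((m : ℝ) ^ 2)⁻¹ * (1 / 2 * T)) := by
    rw [h5]
    field_simp
    ring
  rw [e2, abs_neg, abs_mul, abs_of_nonneg (by positivity), abs_mul,
    abs_of_nonneg (by norm_num : (0 : ℝ) ≤ 1 / 2)]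
  gcongr

theorem exists_multinomialMean_boundary_le {δ : ℝ} (hδ : 0 < δ) :
    ∃ ρ, 0 ≤ ρ ∧ ρ < 1 ∧ ∀ m : ℕ, 0 < m → ∀ x ∈ simplexInt d, (d = 1 ∨ l1 x ≤ 1 - δ) →
      multinomialMean (m - 1) x (fun k => if ∑ i, k i + d ≤ m then (0 : ℝ) else 1)
        ≤ 2 ^ d * ρ ^ (m - 1) := by
  -- The number (1 + ‖x‖₁)/2 is at most 1 - δ/2; the maximum keeps ρ nonnegative for large δ. If d =
  -- 1, every k ≤ m - 1 satisfies k + 1 ≤ m, so there is no boundary layer.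
  refine ⟨max 0 (1 - δ / 2), le_max_left _ _, max_lt one_pos (by linarith),
    fun m hm x hx hdx => ?_⟩
  have hx' := mem_simplex_of_mem_simplexInt hx
  rcases hdx with h1 | h1
  · have : multinomialMean (m - 1) x (fun k => if ∑ i, k i + d ≤ m then (0 : ℝ) else 1) = 0 := by
      refine Finset.sum_eq_zero fun k hk => ?_
      dsimp only
      rw [if_pos, smul_zero]
      have := mem_lattice.1 hk
      omega
    rw [this]
    have : 0 ≤ max 0 (1 - δ / 2) := le_max_left _ _
    positivity
  · have h := multinomialMean_boundary_le (r := m - 1) hx'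
    rw [Nat.sub_add_cancel hm] at h
    refine h.trans ?_
    have h2 : (1 + l1 x) / 2 ≤ max 0 (1 - δ / 2) := le_trans (by linarith) (le_max_right _ _)
    have h3 : 0 ≤ l1 x := Finset.sum_nonneg fun i _ => abs_nonneg _
    gcongr

/-- The bias of the means of the cell averages, uniformly away from the face `‖x‖₁ = 1`. -/
theorem eventually_abs_mul_multinomialMean_cellMean_sub_le (hd : 1 ≤ d)
    (hf : ContDiffOn ℝ 2 f (simplex d)) {δ ε : ℝ} (hδ : 0 < δ) (hε : 0 < ε) :
    ∀ᶠ m : ℕ in atTop, ∀ x ∈ simplexInt d, (d = 1 ∨ l1 x ≤ 1 - δ) →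
      |(m : ℝ) * (multinomialMean (m - 1) x (cellMean f m) - f x) - biasDiff f x| ≤ ε := by
  obtain ⟨K, hK0, hK⟩ := exists_bound_fderivWithin hf
  have hd0 : (0 : ℝ) < d := by positivity
  -- The second moment of the deviation is at most d m, so after multiplication by m / m² this
  -- choice contributes exactly ε/2.
  obtain ⟨C, hC0, hC⟩ := exists_abs_cellMean_sub_cellTaylor_le hf
    (show 0 < ε / (2 * d) by positivity)
  obtain ⟨C', hC'0, hC'⟩ := exists_abs_multinomialMean_cellTaylor_sub_le hf
  obtain ⟨ρ, hρ0, hρ1, hρ⟩ := exists_multinomialMean_boundary_le (d := d) hδ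
  have hlim : Tendsto (fun m : ℕ => (m : ℝ)⁻¹ * (C + 3 * d * C + C')
      + 4 * K * 2 ^ d * (((m - 1 : ℕ) : ℝ) * ρ ^ (m - 1) + ρ ^ (m - 1))) atTop (𝓝 0) := by
    have h1 := (tendsto_inv_atTop_zero.comp (tendsto_natCast_atTop_atTop (R := ℝ))).mul_const
      (C + 3 * d * C + C')
    have h2 := ((tendsto_self_mul_const_pow_of_lt_one hρ0 hρ1).add
      (tendsto_pow_atTop_nhds_zero_of_lt_one hρ0 hρ1)).comp (tendsto_sub_atTop_nat 1)
    have h3 := h1.add (h2.const_mul (4 * K * 2 ^ d))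
    simpa using h3
  filter_upwards [hlim.eventually (gt_mem_nhds (half_pos hε)), eventually_gt_atTop 0]
    with m hmε hm x hx hdx
  have hx' := mem_simplex_of_mem_simplexInt hx
  have hx0 : ∀ i, 0 ≤ x i := fun i => (hx'.1 i).1
  have hm' : (0 : ℝ) < m := by positivity
  have h5 : ((m - 1 : ℕ) : ℝ) = m - 1 := by rw [Nat.cast_sub hm]; simp
  -- On a cell leaving the simplex the two terms are bounded by K and 3K, whence 4K.
  have hpt : ∀ k ∈ lattice d (m - 1), |cellMean f m k - cellTaylor f m x k|
      ≤ (((m : ℝ) ^ 2)⁻¹ * (ε / (2 * d))) * ‖deviation m x k‖ ^ 2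
        + ((((m : ℝ) ^ 4)⁻¹ * C) * ‖deviation m x k‖ ^ 4
        + (((m : ℝ) ^ 2)⁻¹ * C + 4 * K * if ∑ i, k i + d ≤ m then (0 : ℝ) else 1)) := by
    intro k hk
    split_ifs with hkd
    · refine (hC m hm x hx' k hkd).trans_eq ?_
      ring
    · have h1 := abs_cellMean_le hm (fun y hy => (hK y hy).1) k
      have h2 := abs_cellTaylor_le hK hm hx' hk
      have h3 := abs_sub (cellMean f m k) (cellTaylor f m x k)
      have : 0 ≤ (((m : ℝ) ^ 2)⁻¹ * (ε / (2 * d))) * ‖deviation m x k‖ ^ 2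
        + ((((m : ℝ) ^ 4)⁻¹ * C) * ‖deviation m x k‖ ^ 4 + ((m : ℝ) ^ 2)⁻¹ * C) := by positivity
      linarith
  have hA : |multinomialMean (m - 1) x (cellMean f m)
      - multinomialMean (m - 1) x (cellTaylor f m x)|
      ≤ (((m : ℝ) ^ 2)⁻¹ * (ε / (2 * d))) * (d * m) + ((((m : ℝ) ^ 4)⁻¹ * C) * (d * (3 * m ^ 2))
        + (((m : ℝ) ^ 2)⁻¹ * C + 4 * K * (2 ^ d * ρ ^ (m - 1)))) := by
    rw [← multinomialMean_sub]
    refine (abs_multinomialMean_le hx' _).trans ((multinomialMean_mono hx' hpt).trans ?_)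
    simp only [multinomialMean_add, multinomialMean_const_mul, multinomialMean_const hx0]
    gcongr
    · exact multinomialMean_norm_deviation_sq_le hd hx' m
    · exact multinomialMean_norm_deviation_pow_four_le hd hx' m
    · exact hρ m hm x hx hdx
  have hB := hC' m hm x hx
  set EA := multinomialMean (m - 1) x (cellMean f m)
  set ET := multinomialMean (m - 1) x (cellTaylor f m x)
  have e : (m : ℝ) * (EA - f x) - biasDiff f x
      = m * ((EA - ET) + (ET - f x - (m : ℝ)⁻¹ * biasDiff f x)) := by
    field_simp
    ring
  rw [e, abs_mul, abs_of_pos hm']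
  refine (mul_le_mul_of_nonneg_left ((abs_add_le _ _).trans (add_le_add hA hB)) hm'.le).trans ?_
  have e2 : (m : ℝ) * ((((m : ℝ) ^ 2)⁻¹ * (ε / (2 * d))) * (d * m)
        + ((((m : ℝ) ^ 4)⁻¹ * C) * (d * (3 * m ^ 2))
        + (((m : ℝ) ^ 2)⁻¹ * C + 4 * K * (2 ^ d * ρ ^ (m - 1)))) + ((m : ℝ) ^ 2)⁻¹ * C')
      = ε / 2 + ((m : ℝ)⁻¹ * (C + 3 * d * C + C')
        + 4 * K * 2 ^ d * (((m - 1 : ℕ) : ℝ) * ρ ^ (m - 1) + ρ ^ (m - 1))) := by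
    rw [h5]
    field_simp
    ring
  rw [e2]
  linarith

end Bias

/-! ### Bias-variance decomposition -/

section Decomposition

variable {d : ℕ} {f : (Fin d → ℝ) → ℝ}

/-- The contribution of an observation at `y` to the estimator. -/
noncomputable def estimatorKernel (N : Normalization) (m : ℕ) (x y : Fin d → ℝ) : ℝ :=
  ∑ k ∈ lattice d (m - 1),
    N.factor d m * multinomialProb k (m - 1) x * (cell m k).indicator (fun _ => (1 : ℝ)) y

theorem densityEstimator_eq {Ω : Type*} (N : Normalization) (X : ℕ → Ω → Fin d → ℝ) (n m : ℕ)
    (x : Fin d → ℝ) (ω : Ω) :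
    densityEstimator N X n m x ω
      = (n : ℝ)⁻¹ * ∑ i ∈ Finset.range n, estimatorKernel N m x (X i ω) := by
  simp only [densityEstimator, estimatorKernel]
  rw [Finset.sum_comm, Finset.mul_sum]
  refine Finset.sum_congr rfl fun k _ => ?_
  rw [← Finset.mul_sum]
  ring

theorem measurable_estimatorKernel (N : Normalization) (m : ℕ) (x : Fin d → ℝ) :
    Measurable (estimatorKernel N m x) :=
  Finset.measurable_sum _ fun k _ =>
    (measurable_const.indicator (measurableSet_cell m k)).const_mul _

theorem eq_of_mem_cell {m : ℕ} (hm : 0 < m) {k l : Fin d → ℕ} {y : Fin d → ℝ}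
    (hk : y ∈ cell m k) (hl : y ∈ cell m l) : k = l := by
  have hm' : (0 : ℝ) < m := by positivity
  ext i
  have h1 := (div_lt_iff₀ hm').1 (hk i trivial).1
  have h2 := (le_div_iff₀ hm').1 (hk i trivial).2
  have h3 := (div_lt_iff₀ hm').1 (hl i trivial).1
  have h4 := (le_div_iff₀ hm').1 (hl i trivial).2
  have h5 : (k i : ℝ) < l i + 1 := by linarith
  have h6 : (l i : ℝ) < k i + 1 := by linarith
  norm_cast at h5 h6
  omega

/-- The cells are disjoint, so all cross terms vanish. -/
theorem estimatorKernel_sq (N : Normalization) {m : ℕ} (hm : 0 < m) (x y : Fin d → ℝ) :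
    estimatorKernel N m x y ^ 2
      = ∑ k ∈ lattice d (m - 1), (N.factor d m * multinomialProb k (m - 1) x) ^ 2
          * (cell m k).indicator (fun _ => (1 : ℝ)) y := by
  rw [estimatorKernel, sq, Finset.sum_mul]
  refine Finset.sum_congr rfl fun k hk => ?_
  by_cases hy : y ∈ cell m k
  · rw [Finset.sum_eq_single k]
    · simp [hy, sq]
    · intro l _ hl
      have : y ∉ cell m l := fun h => hl (eq_of_mem_cell hm h hy)
      simp [this]
    · exact fun h => absurd hk h
  · simp [hy]

theorem measureReal_cell (hf : ContDiffOn ℝ 2 f (simplex d)) (hf_nonneg : ∀ y ∈ simplex d, 0 ≤ f y)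
    {m : ℕ} (hm : 0 < m) (k : Fin d → ℕ) :
    ((volume.restrict (simplex d)).withDensity fun y => ENNReal.ofReal (f y)).real (cell m k)
      = ((m : ℝ) ^ d)⁻¹ * cellMean f m k := by
  have hm' : (0 : ℝ) < m := by positivity
  have hS : MeasurableSet (simplex d) := (isCompact_simplex d).isClosed.measurableSet
  have hint : Integrable f (volume.restrict (cell m k ∩ simplex d)) :=
    (integrableOn_simplex hf).mono_set Set.inter_subset_right
  have hnn : 0 ≤ᵐ[volume.restrict (cell m k ∩ simplex d)] f := by
    filter_upwards [ae_restrict_mem ((measurableSet_cell m k).inter hS)] with y hy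
      using hf_nonneg y hy.2
  rw [measureReal_def, withDensity_apply _ (measurableSet_cell m k),
    Measure.restrict_restrict (measurableSet_cell m k),
    ← ofReal_integral_eq_lintegral_ofReal hint hnn,
    ENNReal.toReal_ofReal (integral_nonneg_of_ae hnn), cellMean]
  field_simp

theorem integral_sum_indicator_cell (μ : Measure (Fin d → ℝ)) [IsFiniteMeasure μ] (m : ℕ)
    (s : Finset (Fin d → ℕ)) (a : (Fin d → ℕ) → ℝ) :
    ∫ y, ∑ k ∈ s, a k * (cell m k).indicator (fun _ => (1 : ℝ)) y ∂μ
      = ∑ k ∈ s, a k * μ.real (cell m k) := by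
  rw [integral_finsetSum _ fun k _ =>
    ((integrable_const (1 : ℝ)).indicator (measurableSet_cell m k)).const_mul _]
  refine Finset.sum_congr rfl fun k _ => ?_
  rw [integral_const_mul, integral_indicator_const _ (measurableSet_cell m k)]
  simp

theorem abs_estimatorKernel_le (N : Normalization) (m : ℕ) (x y : Fin d → ℝ) :
    |estimatorKernel N m x y|
      ≤ ∑ k ∈ lattice d (m - 1), |N.factor d m * multinomialProb k (m - 1) x| := by
  refine (Finset.abs_sum_le_sum_abs _ _).trans (Finset.sum_le_sum fun k _ => ?_)
  rw [abs_mul]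
  refine mul_le_of_le_one_right (abs_nonneg _) ?_
  by_cases hy : y ∈ cell m k <;> simp [hy]

/-- The mean of the estimator. -/
noncomputable def estimatorMean (N : Normalization) (f : (Fin d → ℝ) → ℝ) (m : ℕ)
    (x : Fin d → ℝ) : ℝ :=
  N.factor d m / (m : ℝ) ^ d * multinomialMean (m - 1) x (cellMean f m)

/-- The second moment of the contribution of a single observation. -/
noncomputable def estimatorSecondMoment (N : Normalization) (f : (Fin d → ℝ) → ℝ) (m : ℕ)
    (x : Fin d → ℝ) : ℝ :=
  (N.factor d m / (m : ℝ) ^ d) ^ 2 * ((m : ℝ) ^ d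
    * ∑ k ∈ lattice d (m - 1), multinomialProb k (m - 1) x ^ 2 * cellMean f m k)

theorem integral_sq_average_sub {Ω : Type*} [MeasurableSpace Ω] (P : Measure Ω)
    [IsProbabilityMeasure P] {Y : ℕ → Ω → ℝ} (hY : ∀ i, MemLp (Y i) 2 P)
    (hind : Pairwise fun i j => IndepFun (Y i) (Y j) P) {M S : ℝ} (hM : ∀ i, P[Y i] = M)
    (hS : ∀ i, P[fun ω => Y i ω ^ 2] = S) {n : ℕ} (hn : 0 < n) (c : ℝ) :
    ∫ ω, ((n : ℝ)⁻¹ * ∑ i ∈ Finset.range n, Y i ω - c) ^ 2 ∂P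
      = (n : ℝ)⁻¹ * (S - M ^ 2) + (M - c) ^ 2 := by
  have hn' : (n : ℝ) ≠ 0 := by positivity
  have hvar : ∀ i, Var[Y i; P] = S - M ^ 2 := fun i => by
    rw [variance_eq_sub (hY i), hM, ← hS i]
    rfl
  have hsum : MemLp (∑ i ∈ Finset.range n, Y i) 2 P := memLp_finsetSum' _ fun i _ => hY i
  have hZ : MemLp (fun ω => (n : ℝ)⁻¹ * (∑ i ∈ Finset.range n, Y i) ω) 2 P := hsum.const_mul _
  have hW : MemLp (fun ω => (n : ℝ)⁻¹ * (∑ i ∈ Finset.range n, Y i) ω - c) 2 P :=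
    hZ.sub (memLp_const c)
  have hv : Var[fun ω => (n : ℝ)⁻¹ * (∑ i ∈ Finset.range n, Y i) ω - c; P]
      = (n : ℝ)⁻¹ * (S - M ^ 2) := by
    rw [variance_sub_const hZ.aestronglyMeasurable, variance_const_mul,
      IndepFun.variance_sum (fun i _ => hY i) (fun i _ j _ hij => hind hij)]
    simp only [hvar, Finset.sum_const, Finset.card_range, nsmul_eq_mul]
    field_simp
  have hmean : P[fun ω => (n : ℝ)⁻¹ * (∑ i ∈ Finset.range n, Y i) ω - c] = M - c := by
    rw [integral_sub (hZ.integrable one_le_two) (integrable_const c), integral_const_mul]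
    simp only [Finset.sum_apply]
    rw [integral_finsetSum _ fun i _ => (hY i).integrable one_le_two]
    simp only [hM]
    simp
    field_simp
  have h := variance_eq_sub hW
  rw [hv, hmean] at h
  have e : ∫ ω, ((n : ℝ)⁻¹ * ∑ i ∈ Finset.range n, Y i ω - c) ^ 2 ∂P
      = P[(fun ω => (n : ℝ)⁻¹ * (∑ i ∈ Finset.range n, Y i) ω - c) ^ 2] := by
    refine integral_congr_ae (Eventually.of_forall fun ω => ?_)
    simp
  rw [e, h]
  ring

/-- An exact identity. The kernel is bounded, hence square integrable, and the law of the
observations enters only through the masses of the cells. -/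
theorem mse_eq {Ω : Type*} [MeasurableSpace Ω] (P : Measure Ω) [IsProbabilityMeasure P]
    (hf : ContDiffOn ℝ 2 f (simplex d)) (hf_nonneg : ∀ y ∈ simplex d, 0 ≤ f y)
    (X : ℕ → Ω → Fin d → ℝ) (hX_meas : ∀ i, Measurable (X i)) (hX_indep : iIndepFun X P)
    (hX_law : ∀ i, P.map (X i) =
      (volume.restrict (simplex d)).withDensity fun y => ENNReal.ofReal (f y))
    (N : Normalization) {n m : ℕ} (hn : 0 < n) (hm : 0 < m) (x : Fin d → ℝ) :
    mse P N X f n m x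
      = (n : ℝ)⁻¹ * (estimatorSecondMoment N f m x - estimatorMean N f m x ^ 2)
        + (estimatorMean N f m x - f x) ^ 2 := by
  have hm' : (0 : ℝ) < m := by positivity
  have hh := measurable_estimatorKernel N m x
  have hY : ∀ i, MemLp (fun ω => estimatorKernel N m x (X i ω)) 2 P := fun i =>
    MemLp.of_bound (hh.comp (hX_meas i)).aestronglyMeasurable _
      (Eventually.of_forall fun ω => abs_estimatorKernel_le N m x (X i ω))
  have hind : Pairwise fun i j => IndepFun (fun ω => estimatorKernel N m x (X i ω))
      (fun ω => estimatorKernel N m x (X j ω)) P := fun i j hij =>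
    (hX_indep.indepFun hij).comp hh hh
  have hprob : ∀ i, IsProbabilityMeasure (P.map (X i)) := fun i =>
    Measure.isProbabilityMeasure_map (hX_meas i).aemeasurable
  have hreal : ∀ i k, (P.map (X i)).real (cell m k) = ((m : ℝ) ^ d)⁻¹ * cellMean f m k :=
    fun i k => by rw [hX_law i, measureReal_cell hf hf_nonneg hm]
  have hM : ∀ i, P[fun ω => estimatorKernel N m x (X i ω)] = estimatorMean N f m x := by
    intro i
    have := integral_map (μ := P) (hX_meas i).aemeasurable (f := estimatorKernel N m x)
      hh.aestronglyMeasurable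
    rw [← this]
    simp only [estimatorKernel]
    rw [integral_sum_indicator_cell, estimatorMean, multinomialMean, Finset.mul_sum]
    refine Finset.sum_congr rfl fun k _ => ?_
    rw [hreal, smul_eq_mul]
    field_simp
  have hS : ∀ i, P[fun ω => estimatorKernel N m x (X i ω) ^ 2]
      = estimatorSecondMoment N f m x := by
    intro i
    have := integral_map (μ := P) (hX_meas i).aemeasurable (f := fun y => estimatorKernel N m x y ^ 2)
      (hh.pow_const 2).aestronglyMeasurable
    rw [← this]
    simp only [estimatorKernel_sq N hm]
    rw [integral_sum_indicator_cell, estimatorSecondMoment, Finset.mul_sum, Finset.mul_sum]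
    refine Finset.sum_congr rfl fun k _ => ?_
    rw [hreal]
    field_simp
  rw [← integral_sq_average_sub P hY hind hM hS hn (f x), mse]
  refine integral_congr_ae (Eventually.of_forall fun ω => ?_)
  simp only [densityEstimator_eq, sq_abs]

/-! ### The normalizing factor -/

/-- For the Dirichlet factor, passing from d to d + 1 multiplies the ratio to m^d by 1 + d/m, so κ
grows by d; summing gives d(d - 1)/2. -/
theorem tendsto_mul_factor_sub_one (N : Normalization) (d : ℕ) :
    ∃ κ : ℝ, Tendsto (fun m : ℕ => (m : ℝ) * (N.factor d m / (m : ℝ) ^ d - 1)) atTop (𝓝 κ) ∧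
      ∀ (f : (Fin d → ℝ) → ℝ) (x : Fin d → ℝ), N.bias f x = κ * f x + biasDiff f x := by
  cases N with
  | volume =>
    refine ⟨0, ?_, fun f x => by simp [Normalization.bias]⟩
    refine tendsto_const_nhds.congr' ?_
    filter_upwards [eventually_gt_atTop 0] with m hm
    have hm' : (m : ℝ) ≠ 0 := by positivity
    simp [Normalization.factor, div_self (pow_ne_zero d hm')]
  | dirichlet =>
    refine ⟨(d : ℝ) * ((d : ℝ) - 1) / 2, ?_, fun f x => rfl⟩
    induction d with
    | zero =>
      refine tendsto_const_nhds.congr' (Eventually.of_forall fun m => ?_)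
      have : ((m - 1).factorial : ℝ) ≠ 0 := by positivity
      simp [Normalization.factor, div_self this]
    | succ d ih =>
      have hinv := tendsto_inv_atTop_zero.comp (tendsto_natCast_atTop_atTop (R := ℝ))
      have h := (ih.mul ((hinv.const_mul (d : ℝ)).const_add 1)).add_const (d : ℝ)
      have e : (d : ℝ) * ((d : ℝ) - 1) / 2 * (1 + d * 0) + d
          = ((d + 1 : ℕ) : ℝ) * (((d + 1 : ℕ) : ℝ) - 1) / 2 := by push_cast; ring
      rw [e] at h
      refine h.congr' ?_
      filter_upwards [eventually_gt_atTop 0] with m hm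
      have hm' : (m : ℝ) ≠ 0 := by positivity
      have hfac : ((m - 1).factorial : ℝ) ≠ 0 := by positivity
      have e1 : m - 1 + (d + 1) = (m - 1 + d) + 1 := rfl
      have e2 : ((m - 1 + d + 1 : ℕ) : ℝ) = m + d := by
        exact_mod_cast (by omega : m - 1 + d + 1 = m + d)
      simp only [Normalization.factor, Function.comp_apply]
      rw [e1, Nat.factorial_succ, Nat.cast_mul, e2, pow_succ]
      field_simp
      ring

theorem tendsto_factor_div_pow (N : Normalization) (d : ℕ) :
    Tendsto (fun m : ℕ => N.factor d m / (m : ℝ) ^ d) atTop (𝓝 1) := by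
  obtain ⟨κ, hκ, -⟩ := tendsto_mul_factor_sub_one N d
  have hinv := tendsto_inv_atTop_zero.comp (tendsto_natCast_atTop_atTop (R := ℝ))
  have h := (hinv.mul hκ).add_const 1
  rw [zero_mul, zero_add] at h
  refine h.congr' ?_
  filter_upwards [eventually_gt_atTop 0] with m hm
  have hm' : (m : ℝ) ≠ 0 := by positivity
  simp only [Function.comp_apply]
  field_simp
  ring

end Decomposition

/-! ### Asymptotics of the mean and of the variance -/

section Asymptotics

variable {d : ℕ} {f : (Fin d → ℝ) → ℝ}

theorem tendsto_inv_natCast : Tendsto (fun m : ℕ => (m : ℝ)⁻¹) atTop (𝓝 0) :=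
  tendsto_inv_atTop_zero.comp tendsto_natCast_atTop_atTop

theorem tendsto_inv_sqrt_natCast : Tendsto (fun m : ℕ => (√(m : ℝ))⁻¹) atTop (𝓝 0) :=
  tendsto_inv_atTop_zero.comp (Real.tendsto_sqrt_atTop.comp tendsto_natCast_atTop_atTop)

/-- `f` is Lipschitz on the simplex and ‖K/m - x‖ is of order m^{-1/2} on average; the boundary
layer has negligible mass at a fixed interior point. -/
theorem tendsto_multinomialMean_abs_cellMean_sub (hd : 1 ≤ d) (hf : ContDiffOn ℝ 2 f (simplex d))
    {x : Fin d → ℝ} (hx : x ∈ simplexInt d) :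
    Tendsto (fun m : ℕ => multinomialMean (m - 1) x (fun k => |cellMean f m k - f x|)) atTop
      (𝓝 0) := by
  obtain ⟨K, hK0, hK⟩ := exists_bound_fderivWithin hf
  obtain ⟨ρ, hρ0, hρ1, hρ⟩ := exists_multinomialMean_boundary_le (d := d) (sub_pos.2 hx.2)
  have hx' := mem_simplex_of_mem_simplexInt hx
  have hx0 : ∀ i, 0 ≤ x i := fun i => (hx'.1 i).1
  have hlim : Tendsto (fun m : ℕ => K * (((d : ℝ) + 1) * (√(m : ℝ))⁻¹ + (m : ℝ)⁻¹)
      + 2 * K * (2 ^ d * ρ ^ (m - 1))) atTop (𝓝 0) := by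
    have h2 := (tendsto_pow_atTop_nhds_zero_of_lt_one hρ0 hρ1).comp (tendsto_sub_atTop_nat 1)
    have h3 := (((tendsto_inv_sqrt_natCast.const_mul ((d : ℝ) + 1)).add
      tendsto_inv_natCast).const_mul K).add ((h2.const_mul (2 ^ d)).const_mul (2 * K))
    simpa using h3
  refine squeeze_zero' (Eventually.of_forall fun m => ?_) ?_ hlim
  · exact (abs_nonneg _).trans (abs_multinomialMean_le hx' (fun k => cellMean f m k - f x))
  filter_upwards [eventually_gt_atTop 0] with m hm
  have hm' : (0 : ℝ) < m := by positivity
  have hs : 0 < √(m : ℝ) := Real.sqrt_pos.2 hm'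
  have hss : √(m : ℝ) * √(m : ℝ) = m := Real.mul_self_sqrt hm'.le
  have hpt : ∀ k ∈ lattice d (m - 1), |cellMean f m k - f x|
      ≤ (K * (m : ℝ)⁻¹ * (√(m : ℝ))⁻¹) * ‖deviation m x k‖ ^ 2
        + (K * (m : ℝ)⁻¹ * (√(m : ℝ) + 1)
          + 2 * K * if ∑ i, k i + d ≤ m then (0 : ℝ) else 1) := by
    intro k hk
    split_ifs with hkd
    · have h := abs_cellMean_sub_le hf hm hkd x (f x)
        (K * ((m : ℝ)⁻¹ * (‖deviation m x k‖ + 1))) 0 (fun y hy => by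
          rw [_root_.zero_apply, sub_zero]
          refine (abs_sub_le_of_simplex hf (fun z hz => (hK z hz).2.1) hx'
            (cell_subset_simplex hm hkd hy)).trans ?_
          refine mul_le_mul_of_nonneg_left ?_ hK0
          have h1 := norm_smul_sub_deviation_le hm hx' hy
          have h2 : ‖(m : ℝ) • (y - x)‖ ≤ ‖deviation m x k‖ + 1 := by
            have := norm_le_norm_add_norm_sub' ((m : ℝ) • (y - x)) (deviation m x k)
            linarith
          rw [norm_smul, Real.norm_of_nonneg hm'.le] at h2
          rwa [← div_eq_inv_mul, le_div_iff₀ hm', mul_comm])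
      rw [_root_.zero_apply, add_zero] at h
      refine h.trans ?_
      -- Arithmetic-geometric mean inequality, so that the second moment suffices to bound the
      -- first.
      have h3 : ‖deviation m x k‖ ≤ (√(m : ℝ))⁻¹ * ‖deviation m x k‖ ^ 2 + √(m : ℝ) := by
        rw [← sub_nonneg]
        have e : (√(m : ℝ))⁻¹ * ‖deviation m x k‖ ^ 2 + √(m : ℝ) - ‖deviation m x k‖
            = (√(m : ℝ))⁻¹ * ((‖deviation m x k‖ - √(m : ℝ) / 2) ^ 2
              + 3 / 4 * (√(m : ℝ)) ^ 2) := by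
          field_simp
          ring
        rw [e]
        positivity
      have h4 := mul_le_mul_of_nonneg_left h3 (by positivity : 0 ≤ K * (m : ℝ)⁻¹)
      linarith
    · have h1 := abs_cellMean_le hm (fun y hy => (hK y hy).1) k
      have h2 := (hK x hx').1
      have h3 := abs_sub (cellMean f m k) (f x)
      have : 0 ≤ (K * (m : ℝ)⁻¹ * (√(m : ℝ))⁻¹) * ‖deviation m x k‖ ^ 2
        + K * (m : ℝ)⁻¹ * (√(m : ℝ) + 1) := by positivity
      linarith
  refine (multinomialMean_mono hx' hpt).trans ?_
  simp only [multinomialMean_add, multinomialMean_const_mul, multinomialMean_const hx0]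
  have hb := hρ m hm x hx (Or.inr (by linarith))
  have hsq := multinomialMean_norm_deviation_sq_le hd hx' m
  calc _ ≤ (K * (m : ℝ)⁻¹ * (√(m : ℝ))⁻¹) * (d * m)
        + (K * (m : ℝ)⁻¹ * (√(m : ℝ) + 1) + 2 * K * (2 ^ d * ρ ^ (m - 1))) := by gcongr
    _ = _ := by
      have e1 : (m : ℝ)⁻¹ * √(m : ℝ) = (√(m : ℝ))⁻¹ := by
        rw [← div_eq_inv_mul, Real.sqrt_div_self', one_div]
      have e2 : (m : ℝ)⁻¹ * m = 1 := inv_mul_cancel₀ hm'.ne'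
      linear_combination (K * (√(m : ℝ))⁻¹ * d) * e2 + K * e1

theorem tendsto_sqrt_div_sqrt_pred (d : ℕ) :
    Tendsto (fun m : ℕ => (√(m : ℝ) / √((m - 1 : ℕ) : ℝ)) ^ d) atTop (𝓝 1) := by
  have h1 : Tendsto (fun r : ℕ => ((r + 1 : ℕ) : ℝ) / r) atTop (𝓝 1) := by
    have := tendsto_inv_natCast.const_add 1
    rw [add_zero] at this
    refine this.congr' ?_
    filter_upwards [eventually_gt_atTop 0] with r hr
    have : (r : ℝ) ≠ 0 := by positivity
    push_cast
    field_simp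
  have h2 := ((Real.continuous_sqrt.tendsto 1).comp h1).pow d
  rw [Real.sqrt_one, one_pow] at h2
  refine (h2.comp (tendsto_sub_atTop_nat 1)).congr' ?_
  filter_upwards [eventually_gt_atTop 0] with m hm
  simp only [Function.comp_apply]
  rw [Nat.sub_add_cancel hm, Real.sqrt_div (Nat.cast_nonneg m)]

/-- To replace the cell average by f(x), bound one factor of p_k² by C r^{-d/2} and use the other as
a probability weight. -/
theorem tendsto_sqrt_pow_mul_sum (hd : 1 ≤ d) (hf : ContDiffOn ℝ 2 f (simplex d))
    {x : Fin d → ℝ} (hx : x ∈ simplexInt d) :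
    Tendsto (fun m : ℕ => √(m : ℝ) ^ d
      * ∑ k ∈ lattice d (m - 1), multinomialProb k (m - 1) x ^ 2 * cellMean f m k) atTop
      (𝓝 (psi x * f x)) := by
  have hx' := mem_simplex_of_mem_simplexInt hx
  obtain ⟨C, hC0, hC⟩ := exists_sqrt_pow_mul_multinomialProb_le hx
  have h1 := ((tendsto_sum_multinomialProb_sq hd hx).comp (tendsto_sub_atTop_nat 1)).mul_const (f x)
  have h2 : Tendsto (fun m : ℕ => √((m - 1 : ℕ) : ℝ) ^ d * ∑ k ∈ lattice d (m - 1),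
      multinomialProb k (m - 1) x ^ 2 * (cellMean f m k - f x)) atTop (𝓝 0) := by
    have h := (tendsto_multinomialMean_abs_cellMean_sub hd hf hx).const_mul C
    rw [mul_zero] at h
    refine squeeze_zero_norm (fun m => ?_) h
    rw [Finset.mul_sum, multinomialMean, Finset.mul_sum]
    refine (norm_sum_le _ _).trans (Finset.sum_le_sum fun k hk => ?_)
    have hp := multinomialProb_nonneg (r := m - 1) hx' k
    rw [norm_mul, norm_mul, norm_pow, norm_pow, Real.norm_of_nonneg (Real.sqrt_nonneg _),
      Real.norm_of_nonneg hp, Real.norm_eq_abs, smul_eq_mul]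
    have := mul_le_mul_of_nonneg_right (hC (m - 1) k hk)
      (mul_nonneg hp (abs_nonneg (cellMean f m k - f x)))
    linarith
  have h3 := (tendsto_sqrt_div_sqrt_pred d).mul (h1.add h2)
  rw [add_zero, one_mul] at h3
  refine h3.congr' ?_
  filter_upwards [eventually_gt_atTop 1] with m hm
  have hs : √((m - 1 : ℕ) : ℝ) ≠ 0 := by
    have : 0 < m - 1 := by omega
    positivity
  simp only [Function.comp_apply, mul_sub, Finset.sum_sub_distrib, ← Finset.sum_mul]
  rw [div_pow]
  field_simp
  ring

theorem tendsto_estimatorSecondMoment (hd : 1 ≤ d) (hf : ContDiffOn ℝ 2 f (simplex d))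
    (N : Normalization) {x : Fin d → ℝ} (hx : x ∈ simplexInt d) :
    Tendsto (fun m : ℕ => (√(m : ℝ) ^ d)⁻¹ * estimatorSecondMoment N f m x) atTop
      (𝓝 (psi x * f x)) := by
  have h := ((tendsto_factor_div_pow N d).pow 2).mul (tendsto_sqrt_pow_mul_sum hd hf hx)
  rw [one_pow, one_mul] at h
  refine h.congr' ?_
  filter_upwards [eventually_gt_atTop 0] with m hm
  have hs : √(m : ℝ) ≠ 0 := by positivity
  have hss : (m : ℝ) ^ d = √(m : ℝ) ^ d * √(m : ℝ) ^ d := by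
    rw [← mul_pow, Real.mul_self_sqrt (Nat.cast_nonneg m)]
  rw [estimatorSecondMoment]
  generalize N.factor d m / (m : ℝ) ^ d = c
  rw [hss]
  field_simp

/-- The bias of the estimator, uniformly away from the face `‖x‖₁ = 1`. -/
theorem eventually_abs_mul_estimatorMean_sub_le (hd : 1 ≤ d) (hf : ContDiffOn ℝ 2 f (simplex d))
    (N : Normalization) {δ ε : ℝ} (hδ : 0 < δ) (hε : 0 < ε) :
    ∀ᶠ m : ℕ in atTop, ∀ x ∈ simplexInt d, (d = 1 ∨ l1 x ≤ 1 - δ) →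
      |(m : ℝ) * (estimatorMean N f m x - f x) - N.bias f x| ≤ ε := by
  obtain ⟨K, hK0, hK⟩ := exists_bound_fderivWithin hf
  obtain ⟨B, hB0, hB⟩ := exists_abs_biasDiff_le hf
  obtain ⟨κ, hκ, hbias⟩ := tendsto_mul_factor_sub_one N d
  set ρ : ℕ → ℝ := fun m => N.factor d m / (m : ℝ) ^ d with hρ
  have h1 := tendsto_factor_div_pow N d
  have hlim : Tendsto (fun m => |ρ m - 1| * B + |(m : ℝ) * (ρ m - 1) - κ| * K) atTop (𝓝 0) := by
    have h2 := ((h1.sub_const 1).abs.mul_const B).add ((hκ.sub_const κ).abs.mul_const K)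
    simpa using h2
  filter_upwards [hlim.eventually (gt_mem_nhds (half_pos hε)),
    h1.abs.eventually (gt_mem_nhds (by norm_num : |(1 : ℝ)| < 2)),
    eventually_abs_mul_multinomialMean_cellMean_sub_le hd hf hδ
      (show 0 < ε / 4 by positivity)] with m hm1 hm2 hm3 x hx hdx
  have hx' := mem_simplex_of_mem_simplexInt hx
  have h3 := hm3 x hx hdx
  have e : (m : ℝ) * (estimatorMean N f m x - f x) - N.bias f x
      = ρ m * ((m : ℝ) * (multinomialMean (m - 1) x (cellMean f m) - f x) - biasDiff f x)
        + ((ρ m - 1) * biasDiff f x + ((m : ℝ) * (ρ m - 1) - κ) * f x) := by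
    rw [hbias, estimatorMean]
    ring
  rw [e]
  have t1 : |ρ m * ((m : ℝ) * (multinomialMean (m - 1) x (cellMean f m) - f x) - biasDiff f x)|
      ≤ 2 * (ε / 4) := by
    rw [abs_mul]
    exact mul_le_mul hm2.le h3 (abs_nonneg _) zero_le_two
  have t2 : |(ρ m - 1) * biasDiff f x| ≤ |ρ m - 1| * B := by
    rw [abs_mul]
    exact mul_le_mul_of_nonneg_left (hB x hx) (abs_nonneg _)
  have t3 : |((m : ℝ) * (ρ m - 1) - κ) * f x| ≤ |(m : ℝ) * (ρ m - 1) - κ| * K := by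
    rw [abs_mul]
    exact mul_le_mul_of_nonneg_left (hK x hx').1 (abs_nonneg _)
  have t4 := abs_add_le
    (ρ m * ((m : ℝ) * (multinomialMean (m - 1) x (cellMean f m) - f x) - biasDiff f x))
    ((ρ m - 1) * biasDiff f x + ((m : ℝ) * (ρ m - 1) - κ) * f x)
  have t5 := abs_add_le ((ρ m - 1) * biasDiff f x) (((m : ℝ) * (ρ m - 1) - κ) * f x)
  linarith

theorem exists_abs_bias_le (hf : ContDiffOn ℝ 2 f (simplex d)) (N : Normalization) :
    ∃ B, 0 ≤ B ∧ ∀ x ∈ simplexInt d, |N.bias f x| ≤ B := by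
  obtain ⟨K, hK0, hK⟩ := exists_bound_fderivWithin hf
  obtain ⟨B, hB0, hB⟩ := exists_abs_biasDiff_le hf
  obtain ⟨κ, hκ, hbias⟩ := tendsto_mul_factor_sub_one N d
  refine ⟨|κ| * K + B, by positivity, fun x hx => ?_⟩
  rw [hbias]
  refine (abs_add_le _ _).trans (add_le_add ?_ (hB x hx))
  rw [abs_mul]
  exact mul_le_mul_of_nonneg_left (hK x (mem_simplex_of_mem_simplexInt hx)).1 (abs_nonneg _)

theorem tendsto_mul_estimatorMean_sub (hd : 1 ≤ d) (hf : ContDiffOn ℝ 2 f (simplex d))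
    (N : Normalization) {x : Fin d → ℝ} (hx : x ∈ simplexInt d) :
    Tendsto (fun m : ℕ => (m : ℝ) * (estimatorMean N f m x - f x)) atTop (𝓝 (N.bias f x)) := by
  rw [Metric.tendsto_nhds]
  intro ε hε
  filter_upwards [eventually_abs_mul_estimatorMean_sub_le hd hf N (sub_pos.2 hx.2) (half_pos hε)]
    with m hm
  rw [Real.dist_eq]
  exact (hm x hx (Or.inr (by linarith))).trans_lt (half_lt_self hε)

theorem tendsto_estimatorMean (hd : 1 ≤ d) (hf : ContDiffOn ℝ 2 f (simplex d))
    (N : Normalization) {x : Fin d → ℝ} (hx : x ∈ simplexInt d) :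
    Tendsto (fun m : ℕ => estimatorMean N f m x) atTop (𝓝 (f x)) := by
  have h := (tendsto_inv_natCast.mul (tendsto_mul_estimatorMean_sub hd hf N hx)).add_const (f x)
  rw [zero_mul, zero_add] at h
  refine h.congr' ?_
  filter_upwards [eventually_gt_atTop 0] with m hm
  have hm' : (m : ℝ) ≠ 0 := by positivity
  field_simp
  ring

/-- The squared mean stays bounded, so it disappears after division by m^{d/2}, as d ≥ 1. -/
theorem tendsto_estimatorVariance (hd : 1 ≤ d) (hf : ContDiffOn ℝ 2 f (simplex d))
    (N : Normalization) {x : Fin d → ℝ} (hx : x ∈ simplexInt d) :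
    Tendsto (fun m : ℕ => (√(m : ℝ) ^ d)⁻¹
      * (estimatorSecondMoment N f m x - estimatorMean N f m x ^ 2)) atTop
      (𝓝 (psi x * f x)) := by
  have h1 : Tendsto (fun m : ℕ => (√(m : ℝ) ^ d)⁻¹) atTop (𝓝 0) := by
    have := tendsto_inv_sqrt_natCast.pow d
    rw [zero_pow (by omega)] at this
    simpa using this
  have h := (tendsto_estimatorSecondMoment hd hf N hx).sub
    (h1.mul ((tendsto_estimatorMean hd hf N hx).pow 2))
  rw [zero_mul, sub_zero] at h
  refine h.congr fun m => by ring

theorem natCast_rpow_half (m d : ℕ) : (m : ℝ) ^ ((d : ℝ) / 2) = √(m : ℝ) ^ d := by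
  rw [Real.sqrt_eq_rpow, ← Real.rpow_natCast, ← Real.rpow_mul (Nat.cast_nonneg m)]
  ring_nf

theorem mse_expansion (hd : 1 ≤ d) {Ω : Type*} [MeasurableSpace Ω] (P : Measure Ω)
    [IsProbabilityMeasure P]
    (hf : ContDiffOn ℝ 2 f (simplex d)) (hf_nonneg : ∀ y ∈ simplex d, 0 ≤ f y)
    (X : ℕ → Ω → Fin d → ℝ) (hX_meas : ∀ i, Measurable (X i)) (hX_indep : iIndepFun X P)
    (hX_law : ∀ i, P.map (X i) =
      (volume.restrict (simplex d)).withDensity fun y => ENNReal.ofReal (f y))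
    (N : Normalization) {m : ℕ → ℕ} (hm : Tendsto m atTop atTop) :
    ∃ r₁ r₂ : ℕ → (Fin d → ℝ) → ℝ,
      (∀ n : ℕ, ∀ x ∈ simplexInt d,
        mse P N X f n (m n) x =
          (n : ℝ)⁻¹ * (m n : ℝ) ^ ((d : ℝ) / 2) * (psi x * f x)
            + ((m n : ℝ) ^ 2)⁻¹ * N.bias f x ^ 2 + r₁ n x + r₂ n x) ∧
      (∀ x ∈ simplexInt d,
        (fun n => r₁ n x) =o[atTop] fun n => (n : ℝ)⁻¹ * (m n : ℝ) ^ ((d : ℝ) / 2)) ∧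
      (∀ δ : ℝ, 0 < δ →
        TendstoUniformlyOn (fun n x => r₂ n x * (m n : ℝ) ^ 2) (fun _ => 0) atTop
          {x | x ∈ simplexInt d ∧ (d = 1 ∨ l1 x ≤ 1 - δ)}) := by
  -- The remainder r₂ is the error of the squared bias alone and depends on `n` only through `m n`;
  -- r₁ takes all the rest, so the expansion is an identity even for n = 0 or m(n) = 0.
  refine ⟨fun n x => mse P N X f n (m n) x
      - (n : ℝ)⁻¹ * (m n : ℝ) ^ ((d : ℝ) / 2) * (psi x * f x)
      - (estimatorMean N f (m n) x - f x) ^ 2,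
    fun n x => (estimatorMean N f (m n) x - f x) ^ 2 - ((m n : ℝ) ^ 2)⁻¹ * N.bias f x ^ 2,
    fun n x _ => by ring, fun x hx => ?_, fun δ hδ => ?_⟩
  · have hlim := ((tendsto_estimatorVariance hd hf N hx).comp hm).sub_const (psi x * f x)
    rw [sub_self] at hlim
    have ho : (fun n : ℕ => (n : ℝ)⁻¹ * (m n : ℝ) ^ ((d : ℝ) / 2)
        * ((√(m n : ℝ) ^ d)⁻¹ * (estimatorSecondMoment N f (m n) x
          - estimatorMean N f (m n) x ^ 2) - psi x * f x))
        =o[atTop] fun n : ℕ => (n : ℝ)⁻¹ * (m n : ℝ) ^ ((d : ℝ) / 2) * 1 :=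
      (isBigO_refl _ _).mul_isLittleO ((isLittleO_one_iff ℝ).2 hlim)
    simp only [mul_one] at ho
    refine ho.congr' ?_ EventuallyEq.rfl
    filter_upwards [eventually_gt_atTop 0, hm.eventually_gt_atTop 0] with n hn hmn
    rw [mse_eq P hf hf_nonneg X hX_meas hX_indep hX_law N hn hmn, natCast_rpow_half]
    have : √(m n : ℝ) ≠ 0 := by positivity
    field_simp
    ring
  · obtain ⟨B, hB0, hB⟩ := exists_abs_bias_le hf N
    rw [Metric.tendstoUniformlyOn_iff]
    intro ε hε
    -- The scaled error is a² - b² = (a - b)(a + b). The cap 1 gives |a + b| ≤ 2B + 1, and the other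
    -- bound then makes the product at most ε/2.
    set η := min 1 (ε / (2 * (2 * B + 1))) with hη
    have hη0 : 0 < η := lt_min one_pos (by positivity)
    filter_upwards [hm.eventually (eventually_abs_mul_estimatorMean_sub_le hd hf N hδ hη0),
      hm.eventually_gt_atTop 0] with n hn hmn x hx
    have h := hn x hx.1 hx.2
    have hb := hB x hx.1
    have hm' : (m n : ℝ) ≠ 0 := by positivity
    set a := (m n : ℝ) * (estimatorMean N f (m n) x - f x) with ha
    set b := N.bias f x with hbdef
    have e : ((estimatorMean N f (m n) x - f x) ^ 2 - ((m n : ℝ) ^ 2)⁻¹ * b ^ 2) * (m n : ℝ) ^ 2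
        = (a - b) * (a - b + 2 * b) := by
      rw [ha]
      field_simp
      ring
    have h1 : |a - b + 2 * b| ≤ 2 * B + 1 := by
      refine (abs_add_le _ _).trans ?_
      rw [abs_mul, abs_two]
      have : η ≤ 1 := min_le_left _ _
      linarith
    rw [dist_zero_left, Real.norm_eq_abs, e, abs_mul]
    calc |a - b| * |a - b + 2 * b| ≤ η * (2 * B + 1) := by gcongr
      _ ≤ ε / (2 * (2 * B + 1)) * (2 * B + 1) := by gcongr; exact min_le_right _ _
      _ = ε / 2 := by field_simp
      _ < ε := half_lt_self hε

end Asymptotics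

/-! ### Optimization of the risk -/

section Optimization

/-- In the variable u = m / n^{2/(d+4)}, the variance term and the squared bias term scale with the
same power n^{-4/(d+4)}; the next lemma treats the latter. -/
theorem inv_mul_rpow_half_eq {d n m : ℕ} (hn : 0 < n) :
    (n : ℝ)⁻¹ * (m : ℝ) ^ ((d : ℝ) / 2)
      = (n : ℝ) ^ (-(4 / ((d : ℝ) + 4)))
        * ((m : ℝ) / (n : ℝ) ^ (2 / ((d : ℝ) + 4))) ^ ((d : ℝ) / 2) := by
  have hn' : (0 : ℝ) < n := by positivity
  have hd : (0 : ℝ) < (d : ℝ) + 4 := by positivity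
  rw [Real.div_rpow (Nat.cast_nonneg m) (by positivity), ← Real.rpow_mul hn'.le, mul_div_assoc',
    mul_comm ((n : ℝ) ^ (-(4 / ((d : ℝ) + 4)))), mul_div_assoc, ← Real.rpow_sub hn']
  have : -(4 / ((d : ℝ) + 4)) - 2 / ((d : ℝ) + 4) * (d / 2) = -1 := by
    field_simp
    ring
  rw [this, Real.rpow_neg_one, mul_comm]

theorem inv_sq_eq {d n m : ℕ} (hn : 0 < n) :
    ((m : ℝ) ^ 2)⁻¹
      = (n : ℝ) ^ (-(4 / ((d : ℝ) + 4)))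
        * (((m : ℝ) / (n : ℝ) ^ (2 / ((d : ℝ) + 4))) ^ 2)⁻¹ := by
  have hn' : (0 : ℝ) < n := by positivity
  have h : (n : ℝ) ^ (-(4 / ((d : ℝ) + 4))) = (((n : ℝ) ^ (2 / ((d : ℝ) + 4))) ^ 2)⁻¹ := by
    rw [Real.rpow_neg hn'.le, ← Real.rpow_natCast, ← Real.rpow_mul hn'.le]
    congr 2
    push_cast
    ring
  rw [h, div_pow]
  have : (n : ℝ) ^ (2 / ((d : ℝ) + 4)) ≠ 0 := by positivity
  field_simp

/-- Up to a factor, the leading part of the risk in terms of `z = m / mOpt` is the left side; it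
has a unique minimum at `z = 1`. -/
theorem le_four_div_mul_rpow_add {d : ℕ} (hd : 1 ≤ d) {z : ℝ} (hz : 0 < z) :
    4 / (d : ℝ) + 1 + (z⁻¹ - 1) ^ 2 ≤ 4 / (d : ℝ) * z ^ ((d : ℝ) / 2) + (z ^ 2)⁻¹ := by
  have hd' : (0 : ℝ) < d := by positivity
  -- Linearizing the exponential gives (4/d) z^{d/2} ≥ 4/d + 2 log z, and log z ≥ 1 - 1/z. Adding
  -- z⁻² completes the square.
  have h1 : (d : ℝ) / 2 * Real.log z + 1 ≤ z ^ ((d : ℝ) / 2) := by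
    rw [Real.rpow_def_of_pos hz, mul_comm (Real.log z)]
    exact Real.add_one_le_exp _
  have h2 : -Real.log z ≤ z⁻¹ - 1 := by
    rw [← Real.log_inv]
    exact Real.log_le_sub_one_of_pos (by positivity)
  have h3 := mul_le_mul_of_nonneg_left h1 (by positivity : 0 ≤ 4 / (d : ℝ))
  have h4 : 4 / (d : ℝ) * (d / 2 * Real.log z + 1) = 2 * Real.log z + 4 / d := by
    field_simp
    ring
  have h5 : (z ^ 2)⁻¹ = z⁻¹ ^ 2 := (inv_pow z 2).symm
  rw [h5]
  nlinarith

variable {d : ℕ} {V B : ℝ} {v w : ℕ → ℝ} {R : ℕ → ℕ → ℝ}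

theorem tendsto_atTop_of_tendsto_rpow_mul_inv {lam : ℝ} (hlam : 0 < lam) {m : ℕ → ℕ}
    (hm : Tendsto (fun n : ℕ => (n : ℝ) ^ (2 / ((d : ℝ) + 4)) * (m n : ℝ)⁻¹) atTop (𝓝 lam)) :
    Tendsto m atTop atTop := by
  have hpow : Tendsto (fun n : ℕ => (n : ℝ) ^ (2 / ((d : ℝ) + 4))) atTop atTop :=
    (tendsto_rpow_atTop (by positivity)).comp tendsto_natCast_atTop_atTop
  have h := hpow.atTop_mul_pos (inv_pos.2 hlam) (hm.inv₀ hlam.ne')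
  refine tendsto_natCast_atTop_iff (R := ℝ).1 (h.congr' ?_)
  filter_upwards [eventually_gt_atTop 0] with n hn
  have : (n : ℝ) ^ (2 / ((d : ℝ) + 4)) ≠ 0 := by positivity
  rw [mul_inv, inv_inv, ← mul_assoc, mul_inv_cancel₀ this, one_mul]

/-- Only the two-term shape of the risk and the limits of `v` and `w` enter here, so the
optimization is separate from the estimator. -/
theorem isLittleO_risk_sub (hv : Tendsto v atTop (𝓝 V)) (hw : Tendsto w atTop (𝓝 B))
    (hR : ∀ n m, 0 < n → 0 < m →
      R n m = (n : ℝ)⁻¹ * (m : ℝ) ^ ((d : ℝ) / 2) * v m + ((m : ℝ) ^ 2)⁻¹ * w m)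
    {lam : ℝ} (hlam : 0 < lam) {m : ℕ → ℕ}
    (hm : Tendsto (fun n : ℕ => (n : ℝ) ^ (2 / ((d : ℝ) + 4)) * (m n : ℝ)⁻¹) atTop (𝓝 lam)) :
    (fun n : ℕ => R n (m n) - (n : ℝ) ^ (-(4 / ((d : ℝ) + 4)))
        * (lam ^ (-((d : ℝ) / 2)) * V + lam ^ 2 * B))
      =o[atTop] fun n : ℕ => (n : ℝ) ^ (-(4 / ((d : ℝ) + 4))) := by
  have hmT := tendsto_atTop_of_tendsto_rpow_mul_inv hlam hm
  set s : ℕ → ℝ := fun n => (n : ℝ) ^ (2 / ((d : ℝ) + 4)) * (m n : ℝ)⁻¹ with hs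
  have hlim := ((((hm.rpow_const (p := -((d : ℝ) / 2)) (Or.inl hlam.ne')).mul (hv.comp hmT)).add
    ((hm.pow 2).mul (hw.comp hmT))).sub_const (lam ^ (-((d : ℝ) / 2)) * V + lam ^ 2 * B))
  rw [sub_self] at hlim
  have ho : (fun n : ℕ => (n : ℝ) ^ (-(4 / ((d : ℝ) + 4))) * (s n ^ (-((d : ℝ) / 2)) * v (m n)
      + s n ^ 2 * w (m n) - (lam ^ (-((d : ℝ) / 2)) * V + lam ^ 2 * B)))
      =o[atTop] fun n : ℕ => (n : ℝ) ^ (-(4 / ((d : ℝ) + 4))) * 1 :=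
    (isBigO_refl _ _).mul_isLittleO ((isLittleO_one_iff ℝ).2 hlim)
  simp only [mul_one] at ho
  refine ho.congr' ?_ EventuallyEq.rfl
  filter_upwards [eventually_gt_atTop 0, hmT.eventually_gt_atTop 0] with n hn hmn
  have hsn : s n = ((m n : ℝ) / (n : ℝ) ^ (2 / ((d : ℝ) + 4)))⁻¹ := by
    rw [inv_div]
    exact (div_eq_mul_inv _ _).symm
  have hu : 0 < (m n : ℝ) / (n : ℝ) ^ (2 / ((d : ℝ) + 4)) := by positivity
  rw [hR n (m n) hn hmn, inv_mul_rpow_half_eq hn, inv_sq_eq (d := d) hn, hsn,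
    Real.inv_rpow hu.le, Real.rpow_neg hu.le, inv_inv, inv_pow]
  ring

/-- The ratio of the optimal bandwidth to `n ^ (2 / (d + 4))`. -/
noncomputable def optimalScale (d : ℕ) (V B : ℝ) : ℝ :=
  (4 / (d : ℝ) * (B / V)) ^ (2 / ((d : ℝ) + 4))

theorem optimalScale_pos (hd : 1 ≤ d) (hV : 0 < V) (hB : 0 < B) : 0 < optimalScale d V B := by
  have : (0 : ℝ) < d := by positivity
  rw [optimalScale]
  positivity

/-- The stationarity condition: at the optimum the variance term is 4/d times the squared bias term.
-/
theorem optimalScale_rpow_half_mul (hd : 1 ≤ d) (hV : 0 < V) (hB : 0 < B) :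
    optimalScale d V B ^ ((d : ℝ) / 2) * V = 4 / (d : ℝ) * (B * (optimalScale d V B ^ 2)⁻¹) := by
  have hd' : (0 : ℝ) < d := by positivity
  have hM := optimalScale_pos hd hV hB
  have h : optimalScale d V B ^ ((d : ℝ) / 2) * optimalScale d V B ^ 2
      = 4 / (d : ℝ) * (B / V) := by
    rw [← Real.rpow_natCast _ 2, ← Real.rpow_add hM, optimalScale,
      ← Real.rpow_mul (by positivity)]
    have : 2 / ((d : ℝ) + 4) * ((d : ℝ) / 2 + (2 : ℕ)) = 1 := by
      push_cast
      field_simp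
      ring
    rw [this, Real.rpow_one]
  rw [← mul_right_inj' (pow_ne_zero 2 hM.ne')]
  have e : optimalScale d V B ^ 2 * (optimalScale d V B ^ ((d : ℝ) / 2) * V)
      = optimalScale d V B ^ ((d : ℝ) / 2) * optimalScale d V B ^ 2 * V := by ring
  rw [e, h]
  field_simp

theorem risk_optimalScale (hd : 1 ≤ d) (hV : 0 < V) (hB : 0 < B) :
    (optimalScale d V B)⁻¹ ^ (-((d : ℝ) / 2)) * V + (optimalScale d V B)⁻¹ ^ 2 * B
      = (4 / (d : ℝ) + 1) / (4 / (d : ℝ)) ^ (4 / ((d : ℝ) + 4))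
        * (V ^ (4 / ((d : ℝ) + 4)) / B ^ (-((d : ℝ) / ((d : ℝ) + 4)))) := by
  have hd' : (0 : ℝ) < d := by positivity
  have hM := optimalScale_pos hd hV hB
  rw [Real.inv_rpow hM.le, Real.rpow_neg hM.le, inv_inv, optimalScale_rpow_half_mul hd hV hB]
  have h2 : optimalScale d V B ^ 2
      = (4 / (d : ℝ)) ^ (4 / ((d : ℝ) + 4)) * (B ^ (4 / ((d : ℝ) + 4))
        / V ^ (4 / ((d : ℝ) + 4))) := by
    rw [optimalScale, ← Real.rpow_natCast _ 2, ← Real.rpow_mul (by positivity),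
      ← Real.div_rpow hB.le hV.le, ← Real.mul_rpow (by positivity) (by positivity)]
    congr 1
    push_cast
    ring
  have h3 : B ^ ((d : ℝ) / ((d : ℝ) + 4)) * B ^ (4 / ((d : ℝ) + 4)) = B := by
    rw [← Real.rpow_add hB, ← add_div, div_self (by positivity), Real.rpow_one]
  rw [inv_pow, h2, Real.rpow_neg hB.le]
  have p1 : 0 < B ^ (4 / ((d : ℝ) + 4)) := by positivity
  have p2 : 0 < V ^ (4 / ((d : ℝ) + 4)) := by positivity
  have p3 : 0 < (4 / (d : ℝ)) ^ (4 / ((d : ℝ) + 4)) := by positivity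
  have p4 : 0 < B ^ ((d : ℝ) / ((d : ℝ) + 4)) := by positivity
  generalize B ^ (4 / ((d : ℝ) + 4)) = b1 at *
  generalize B ^ ((d : ℝ) / ((d : ℝ) + 4)) = b2 at *
  generalize V ^ (4 / ((d : ℝ) + 4)) = v1 at *
  generalize (4 / (d : ℝ)) ^ (4 / ((d : ℝ) + 4)) = c1 at *
  rw [← h3]
  field_simp

theorem tendsto_rpow_mul_inv_of_tendsto_div (hd : 1 ≤ d) (hV : 0 < V) (hB : 0 < B) {m : ℕ → ℕ}
    (hm : Tendsto (fun n : ℕ => (m n : ℝ)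
      / ((n : ℝ) ^ (2 / ((d : ℝ) + 4)) * optimalScale d V B)) atTop (𝓝 1)) :
    Tendsto (fun n : ℕ => (n : ℝ) ^ (2 / ((d : ℝ) + 4)) * (m n : ℝ)⁻¹) atTop
      (𝓝 (optimalScale d V B)⁻¹) := by
  have hM := optimalScale_pos hd hV hB
  have h := (hm.inv₀ one_ne_zero).mul_const (optimalScale d V B)⁻¹
  rw [inv_one, one_mul] at h
  refine h.congr fun n => ?_
  rw [inv_div]
  field_simp

theorem risk_le (hd : 1 ≤ d) (hV : 0 < V) (hB : 0 < B)
    (hv : Tendsto v atTop (𝓝 V)) (hw : Tendsto w atTop (𝓝 B))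
    (hR : ∀ n m, 0 < n → 0 < m →
      R n m = (n : ℝ)⁻¹ * (m : ℝ) ^ ((d : ℝ) / 2) * v m + ((m : ℝ) ^ 2)⁻¹ * w m)
    {m : ℕ → ℕ} (hm : Tendsto (fun n : ℕ => (m n : ℝ)
      / ((n : ℝ) ^ (2 / ((d : ℝ) + 4)) * optimalScale d V B)) atTop (𝓝 1))
    {η : ℝ} (hη : 0 < η) :
    ∀ᶠ n : ℕ in atTop, R n (m n) ≤ (n : ℝ) ^ (-(4 / ((d : ℝ) + 4)))
      * (B * (optimalScale d V B ^ 2)⁻¹) * ((1 + η) * (4 / (d : ℝ) + 1)) := by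
  have hM := optimalScale_pos hd hV hB
  have ho := isLittleO_risk_sub hv hw hR (inv_pos.2 hM)
    (tendsto_rpow_mul_inv_of_tendsto_div hd hV hB hm)
  rw [Real.inv_rpow hM.le, Real.rpow_neg hM.le, inv_inv, optimalScale_rpow_half_mul hd hV hB,
    inv_pow] at ho
  have hc : 0 < η * (B * (optimalScale d V B ^ 2)⁻¹ * (4 / (d : ℝ) + 1)) := by positivity
  filter_upwards [ho.def hc] with n hn
  have ht : 0 ≤ (n : ℝ) ^ (-(4 / ((d : ℝ) + 4))) := by positivity
  rw [Real.norm_eq_abs, Real.norm_of_nonneg ht] at hn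
  have := le_of_abs_le hn
  linarith

/-- The lower bound keeps the excess (1/z - 1)², which later forces z → 1. It holds along every
sequence m → ∞, whatever its order. -/
theorem le_risk (hd : 1 ≤ d) (hV : 0 < V) (hB : 0 < B)
    (hv : Tendsto v atTop (𝓝 V)) (hw : Tendsto w atTop (𝓝 B))
    (hR : ∀ n m, 0 < n → 0 < m →
      R n m = (n : ℝ)⁻¹ * (m : ℝ) ^ ((d : ℝ) / 2) * v m + ((m : ℝ) ^ 2)⁻¹ * w m)
    {m : ℕ → ℕ} (hm : Tendsto m atTop atTop) {η : ℝ} (hη : 0 < η) (hη1 : η < 1) :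
    ∀ᶠ n : ℕ in atTop, (n : ℝ) ^ (-(4 / ((d : ℝ) + 4)))
      * (B * (optimalScale d V B ^ 2)⁻¹) * ((1 - η) * (4 / (d : ℝ) + 1
        + (((m n : ℝ) / ((n : ℝ) ^ (2 / ((d : ℝ) + 4)) * optimalScale d V B))⁻¹ - 1) ^ 2))
      ≤ R n (m n) := by
  have hM := optimalScale_pos hd hV hB
  have hv' : ∀ᶠ n in atTop, (1 - η) * V < v (m n) :=
    (hv.comp hm).eventually (lt_mem_nhds (by nlinarith))
  have hw' : ∀ᶠ n in atTop, (1 - η) * B < w (m n) :=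
    (hw.comp hm).eventually (lt_mem_nhds (by nlinarith))
  filter_upwards [hv', hw', eventually_gt_atTop 0, hm.eventually_gt_atTop 0] with n hvn hwn hn hmn
  have ht : 0 < (n : ℝ) ^ (-(4 / ((d : ℝ) + 4))) := by positivity
  rw [hR n (m n) hn hmn, inv_mul_rpow_half_eq hn, inv_sq_eq (d := d) hn]
  have hpow : 0 < (n : ℝ) ^ (2 / ((d : ℝ) + 4)) := by positivity
  set M := optimalScale d V B with hMdef
  set z := (m n : ℝ) / ((n : ℝ) ^ (2 / ((d : ℝ) + 4)) * M) with hz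
  have hz0 : 0 < z := by positivity
  have hu : (m n : ℝ) / (n : ℝ) ^ (2 / ((d : ℝ) + 4)) = M * z := by
    rw [hz]
    field_simp
  rw [hu]
  set t := (n : ℝ) ^ (-(4 / ((d : ℝ) + 4)))
  have hη' : 0 < 1 - η := by linarith
  calc t * (B * (M ^ 2)⁻¹) * ((1 - η) * (4 / (d : ℝ) + 1 + (z⁻¹ - 1) ^ 2))
      ≤ t * (B * (M ^ 2)⁻¹) * ((1 - η) * (4 / (d : ℝ) * z ^ ((d : ℝ) / 2) + (z ^ 2)⁻¹)) := by
        exact mul_le_mul_of_nonneg_left (mul_le_mul_of_nonneg_left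
          (le_four_div_mul_rpow_add hd hz0) hη'.le) (by positivity)
    _ = t * (1 - η) * ((4 / (d : ℝ) * (B * (M ^ 2)⁻¹)) * z ^ ((d : ℝ) / 2)
          + (M ^ 2)⁻¹ * (z ^ 2)⁻¹ * B) := by ring
    _ = t * (M * z) ^ ((d : ℝ) / 2) * ((1 - η) * V) + t * ((M * z) ^ 2)⁻¹ * ((1 - η) * B) := by
        rw [← optimalScale_rpow_half_mul hd hV hB, Real.mul_rpow hM.le hz0.le, mul_pow, mul_inv]
        ring
    _ ≤ t * (M * z) ^ ((d : ℝ) / 2) * v (m n) + t * ((M * z) ^ 2)⁻¹ * w (m n) := by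
        gcongr

/-- An optimal sequence is compared with the rounded-up optimal bandwidth, and the excess (1/z - 1)²
is squeezed to zero. Conversely, z → 1 attains the lower bound valid for every competitor. -/
theorem isAsympOptimal_iff (hd : 1 ≤ d) (hV : 0 < V) (hB : 0 < B)
    (hv : Tendsto v atTop (𝓝 V)) (hw : Tendsto w atTop (𝓝 B))
    (hR : ∀ n m, 0 < n → 0 < m →
      R n m = (n : ℝ)⁻¹ * (m : ℝ) ^ ((d : ℝ) / 2) * v m + ((m : ℝ) ^ 2)⁻¹ * w m) (m : ℕ → ℕ) :
    IsAsympOptimal R m ↔ Tendsto (fun n : ℕ => (m n : ℝ)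
      / ((n : ℝ) ^ (2 / ((d : ℝ) + 4)) * optimalScale d V B)) atTop (𝓝 1) := by
  have hM := optimalScale_pos hd hV hB
  have hd' : (0 : ℝ) < d := by positivity
  have hopt : Tendsto (fun n : ℕ => (n : ℝ) ^ (2 / ((d : ℝ) + 4)) * optimalScale d V B)
      atTop atTop :=
    ((tendsto_rpow_atTop (by positivity)).comp tendsto_natCast_atTop_atTop).atTop_mul_const hM
  have hc0 : 0 < 4 / (d : ℝ) + 1 := by positivity
  constructor
  · rintro ⟨hm, hcomp⟩
    set z : ℕ → ℝ := fun n => (m n : ℝ)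
      / ((n : ℝ) ^ (2 / ((d : ℝ) + 4)) * optimalScale d V B) with hz
    set m' : ℕ → ℕ := fun n => ⌈(n : ℝ) ^ (2 / ((d : ℝ) + 4)) * optimalScale d V B⌉₊ with hm'
    have hceil : Tendsto (fun n : ℕ => (m' n : ℝ)
        / ((n : ℝ) ^ (2 / ((d : ℝ) + 4)) * optimalScale d V B)) atTop (𝓝 1) :=
      (tendsto_nat_ceil_div_atTop (R := ℝ)).comp hopt
    have hm'T : Tendsto m' atTop atTop := tendsto_nat_ceil_atTop.comp hopt
    have hsq : Tendsto (fun n => ((z n)⁻¹ - 1) ^ 2) atTop (𝓝 0) := by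
      rw [Metric.tendsto_nhds]
      intro ε hε
      -- With c = 4/d + 1 and y the excess, (1 - η)(c + y) ≤ (1 + η)²c gives (1 - η)y ≤ (3η + η²)c <
      -- 4ηc, hence y < 8ηc ≤ ε.
      set η := min (1 / 2) (ε / (8 * (4 / (d : ℝ) + 1))) with hη
      have hη0 : 0 < η := lt_min (by norm_num) (by positivity)
      have hη2 : η ≤ 1 / 2 := min_le_left _ _
      have hηε : 8 * η * (4 / (d : ℝ) + 1) ≤ ε := by
        have : η ≤ ε / (8 * (4 / (d : ℝ) + 1)) := min_le_right _ _
        rw [le_div_iff₀ (by positivity)] at this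
        linarith
      filter_upwards [hcomp m' hm'T η hη0, risk_le hd hV hB hv hw hR hceil hη0,
        le_risk hd hV hB hv hw hR hm hη0 (by linarith), eventually_gt_atTop 0] with n h1 h2 h3 hn
      have ht : 0 < (n : ℝ) ^ (-(4 / ((d : ℝ) + 4))) * (B * (optimalScale d V B ^ 2)⁻¹) := by
        positivity
      have h4 := h3.trans (h1.trans (mul_le_mul_of_nonneg_left h2 (by linarith)))
      rw [mul_left_comm (1 + η)] at h4
      have h5 := le_of_mul_le_mul_left h4 ht
      change (1 - η) * (4 / (d : ℝ) + 1 + ((z n)⁻¹ - 1) ^ 2) ≤ _ at h5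
      rw [Real.dist_eq, sub_zero, abs_of_nonneg (sq_nonneg _)]
      generalize 4 / (d : ℝ) + 1 = c at *
      have hy := sq_nonneg ((z n)⁻¹ - 1)
      generalize ((z n)⁻¹ - 1) ^ 2 = y at *
      have h6 : (1 - η) * y ≤ (3 * η + η ^ 2) * c := by linarith
      have h7 : 1 / 2 * y ≤ (1 - η) * y := mul_le_mul_of_nonneg_right (by linarith) hy
      have h8 : (3 * η + η ^ 2) * c < 4 * η * c :=
        mul_lt_mul_of_pos_right (by nlinarith) hc0
      linarith
    have habs : Tendsto (fun n => (z n)⁻¹ - 1) atTop (𝓝 0) := by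
      have h := (Real.continuous_sqrt.tendsto 0).comp hsq
      rw [Real.sqrt_zero] at h
      refine tendsto_zero_iff_abs_tendsto_zero _ |>.2 (h.congr fun n => ?_)
      simp only [Function.comp_apply]
      exact Real.sqrt_sq_eq_abs _
    have hinv := (habs.add_const 1).inv₀ (by norm_num)
    simpa using hinv
  · intro hm
    have hmT : Tendsto m atTop atTop := tendsto_atTop_of_tendsto_rpow_mul_inv (inv_pos.2 hM)
      (tendsto_rpow_mul_inv_of_tendsto_div hd hV hB hm)
    refine ⟨hmT, fun m' hm' ε hε => ?_⟩
    -- The solution of 1 + η = (1 + ε)(1 - η).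
    set η := ε / (2 + ε) with hη
    have hη0 : 0 < η := by positivity
    have hη1 : η < 1 := by rw [hη, div_lt_one (by positivity)]; linarith
    have hηε : 1 + η = (1 + ε) * (1 - η) := by
      rw [hη]
      field_simp
      ring
    filter_upwards [risk_le hd hV hB hv hw hR hm hη0,
      le_risk hd hV hB hv hw hR hm' hη0 hη1] with n h1 h2
    refine h1.trans (le_trans ?_ (mul_le_mul_of_nonneg_left h2 (by linarith)))
    have ht : 0 ≤ (n : ℝ) ^ (-(4 / ((d : ℝ) + 4))) * (B * (optimalScale d V B ^ 2)⁻¹) := by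
      positivity
    rw [mul_left_comm (1 + ε), hηε]
    refine mul_le_mul_of_nonneg_left ?_ ht
    rw [mul_assoc]
    refine mul_le_mul_of_nonneg_left ?_ (by linarith)
    exact mul_le_mul_of_nonneg_left (le_add_of_nonneg_right (sq_nonneg _)) (by linarith)

end Optimization

end BernsteinSimplex

/-! ### The main theorem -/

open BernsteinSimplex
theorem mainTheorem11 {d : ℕ} (hd : 1 ≤ d) {Ω : Type*} [MeasurableSpace Ω]
    (P : Measure Ω) [IsProbabilityMeasure P]
    (f : (Fin d → ℝ) → ℝ) (hf : ContDiffOn ℝ 2 f (simplex d))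
    (hf_nonneg : ∀ y ∈ simplex d, 0 ≤ f y)
    (X : ℕ → Ω → Fin d → ℝ) (hX_meas : ∀ i, Measurable (X i)) (hX_indep : iIndepFun X P)
    (hX_law : ∀ i, P.map (X i) =
      (volume.restrict (simplex d)).withDensity fun y => ENNReal.ofReal (f y))
    (N : Normalization) :
    -- expansion of the mean squared error
    (∀ m : ℕ → ℕ, Tendsto m atTop atTop →
      ∃ r₁ r₂ : ℕ → (Fin d → ℝ) → ℝ,
        (∀ n : ℕ, ∀ x ∈ simplexInt d,
          mse P N X f n (m n) x =
            (n : ℝ)⁻¹ * (m n : ℝ) ^ ((d : ℝ) / 2) * (psi x * f x)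
              + ((m n : ℝ) ^ 2)⁻¹ * N.bias f x ^ 2 + r₁ n x + r₂ n x) ∧
        (∀ x ∈ simplexInt d,
          (fun n => r₁ n x) =o[atTop] fun n => (n : ℝ)⁻¹ * (m n : ℝ) ^ ((d : ℝ) / 2)) ∧
        (∀ δ : ℝ, 0 < δ →
          TendstoUniformlyOn (fun n x => r₂ n x * (m n : ℝ) ^ 2) (fun _ => 0) atTop
            {x | x ∈ simplexInt d ∧ (d = 1 ∨ l1 x ≤ 1 - δ)})) ∧
    -- the optimal bandwidth and its mean squared error
    (∀ x ∈ simplexInt d, f x * N.bias f x ≠ 0 →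
      (∀ m : ℕ → ℕ,
        IsAsympOptimal (fun n k => mse P N X f n k x) m ↔
          Tendsto (fun n => (m n : ℝ) / mOpt N f x n) atTop (𝓝 1)) ∧
      (∀ m : ℕ → ℕ, Tendsto (fun n => (m n : ℝ) / mOpt N f x n) atTop (𝓝 1) →
        (fun n : ℕ => mse P N X f n (m n) x
            - (n : ℝ) ^ (-(4 / ((d : ℝ) + 4)))
              * ((4 / (d : ℝ) + 1) / (4 / (d : ℝ)) ^ (4 / ((d : ℝ) + 4)))
              * ((psi x * f x) ^ (4 / ((d : ℝ) + 4))
                  / (N.bias f x ^ 2) ^ (-((d : ℝ) / ((d : ℝ) + 4)))))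
          =o[atTop] fun n : ℕ => (n : ℝ) ^ (-(4 / ((d : ℝ) + 4))))) ∧
    -- bandwidths of the optimal order
    (∀ x ∈ simplexInt d, ∀ lam : ℝ, 0 < lam → ∀ m : ℕ → ℕ,
      Tendsto (fun n : ℕ => (n : ℝ) ^ (2 / ((d : ℝ) + 4)) * (m n : ℝ)⁻¹) atTop (𝓝 lam) →
        (fun n : ℕ => mse P N X f n (m n) x
            - (n : ℝ) ^ (-(4 / ((d : ℝ) + 4)))
              * (lam ^ (-((d : ℝ) / 2)) * (psi x * f x) + lam ^ 2 * N.bias f x ^ 2))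
          =o[atTop] fun n : ℕ => (n : ℝ) ^ (-(4 / ((d : ℝ) + 4)))) := by
  -- The scaled variance and the scaled squared bias depend on `m` only, so the risk has the
  -- two-term shape for all positive n and m.
  have hexp : ∀ x ∈ simplexInt d, ∃ v w : ℕ → ℝ, Tendsto v atTop (𝓝 (psi x * f x)) ∧
      Tendsto w atTop (𝓝 (N.bias f x ^ 2)) ∧ ∀ n m, 0 < n → 0 < m →
        mse P N X f n m x
          = (n : ℝ)⁻¹ * (m : ℝ) ^ ((d : ℝ) / 2) * v m + ((m : ℝ) ^ 2)⁻¹ * w m := by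
    intro x hx
    refine ⟨_, _, tendsto_estimatorVariance hd hf N hx,
      (tendsto_mul_estimatorMean_sub hd hf N hx).pow 2, fun n m hn hm => ?_⟩
    rw [mse_eq P hf hf_nonneg X hX_meas hX_indep hX_law N hn hm, natCast_rpow_half]
    have h1 : √(m : ℝ) ≠ 0 := by positivity
    have h2 : (m : ℝ) ≠ 0 := by positivity
    field_simp
  refine ⟨fun m hm => mse_expansion hd P hf hf_nonneg X hX_meas hX_indep hX_law N hm,
    fun x hx hfb => ?_, fun x hx lam hlam m hm => ?_⟩
  · obtain ⟨v, w, hv, hw, hR⟩ := hexp x hx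
    have hfx : 0 < f x := (hf_nonneg x (mem_simplex_of_mem_simplexInt hx)).lt_of_ne'
      (left_ne_zero_of_mul hfb)
    have hV : 0 < psi x * f x := mul_pos (psi_pos hx) hfx
    have hB : 0 < N.bias f x ^ 2 := by
      have := right_ne_zero_of_mul hfb
      positivity
    -- `mOpt` unfolds to n^{2/(d+4)} times `optimalScale` with V = ψ(x)f(x) and B = b(x)².
    refine ⟨fun m => isAsympOptimal_iff hd hV hB hv hw hR m, fun m hm => ?_⟩
    have h := isLittleO_risk_sub hv hw hR (inv_pos.2 (optimalScale_pos hd hV hB))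
      (tendsto_rpow_mul_inv_of_tendsto_div hd hV hB hm)
    rw [risk_optimalScale hd hV hB] at h
    simpa only [mul_assoc] using h
  · obtain ⟨v, w, hv, hw, hR⟩ := hexp x hx
    exact isLittleO_risk_sub hv hw hR hlam hm
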